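/- Let $\mathbb{C}\langle\eta\rangle$ be the differential field of rational functions in independent variables $\eta,\eta',\eta'',\dots$ over $\mathbb C$, with derivation $\partial\eta^{(n)}=\eta^{(n+1)}$. A matrix $g=\begin{pmatrix}a&b\\c&d\end{pmatrix}$ of $G=SL(2,\mathbb{C})$ acts on it by the unique automorphism that commutes with $\partial$ and sends $\eta$ to $\frac{a\eta+c}{b\eta+d}$. Let $B\subset G$ be the subgroup of lower triangular matrices, $H\subset B$ the subgroup of diagonal matrices and $N\subset B$ the subgroup of unipotent matrices. For a subgroup $S$ let $\mathbb{C}\langle\eta\rangle^S$ be the field of $S$-invariants, and let $\mathbb C\langle P\rangle$ denote the differential subfield generated by $P$. The Poisson bracket of $\mathbb{C}\langle\eta\rangle$ is the extension to densities of the basic bracket $\{\eta(x),\eta(y)\}$ given in (ii): for $P,Q\in\mathbb{C}\langle\eta\rangle$, $\{P(x),Q(y)\}=\sum_{i,j}\frac{\partial P}{\partial\eta^{(i)}}(x)\frac{\partial Q}{\partial\eta^{(j)}}(y)\,\partial_x^i\partial_y^j\{\eta(x),\eta(y)\}$, a distribution in $(x,y)\in U\times U$ depending on the curve $\eta$, defined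 for every smooth curve $\eta:U\to\mathbb C$, $U\subset\mathbb R$ open, along which $P$ and $Q$ have no poles. It is skew-symmetric, satisfies the Leibniz rule, is compatible with $\partial$ (that is, $\{(\partial P)(x),Q(y)\}=\partial_x\{P(x),Q(y)\}$), and satisfies the Jacobi identity (for the local functionals $\int fP\,dx$, with $f$ a test function). Below, $\delta$ denotes the derivative of the function $\mathrm{sign}$, i.e. $\delta=2\delta_{\mathrm{Dirac}}$. Then: (i) For $S=H,N,B,G$ the field $\mathbb{C}\langle\eta\rangle^S$ is a differential subfield, and $$\mathbb{C}\langle\eta\rangle^G\subset\mathbb{C}\langle\eta\rangle^B\subset\mathbb{C}\langle\eta\rangle^H\subset\mathbb{C}\langle\eta\rangle,\qquad \mathbb{C}\langle\eta\rangle^B\subset\mathbb{C}\langle\eta\rangle^N\subset\mathbb{C}\langle\eta\rangle .$$ All these inclusions are Poisson morphisms: for $P,Q\in\mathbb{C}\langle\eta\rangle^S$ the bracket $\{P(x),Q(y)\}$ is again an $S$-invariant function of the curve $\eta$ (it takes the same value at $\eta$ and at $\frac{a\eta+c}{b\eta+d}$ for every $g\in S$ such that $b\eta+d$ has no zeros on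 $U$, and $P,Q$ have no poles along the transformed curve if they have none along $\eta$). (ii) $\{\eta(x),\eta(y)\}=\eta(x)^2-\eta(y)^2-\mathrm{sign}(x-y)\,(\eta(x)-\eta(y))^2$. This is the bracket of the ratios $\eta=\phi/\psi$ induced by the exchange bracket $\{\phi(x),\phi(y)\}=a\,\phi(x)\phi(y)$, $\{\psi(x),\psi(y)\}=a\,\psi(x)\psi(y)$, $\{\phi(x),\psi(y)\}=(a-c)\,\phi(x)\psi(y)+(c+1)\,\psi(x)\phi(y)$, $\{\psi(x),\phi(y)\}=(a-c)\,\psi(x)\phi(y)+(c-1)\,\phi(x)\psi(y)$ of wave functions, where $c=\mathrm{sign}(x-y)$ and $a=a(x-y)$ with an arbitrary odd function $a$. (iii) $\mathbb{C}\langle\eta\rangle^N=\mathbb{C}\langle\theta\rangle$ with $\theta=\eta'$; the derivatives $\theta,\theta',\theta'',\dots$ are algebraically independent over $\mathbb C$; and $\{\theta(x),\theta(y)\}=2\,\mathrm{sign}(x-y)\,\theta(x)\theta(y)$. (iv) $\mathbb{C}\langle\eta\rangle^B=\mathbb{C}\langle v\rangle$ with $v=\tfrac12\eta''/\eta'=\tfrac12\theta'/\theta$,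 and along curves with $\eta'\neq0$ $$\{v(x),v(y)\}=-\tfrac12\delta'(x-y).$$ (v) $\mathbb{C}\langle\eta\rangle^G=\mathbb{C}\langle u\rangle$ with $u=\tfrac12S(\eta)=v'-v^2$, where $S(\eta)=\frac{\eta'''}{\eta'}-\frac32\left(\frac{\eta''}{\eta'}\right)^2$, and along curves with $\eta'\neq0$ $$\{u(x),u(y)\}=\tfrac12\delta'''(x-y)+\delta'(x-y)\,\bigl[u(x)+u(y)\bigr].$$ (In terms of the Dirac function, the last two brackets are $-\delta_{\mathrm{Dirac}}'(x-y)$ and $\delta_{\mathrm{Dirac}}'''(x-y)+2\delta_{\mathrm{Dirac}}'(x-y)[u(x)+u(y)]$.) -/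

import Mathlib

open scoped ContDiff
open MvPolynomial

noncomputable section

namespace EtaTower

/-! ### Rational functions in a family of variables, and derivations of them -/

/-- The field `ℂ(X_i : i ∈ σ)` of rational functions. -/
abbrev RatFn (σ : Type) : Type := FractionRing (MvPolynomial σ ℂ)

/-- The variable `X_i`, as a rational function. -/
def var {σ : Type} (i : σ) : RatFn σ := algebraMap (MvPolynomial σ ℂ) (RatFn σ) (X i)

/-- The derivation of the polynomial ring, with values in rational functions, with `X_i ↦ f i`. -/
def polyDer {σ : Type} (f : σ → RatFn σ) : Derivation ℂ (MvPolynomial σ ℂ) (RatFn σ) :=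
  mkDerivation ℂ f

/-- The quotient rule. -/
def quotRule {σ : Type} (f : σ → RatFn σ) (a b : MvPolynomial σ ℂ) : RatFn σ :=
  (polyDer f a * algebraMap _ (RatFn σ) b - algebraMap _ (RatFn σ) a * polyDer f b) /
    algebraMap _ (RatFn σ) b ^ 2

theorem algebraMap_ne_zero {σ : Type} {b : MvPolynomial σ ℂ} (hb : b ≠ 0) :
    algebraMap (MvPolynomial σ ℂ) (RatFn σ) b ≠ 0 := by
  simpa using hb

theorem quotRule_congr {σ : Type} (f : σ → RatFn σ) {a b c d : MvPolynomial σ ℂ}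
    (hb : b ≠ 0) (hd : d ≠ 0)
    (h : algebraMap _ (RatFn σ) a / algebraMap _ (RatFn σ) b =
      algebraMap _ (RatFn σ) c / algebraMap _ (RatFn σ) d) :
    quotRule f a b = quotRule f c d := by
  have hb' := algebraMap_ne_zero hb
  have hd' := algebraMap_ne_zero hd
  rw [div_eq_div_iff hb' hd'] at h
  have h0 : a * d = c * b := by
    apply IsFractionRing.injective (MvPolynomial σ ℂ) (RatFn σ)
    simpa using h
  have h1 := congrArg (polyDer f) h0
  simp only [Derivation.leibniz, Algebra.smul_def] at h1
  unfold quotRule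
  rw [div_eq_div_iff (pow_ne_zero 2 hb') (pow_ne_zero 2 hd')]
  generalize algebraMap _ (RatFn σ) a = A at *
  generalize algebraMap _ (RatFn σ) b = B at *
  generalize algebraMap _ (RatFn σ) c = C at *
  generalize algebraMap _ (RatFn σ) d = D at *
  linear_combination (B * D) * h1 - (polyDer f b * D + polyDer f d * B) * h

/-- The value of the derivation `X_i ↦ f i` at a rational function. -/
def extDerFun {σ : Type} (f : σ → RatFn σ) (P : RatFn σ) : RatFn σ :=
  quotRule f (IsFractionRing.num (MvPolynomial σ ℂ) P) (IsFractionRing.den (MvPolynomial σ ℂ) P)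

theorem extDerFun_div {σ : Type} (f : σ → RatFn σ) (a b : MvPolynomial σ ℂ) (hb : b ≠ 0) :
    extDerFun f (algebraMap _ (RatFn σ) a / algebraMap _ (RatFn σ) b) = quotRule f a b :=
  quotRule_congr f (nonZeroDivisors.ne_zero (IsFractionRing.den (MvPolynomial σ ℂ) _).2) hb
    (IsFractionRing.mk'_num_den' (MvPolynomial σ ℂ) _)

theorem exists_div {σ : Type} (P : RatFn σ) : ∃ a b : MvPolynomial σ ℂ, b ≠ 0 ∧
    P = algebraMap _ (RatFn σ) a / algebraMap _ (RatFn σ) b :=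
  ⟨_, _, nonZeroDivisors.ne_zero (IsFractionRing.den (MvPolynomial σ ℂ) P).2,
    (IsFractionRing.mk'_num_den' (MvPolynomial σ ℂ) P).symm⟩

theorem extDerFun_add {σ : Type} (f : σ → RatFn σ) (P Q : RatFn σ) :
    extDerFun f (P + Q) = extDerFun f P + extDerFun f Q := by
  obtain ⟨a, b, hb, rfl⟩ := exists_div P
  obtain ⟨c, d, hd, rfl⟩ := exists_div Q
  have hb' := algebraMap_ne_zero hb
  have hd' := algebraMap_ne_zero hd
  rw [div_add_div _ _ hb' hd', ← map_mul, ← map_mul, ← map_add, ← map_mul,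
    extDerFun_div f _ _ (mul_ne_zero hb hd), extDerFun_div f _ _ hb, extDerFun_div f _ _ hd]
  simp only [quotRule, Derivation.leibniz, Algebra.smul_def, map_add, map_mul]
  field_simp
  ring

theorem extDerFun_mul {σ : Type} (f : σ → RatFn σ) (P Q : RatFn σ) :
    extDerFun f (P * Q) = P * extDerFun f Q + Q * extDerFun f P := by
  obtain ⟨a, b, hb, rfl⟩ := exists_div P
  obtain ⟨c, d, hd, rfl⟩ := exists_div Q
  have hb' := algebraMap_ne_zero hb
  have hd' := algebraMap_ne_zero hd
  rw [div_mul_div_comm, ← map_mul, ← map_mul,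
    extDerFun_div f _ _ (mul_ne_zero hb hd), extDerFun_div f _ _ hb, extDerFun_div f _ _ hd]
  simp only [quotRule, Derivation.leibniz, Algebra.smul_def, map_mul]
  field_simp
  ring

theorem extDerFun_algebraMap {σ : Type} (f : σ → RatFn σ) (a : MvPolynomial σ ℂ) :
    extDerFun f (algebraMap _ (RatFn σ) a) = polyDer f a := by
  have h := extDerFun_div f a 1 one_ne_zero
  simpa [quotRule] using h

theorem extDerFun_const {σ : Type} (f : σ → RatFn σ) (z : ℂ) :
    extDerFun f (algebraMap ℂ (RatFn σ) z) = 0 := by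
  rw [IsScalarTower.algebraMap_apply ℂ (MvPolynomial σ ℂ) (RatFn σ), extDerFun_algebraMap]
  exact Derivation.map_algebraMap _ _

/-- The `ℂ`-linear derivation of the field of rational functions with `X_i ↦ f i`. -/
def extDer {σ : Type} (f : σ → RatFn σ) : Derivation ℂ (RatFn σ) (RatFn σ) :=
  Derivation.mk'
    { toFun := extDerFun f
      map_add' := extDerFun_add f
      map_smul' := fun z P => by
        simp [Algebra.smul_def, extDerFun_mul, extDerFun_const] }
    (fun P Q => by simpa using extDerFun_mul f P Q)

theorem extDer_var {σ : Type} (f : σ → RatFn σ) (i : σ) : extDer f (var i) = f i := by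
  have h := extDerFun_algebraMap f (X i)
  rw [polyDer, mkDerivation_X] at h
  exact h

/-! ### The differential field `ℂ⟨η⟩`, the group action and its fields of invariants -/

/-- The differential field `ℂ⟨η⟩`: rational functions in the independent variables
`η, η', η'', …`, the variable with index `n` being the `n`-th derivative of `η`. -/
abbrev EtaField : Type := RatFn ℕ

/-- The derivation `∂` of `ℂ⟨η⟩`, with `∂ η⁽ⁿ⁾ = η⁽ⁿ⁺¹⁾`. -/
def D : Derivation ℂ EtaField EtaField := extDer fun n => var (n + 1)

/-- The partial derivative `∂/∂η⁽ⁱ⁾` of `ℂ⟨η⟩`. -/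
def partialD (i : ℕ) : Derivation ℂ EtaField EtaField := extDer (Pi.single i 1)

/-- The generator `η`. -/
def eta : EtaField := var 0

/-- `θ = η'`. -/
def theta : EtaField := D eta

/-- `v = (1/2) η''/η'`. -/
def vField : EtaField := (1 / 2) * (D (D eta) / D eta)

/-- The Schwarzian derivative `S(P) = P'''/P' - (3/2) (P''/P')²`. -/
def schwarzian (P : EtaField) : EtaField :=
  D (D (D P)) / D P - (3 / 2) * (D (D P) / D P) ^ 2

/-- `u = (1/2) S(η)`. -/
def uField : EtaField := (1 / 2) * schwarzian eta

/-- The group `G = SL(2, ℂ)`. -/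
abbrev SL2 : Type := Matrix.SpecialLinearGroup (Fin 2) ℂ

/-- `σ` is the action of `g = (a b; c d)` on `ℂ⟨η⟩`: the automorphism of the differential field
with `η ↦ (a η + c)/(b η + d)`. -/
def IsMoebius (g : SL2) (σ : EtaField ≃ₐ[ℂ] EtaField) : Prop :=
  (∀ P, σ (D P) = D (σ P)) ∧
    σ eta = (algebraMap ℂ EtaField (g 0 0) * eta + algebraMap ℂ EtaField (g 1 0)) /
      (algebraMap ℂ EtaField (g 0 1) * eta + algebraMap ℂ EtaField (g 1 1))

/-- The field `ℂ⟨η⟩^S` of invariants of a subgroup `S ⊆ G`. -/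
def invariants (S : Subgroup SL2) : IntermediateField ℂ EtaField where
  carrier := {P | ∀ g ∈ S, ∀ σ : EtaField ≃ₐ[ℂ] EtaField, IsMoebius g σ → σ P = P}
  mul_mem' := fun hP hQ g hg σ hσ => by rw [map_mul, hP g hg σ hσ, hQ g hg σ hσ]
  add_mem' := fun hP hQ g hg σ hσ => by rw [map_add, hP g hg σ hσ, hQ g hg σ hσ]
  algebraMap_mem' := fun z _ _ σ _ => σ.commutes z
  inv_mem' := fun _ hP g hg σ hσ => by rw [map_inv₀, hP g hg σ hσ]

/-- The differential subfield `ℂ⟨P⟩` of `ℂ⟨η⟩` generated by `P`. -/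
def diffAdjoin (P : EtaField) : IntermediateField ℂ EtaField :=
  IntermediateField.adjoin ℂ (Set.range fun n : ℕ => D^[n] P)

theorem mul_entries (g h : SL2) (i j : Fin 2) : (g * h) i j = g i 0 * h 0 j + g i 1 * h 1 j := by
  rw [Matrix.SpecialLinearGroup.coe_mul, Matrix.mul_apply, Fin.sum_univ_two]

/-- The Borel subgroup `B` of lower triangular matrices. -/
def borelLower : Subgroup SL2 where
  carrier := {g | g 0 1 = 0}
  mul_mem' := fun {g h} hg hh => by
    simp only [Set.mem_ofPred_eq] at *
    rw [mul_entries, hg, hh]; ring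
  one_mem' := by simp
  inv_mem' := fun {g} hg => by
    simp only [Set.mem_ofPred_eq] at *
    rw [Matrix.SpecialLinearGroup.coe_inv, Matrix.adjugate_fin_two]
    simpa using hg

/-- The Cartan subgroup `H` of diagonal matrices. -/
def cartan : Subgroup SL2 where
  carrier := {g | g 0 1 = 0 ∧ g 1 0 = 0}
  mul_mem' := fun {g h} hg hh => by
    simp only [Set.mem_ofPred_eq] at *
    rw [mul_entries, mul_entries, hg.1, hh.1, hg.2, hh.2]
    constructor <;> ring
  one_mem' := by simp
  inv_mem' := fun {g} hg => by
    simp only [Set.mem_ofPred_eq] at *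
    rw [Matrix.SpecialLinearGroup.coe_inv, Matrix.adjugate_fin_two]
    simpa using hg

/-- The unipotent subgroup `N ⊆ B`. -/
def unipotent : Subgroup SL2 where
  carrier := {g | g 0 1 = 0 ∧ g 0 0 = 1 ∧ g 1 1 = 1}
  mul_mem' := fun {g h} hg hh => by
    simp only [Set.mem_ofPred_eq] at *
    rw [mul_entries, mul_entries, mul_entries, hg.1, hh.1, hg.2.1, hh.2.1, hg.2.2, hh.2.2]
    refine ⟨?_, ?_, ?_⟩ <;> ring
  one_mem' := by simp
  inv_mem' := fun {g} hg => by
    simp only [Set.mem_ofPred_eq] at *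
    rw [Matrix.SpecialLinearGroup.coe_inv, Matrix.adjugate_fin_two]
    simpa using ⟨hg.1, hg.2.2, hg.2.1⟩

/-! ### Wave functions -/

/-- Rational functions of the evaluation functionals of the wave functions: the variable `(x, 0)`
is `φ(x)` and the variable `(x, 1)` is `ψ(x)`. -/
abbrev WaveField : Type := RatFn (ℝ × Fin 2)

/-- The exchange bracket `{w_i(x), w_j(y)}` of the evaluation functionals of `w = (φ, ψ)`:
`{φ(x), φ(y)} = a φ(x) φ(y)`, `{ψ(x), ψ(y)} = a ψ(x) ψ(y)`,
`{φ(x), ψ(y)} = (a - c) φ(x) ψ(y) + (c + 1) ψ(x) φ(y)`,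
`{ψ(x), φ(y)} = (a - c) ψ(x) φ(y) + (c - 1) φ(x) ψ(y)`,
where `a = a(x - y)` and `c = sign(x - y)`. -/
def exchange (a : ℝ → ℂ) (p q : ℝ × Fin 2) : WaveField :=
  let a' : ℂ := a (p.1 - q.1)
  let c : ℂ := (Real.sign (p.1 - q.1) : ℝ)
  let r : ℂ := if p.2 = 0 then 1 else -1
  if p.2 = q.2 then a' • (var p * var q)
  else (a' - c) • (var p * var q) + (c + r) • (var (p.1, q.2) * var (q.1, p.2))

/-- The extension of the exchange bracket to a biderivation of the field of rational functions. -/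
def waveBracket (a : ℝ → ℂ) (F G : WaveField) : WaveField :=
  extDer (fun p => extDer (fun q => exchange a p q) G) F

/-- The evaluation functional `η(x) = φ(x)/ψ(x)`. -/
def etaAt (x : ℝ) : WaveField := var (x, 0) / var (x, 1)

/-! ### Densities along a curve, and their Poisson bracket

Curves are smooth functions on an open set of the real line. -/

/-- The jet of a curve at a point. -/
def jet (η : ℝ → ℂ) (x : ℝ) : ℕ → ℂ := fun n => iteratedDeriv n η x

/-- The density `P ∈ ℂ⟨η⟩` is regular along the curve `η` over `U`: the denominator of its reduced
fraction does not vanish. -/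
def RegularOn (P : EtaField) (η : ℝ → ℂ) (U : Set ℝ) : Prop :=
  ∀ x ∈ U, eval (jet η x) (IsFractionRing.den (MvPolynomial ℕ ℂ) P : MvPolynomial ℕ ℂ) ≠ 0

/-- The value `P(x)` of the density `P` along the curve `η`. -/
def value (P : EtaField) (η : ℝ → ℂ) (x : ℝ) : ℂ :=
  eval (jet η x) (IsFractionRing.num (MvPolynomial ℕ ℂ) P) /
    eval (jet η x) (IsFractionRing.den (MvPolynomial ℕ ℂ) P : MvPolynomial ℕ ℂ)

/-- Complex test functions on `U`. -/
def IsTest (U : Set ℝ) (f : ℝ → ℂ) : Prop :=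
  ContDiff ℝ ∞ f ∧ HasCompactSupport f ∧ tsupport f ⊆ U

/-- The variational derivative `∑ᵢ (-d/dx)ⁱ (f ∂P/∂η⁽ⁱ⁾)` of the local functional
`η ↦ ∫ f(x) P(x) dx`. -/
def grad (P : EtaField) (η f : ℝ → ℂ) (x : ℝ) : ℂ :=
  ∑ᶠ i : ℕ, (-1) ^ i * iteratedDeriv i (fun y => f y * value (partialD i P) η y) x

/-- The kernel `η(x)² - η(y)² - sign(x - y) (η(x) - η(y))²`. -/
def etaKernel (η : ℝ → ℂ) (x y : ℝ) : ℂ :=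
  η x ^ 2 - η y ^ 2 - (Real.sign (x - y) : ℝ) * (η x - η y) ^ 2

/-- The distribution `{P(x), Q(y)}` at the curve `η`, evaluated at the test function `f(x) g(y)`;
in other words the Poisson bracket of the local functionals `∫ f P dx` and `∫ g Q dy`. It is the
extension of the basic bracket `{η(x), η(y)}` to functions of `η` and its derivatives. -/
def bracket (P Q : EtaField) (η f g : ℝ → ℂ) : ℂ :=
  ∫ x, ∫ y, grad P η f x * grad Q η g y * etaKernel η x y

/-- The Hamiltonian vector field `{η(x), ∫ g Q dy}` of the local functional `∫ g Q dy`. -/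
def hamVec (Q : EtaField) (η g : ℝ → ℂ) (x : ℝ) : ℂ :=
  ∫ y, etaKernel η x y * grad Q η g y

/-- The pairing of `δ⁽ᵏ⁾(x - y)` with `Φ(x, y)`, where `δ` is the derivative of the function `sign`,
that is twice the Dirac function. -/
def deltaPairing (k : ℕ) (Φ : ℝ → ℝ → ℂ) : ℂ :=
  2 * ∫ y, (-1) ^ k * iteratedDeriv k (fun x => Φ x y) y

/-- The curve `(a η + c)/(b η + d)`. -/
def moebiusCurve (g : SL2) (η : ℝ → ℂ) (x : ℝ) : ℂ :=
  (g 0 0 * η x + g 1 0) / (g 0 1 * η x + g 1 1)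

/-- The field of `S`-invariants is closed under the Poisson bracket: the bracket of two invariant
densities is itself an `S`-invariant function of the curve, so that the bracket of `ℂ⟨η⟩` restricts
to the `S`-invariants and the inclusion is a Poisson morphism. -/
def IsPoissonSubfield (S : Subgroup SL2) : Prop :=
  ∀ P ∈ invariants S, ∀ Q ∈ invariants S, ∀ g ∈ S, ∀ (U : Set ℝ) (η : ℝ → ℂ),
    IsOpen U → ContDiffOn ℝ ∞ η U → RegularOn P η U → RegularOn Q η U →
    (∀ x ∈ U, g 0 1 * η x + g 1 1 ≠ 0) →
    RegularOn P (moebiusCurve g η) U ∧ RegularOn Q (moebiusCurve g η) U ∧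
      ∀ f h : ℝ → ℂ, IsTest U f → IsTest U h →
        bracket P Q (moebiusCurve g η) f h = bracket P Q η f h

end EtaTower

end

open EtaTower

noncomputable section

namespace EtaTower

/-! ### Derivations of fields of rational functions -/

/-! Algebra. An endomorphism of ℂ⟨η⟩ commuting with ∂ is determined by the image y of η. Every y
that involves only η itself, with ∂y/∂η ≠ 0, occurs: ∂ⁿy has order n and leading coefficient ∂y/∂η,
so y, ∂y, … are algebraically independent (`algebraicIndependent_of_triangular`). This gives the
group action. The generators satisfy η' = θ, θ' = 2vθ, v' = u + v², so each step of ℂ⟨u⟩ ⊂ ℂ⟨v⟩ ⊂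
ℂ⟨θ⟩ ⊂ ℂ⟨η⟩ adjoins a single element t. An infinite family in the group fixes the smaller field and
moves t to infinitely many places, so an invariant fraction r(t)/s(t) lies in the smaller field
(`mem_of_fixed_of_infinite`). Translations, dilations and upper shears serve the three steps.

Brackets. Tested on f and g, {P, Q} is ∫ grad P · X_Q, where X_Q is the kernel applied to grad Q.
The coefficient of sign in the kernel has a double zero on the diagonal, so X_Q' has no local term
(`hasDerivAt_kernelInt`). As `grad` obeys a Leibniz rule and integration by parts (`grad_mul`,
`grad_D`), the gradients of θ, v, u follow from the three relations above. For θ one finds X' = 2θ ·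
sign∗(θg). For v one finds X' = −2θg, and the bracket becomes local. For u, the Miura relation u =
v' − v² reduces {u, u} on f, g to {v, v} on −f' − 2fv, −g' − 2gv. The gradients vanish off the
supports of the test functions, so the curve may be replaced by one smooth on all of ℝ
(`exists_global_curve`, `bracket_congr`).

Invariance. Passing to the transformed curve multiplies the gradient of an invariant density by (bη
+ d)². The kernel, with the compensating factors, changes by a polynomial of degree at most two in
each of η(x), η(y), without sign (`etaKernel_moebiusCurve`). Its contribution is made of moments ∫
ηᵏ grad P, which are ∫ f · (evolution of P along ηᵏ); they vanish when P is invariant under the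
infinitesimal Möbius fields concerned.

Jacobi. The derivative of {P, Q} along X_R has second-variation terms, which cancel in the cyclic
sum because mixed partial derivatives commute, and a kernel term, whose cyclic sum vanishes
pointwise by an identity between three signs (`sign_cocycle`, `jacobiKernel_cyclic`). -/

theorem algebraMap_X {σ : Type} (i : σ) :
    algebraMap (MvPolynomial σ ℂ) (RatFn σ) (X i) = var i := rfl

theorem algebraMap_C {σ : Type} (z : ℂ) :
    algebraMap (MvPolynomial σ ℂ) (RatFn σ) (C z) = algebraMap ℂ (RatFn σ) z :=
  (IsScalarTower.algebraMap_apply ℂ (MvPolynomial σ ℂ) (RatFn σ) z).symm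

/-- Only the variables that occur in numerator and denominator matter. This gives every density a
finite order. -/
theorem derivation_eq_of_vars {σ : Type} {A B : Derivation ℂ (RatFn σ) (RatFn σ)}
    {a b : MvPolynomial σ ℂ} (ha : ∀ i ∈ a.vars, A (var i) = B (var i))
    (hb : ∀ i ∈ b.vars, A (var i) = B (var i)) :
    A (algebraMap _ (RatFn σ) a / algebraMap _ (RatFn σ) b) =
      B (algebraMap _ (RatFn σ) a / algebraMap _ (RatFn σ) b) := by
  have key : ∀ p : MvPolynomial σ ℂ, (∀ i ∈ p.vars, A (var i) = B (var i)) →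
      A (algebraMap _ (RatFn σ) p) = B (algebraMap _ (RatFn σ) p) := fun p hp =>
    derivation_eq_of_forall_mem_vars (D₁ := A.compAlgebraMap (MvPolynomial σ ℂ))
      (D₂ := B.compAlgebraMap (MvPolynomial σ ℂ)) (f := p) hp
  rw [Derivation.leibniz_div, Derivation.leibniz_div, key a ha, key b hb]

theorem derivation_ext_var {σ : Type} {A B : Derivation ℂ (RatFn σ) (RatFn σ)}
    (h : ∀ i, A (var i) = B (var i)) : A = B := by
  ext P
  obtain ⟨a, b, -, rfl⟩ := exists_div P
  exact derivation_eq_of_vars (fun i _ => h i) fun i _ => h i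

theorem derivation_sum_apply {R A M ι : Type*} [CommSemiring R] [CommSemiring A] [AddCommMonoid M]
    [Algebra R A] [Module A M] [Module R M] (s : Finset ι) (d : ι → Derivation R A M) (a : A) :
    (∑ i ∈ s, d i) a = ∑ i ∈ s, d i a := by
  classical
  induction s using Finset.induction_on with
  | empty => simp
  | insert i s hi ih => rw [Finset.sum_insert hi, Finset.sum_insert hi, Derivation.add_apply, ih]

/-- An element of `ℂ⟨η⟩` involves finitely many derivatives of `η`. -/
theorem exists_order (P : EtaField) : ∃ N : ℕ, ∀ M, N ≤ M → ∀ f : ℕ → EtaField,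
    extDer f P = ∑ i ∈ Finset.range M, f i * partialD i P := by
  obtain ⟨a, b, -, rfl⟩ := exists_div P
  obtain ⟨N, hN⟩ := (a.vars ∪ b.vars).exists_nat_subset_range
  refine ⟨N, fun M hM f => ?_⟩
  have h : ∀ i ∈ a.vars ∪ b.vars,
      extDer f (var i) = (∑ j ∈ Finset.range M, f j • partialD j) (var i) := by
    intro i hi
    have hiM : i ∈ Finset.range M := Finset.range_mono hM (hN hi)
    rw [extDer_var, derivation_sum_apply, Finset.sum_eq_single_of_mem i hiM]
    · simp [partialD, extDer_var]
    · intro j _ hj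
      simp [partialD, extDer_var, Pi.single_eq_of_ne hj.symm]
  have := derivation_eq_of_vars (a := a) (b := b)
    (fun i hi => h i (Finset.mem_union_left _ hi)) (fun i hi => h i (Finset.mem_union_right _ hi))
  rw [this, derivation_sum_apply]
  rfl

theorem partialD_var (i j : ℕ) : partialD i (var j) = if j = i then 1 else 0 := by
  rw [partialD, extDer_var, Pi.single_apply]

theorem D_var (n : ℕ) : D (var n) = var (n + 1) := extDer_var _ _

theorem D_iterate_eta (n : ℕ) : D^[n] eta = var n := by
  induction n with
  | zero => rfl
  | succ n ih => rw [Function.iterate_succ_apply', ih, D_var]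

theorem partialD_comm (i j : ℕ) (P : EtaField) :
    partialD i (partialD j P) = partialD j (partialD i P) := by
  have h : ⁅partialD i, partialD j⁆ = 0 := derivation_ext_var fun k => by
    rw [Derivation.commutator_apply, partialD_var, partialD_var]
    split_ifs <;> simp
  have h' := congrArg (fun A => A P) h
  rw [Derivation.commutator_apply] at h'
  exact sub_eq_zero.1 h'

theorem partialD_succ_D (i : ℕ) (P : EtaField) :
    partialD (i + 1) (D P) = D (partialD (i + 1) P) + partialD i P := by
  have h : ⁅partialD (i + 1), D⁆ = partialD i := derivation_ext_var fun k => by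
    rw [Derivation.commutator_apply, D_var, partialD_var, partialD_var, partialD_var]
    simp only [add_left_inj]
    split_ifs <;> simp
  have h' := congrArg (fun A => A P) h
  rw [Derivation.commutator_apply] at h'
  exact sub_eq_iff_eq_add'.1 h'

theorem partialD_zero_D (P : EtaField) : partialD 0 (D P) = D (partialD 0 P) := by
  have h : ⁅partialD 0, D⁆ = 0 := derivation_ext_var fun k => by
    rw [Derivation.commutator_apply, D_var, partialD_var, partialD_var]
    split_ifs <;> simp_all
  have hcomm := congrArg (fun A => A P) h
  rw [Derivation.commutator_apply] at hcomm
  exact sub_eq_zero.1 hcomm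

/-- The evolutionary derivation `∑ₙ (∂ⁿ w) ∂/∂η⁽ⁿ⁾`. -/
def evo (w : EtaField) : Derivation ℂ EtaField EtaField := extDer fun n => D^[n] w

theorem evo_eta (w : EtaField) : evo w eta = w := extDer_var _ _

theorem evo_D (w P : EtaField) : evo w (D P) = D (evo w P) := by
  have h : ⁅evo w, D⁆ = 0 := derivation_ext_var fun k => by
    rw [Derivation.commutator_apply, D_var, evo, extDer_var, extDer_var,
      Function.iterate_succ_apply', sub_self]
    rfl
  have hcomm := congrArg (fun A => A P) h
  rw [Derivation.commutator_apply] at hcomm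
  exact sub_eq_zero.1 hcomm

/-! ### The group action -/

/-- Each monomial of the derivative is one of p with a factor Xᵢ removed. This drives the descent in
the algebraic independence criterion. -/
theorem totalDegree_pderiv_lt {σ : Type} {p : MvPolynomial σ ℂ} {i : σ} (h : pderiv i p ≠ 0) :
    (pderiv i p).totalDegree < p.totalDegree := by
  obtain ⟨m, hm, hdeg⟩ := Finset.exists_mem_eq_sup (pderiv i p).support
    (support_nonempty.2 h) fun s => s.sum fun _ e => e
  have hm' : m + Finsupp.single i 1 ∈ p.support := by
    rw [mem_support_iff, coeff_pderiv] at hm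
    exact mem_support_iff.2 (left_ne_zero_of_mul hm)
  have := le_totalDegree hm'
  rw [Finsupp.sum_add_index' (by simp) (by simp), Finsupp.sum_single_index rfl] at this
  rw [totalDegree, hdeg]
  exact this

theorem eq_C_of_pderiv_eq_zero {σ : Type} {p : MvPolynomial σ ℂ} (h : ∀ i, pderiv i p = 0) :
    p = C (coeff 0 p) := by
  classical
  ext m
  rw [coeff_C]
  split_ifs with hm
  · rw [hm]
  · obtain ⟨i, hi⟩ : ∃ i, m i ≠ 0 := by
      by_contra! h0
      exact hm (Finsupp.ext fun i => (h0 i).symm)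
    have hm' : m - Finsupp.single i 1 + Finsupp.single i 1 = m :=
      tsub_add_cancel_of_le (by simpa using Nat.one_le_iff_ne_zero.2 hi)
    have := coeff_pderiv (i := i) p (m - Finsupp.single i 1)
    rw [h i, hm', coeff_zero] at this
    exact (mul_eq_zero.1 this.symm).resolve_right (Nat.cast_add_one_ne_zero _)

/-- The chain rule. The sum runs over any sufficiently long initial range, so that ranges for
different polynomials can be merged. -/
theorem exists_derivation_aeval {K : Type*} [Field K] [Algebra ℂ K] (y : ℕ → K)
    (d : Derivation ℂ K K) (p : MvPolynomial ℕ ℂ) : ∃ N, ∀ M, N ≤ M →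
      d (aeval y p) = ∑ i ∈ Finset.range M, aeval y (pderiv i p) * d (y i) := by
  induction p using MvPolynomial.induction_on with
  | C z => exact ⟨0, fun M _ => by simp⟩
  | add p q hp hq =>
    obtain ⟨N₁, h₁⟩ := hp
    obtain ⟨N₂, h₂⟩ := hq
    refine ⟨max N₁ N₂, fun M hM => ?_⟩
    rw [map_add, map_add, h₁ M (le_trans (le_max_left _ _) hM),
      h₂ M (le_trans (le_max_right _ _) hM), ← Finset.sum_add_distrib]
    exact Finset.sum_congr rfl fun i _ => by rw [map_add, map_add, add_mul]
  | mul_X p n hp =>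
    obtain ⟨N, h⟩ := hp
    refine ⟨max N (n + 1), fun M hM => ?_⟩
    have hn : n ∈ Finset.range M :=
      Finset.mem_range.2 (lt_of_lt_of_le (Nat.lt_succ_self n) (le_trans (le_max_right _ _) hM))
    rw [map_mul, aeval_X, Derivation.leibniz, h M (le_trans (le_max_left _ _) hM), smul_eq_mul,
      smul_eq_mul, Finset.mul_sum, ← Finset.sum_erase_add _ _ hn, ← Finset.sum_erase_add _ _ hn,
      pderiv_mul, pderiv_X_self, map_add, map_mul, map_mul, aeval_X, map_one]
    have : ∑ x ∈ (Finset.range M).erase n, aeval y (pderiv x (p * X n)) * d (y x) =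
        ∑ x ∈ (Finset.range M).erase n, y n * (aeval y (pderiv x p) * d (y x)) :=
      Finset.sum_congr rfl fun i hi => by
        rw [pderiv_mul, pderiv_X_of_ne (Finset.ne_of_mem_erase hi).symm, mul_zero, add_zero,
          map_mul, aeval_X]
        ring
    rw [this]
    ring

/-- A Jacobian criterion: a triangular system of derivations with nonzero diagonal. -/
theorem algebraicIndependent_of_triangular {K : Type*} [Field K] [Algebra ℂ K] (y : ℕ → K)
    (d : ℕ → Derivation ℂ K K) (h0 : ∀ i j, j < i → d i (y j) = 0) (h1 : ∀ i, d i (y i) ≠ 0) :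
    AlgebraicIndependent ℂ y := by
  rw [algebraicIndependent_iff]
  suffices h : ∀ n, ∀ p : MvPolynomial ℕ ℂ, p.totalDegree = n → aeval y p = 0 → p = 0 from
    fun p => h _ p rfl
  intro n
  induction n using Nat.strong_induction_on with
  | _ n ih =>
  intro p hn hp
  by_cases hall : ∀ i, pderiv i p = 0
  · have hC := eq_C_of_pderiv_eq_zero hall
    rw [hC, aeval_C] at hp
    rw [hC, (map_eq_zero _).1 hp, C_0]
  · exfalso
    push Not at hall
    have hfin : ∀ i, pderiv i p ≠ 0 → i ∈ p.vars := fun i hi => by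
      by_contra hc
      exact hi (pderiv_eq_zero_of_notMem_vars hc)
    -- Let m be the largest index with ∂ₘp ≠ 0 and apply `d m` to p(y) = 0. Terms below m die by
    -- triangularity, terms above m because ∂ᵢp = 0. What is left says that ∂ₘp, of smaller degree,
    -- also vanishes at y.
    obtain ⟨m, hm, hmax⟩ := Set.exists_max_image {i | pderiv i p ≠ 0} id
      (p.vars.finite_toSet.subset fun i hi => hfin i hi) hall
    have hlt := totalDegree_pderiv_lt hm
    obtain ⟨N, hN⟩ := exists_derivation_aeval y (d m) p
    have h := hN (max N (m + 1)) (le_max_left _ _)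
    rw [hp, map_zero, Finset.sum_eq_single_of_mem m
      (Finset.mem_range.2 (lt_of_lt_of_le (Nat.lt_succ_self m) (le_max_right _ _)))] at h
    · exact hm (ih _ (hn ▸ hlt) _ rfl ((mul_eq_zero.1 h.symm).resolve_right (h1 m)))
    · intro i _ him
      rcases lt_or_gt_of_ne him with hi | hi
      · rw [h0 m i hi, mul_zero]
      · have : pderiv i p = 0 := by
          by_contra hc
          exact absurd (hmax i hc) (not_le.2 hi)
        rw [this, map_zero, zero_mul]

/-- By the commutator [∂/∂η⁽ⁱ⁺¹⁾, ∂] = ∂/∂η⁽ⁱ⁾, each ∂ raises the order by one and keeps the leading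
coefficient. This is the triangular system for the criterion above. -/
theorem partialD_D_iterate {y : EtaField} (hy : ∀ i, 0 < i → partialD i y = 0) (j : ℕ) :
    (∀ i, j < i → partialD i (D^[j] y) = 0) ∧ partialD j (D^[j] y) = partialD 0 y := by
  induction j with
  | zero => exact ⟨hy, rfl⟩
  | succ j ih =>
    rw [Function.iterate_succ_apply']
    refine ⟨fun i hi => ?_, ?_⟩
    · obtain ⟨k, rfl⟩ : ∃ k, i = k + 1 := ⟨i - 1, by omega⟩
      rw [partialD_succ_D, ih.1 _ (by omega), ih.1 _ (by omega), map_zero, add_zero]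
    · rw [partialD_succ_D, ih.1 _ (by omega), map_zero, zero_add, ih.2]

theorem algebraicIndependent_D_iterate {y : EtaField} (hy : ∀ i, 0 < i → partialD i y = 0)
    (h0 : partialD 0 y ≠ 0) : AlgebraicIndependent ℂ fun n => D^[n] y :=
  algebraicIndependent_of_triangular _ partialD (fun i j hij => (partialD_D_iterate hy j).1 i hij)
    fun i => (partialD_D_iterate hy i).2 ▸ h0

theorem algHom_ext_var {σ : Type} {K : Type*} [Field K] [Algebra ℂ K] {F G : RatFn σ →ₐ[ℂ] K}
    (h : ∀ i, F (var i) = G (var i)) : F = G := by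
  refine AlgHom.ext fun P => ?_
  obtain ⟨a, b, -, rfl⟩ := exists_div P
  have key : F.comp (IsScalarTower.toAlgHom ℂ (MvPolynomial σ ℂ) (RatFn σ)) =
      G.comp (IsScalarTower.toAlgHom ℂ (MvPolynomial σ ℂ) (RatFn σ)) :=
    MvPolynomial.algHom_ext fun i => h i
  have key' : ∀ a, F (algebraMap _ (RatFn σ) a) = G (algebraMap _ (RatFn σ) a) :=
    fun a => DFunLike.congr_fun key a
  rw [map_div₀, map_div₀, key', key']

theorem algHom_ext_eta {F G : EtaField →ₐ[ℂ] EtaField} (hF : ∀ P, F (D P) = D (F P))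
    (hG : ∀ P, G (D P) = D (G P)) (h : F eta = G eta) : F = G := by
  refine algHom_ext_var fun n => ?_
  induction n with
  | zero => exact h
  | succ n ih => rw [← D_var, hF, hG, ih]

/-- Substituting ∂ⁿy for η⁽ⁿ⁾ is injective on polynomials by algebraic independence, so no
denominator is sent to zero and the substitution extends to fractions. -/
theorem exists_differential_hom {y : EtaField} (hy : ∀ i, 0 < i → partialD i y = 0)
    (h0 : partialD 0 y ≠ 0) :
    ∃ F : EtaField →ₐ[ℂ] EtaField, (∀ P, F (D P) = D (F P)) ∧ F eta = y := by
  have hind := algebraicIndependent_D_iterate hy h0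
  obtain ⟨F, hF⟩ : ∃ F : EtaField →ₐ[ℂ] EtaField,
      ∀ a, F (algebraMap _ EtaField a) = aeval (fun n => D^[n] y) a := by
    have hinj : Function.Injective (aeval (R := ℂ) fun n => D^[n] y) := hind
    refine ⟨IsFractionRing.liftAlgHom hinj, fun a => ?_⟩
    rw [IsFractionRing.liftAlgHom_apply, IsFractionRing.lift_algebraMap]
    rfl
  have hvar : ∀ n, F (var n) = D^[n] y := fun n => by rw [← algebraMap_X, hF, aeval_X]
  have hpoly : ∀ a : MvPolynomial ℕ ℂ, F (D (algebraMap _ EtaField a)) = D (F (algebraMap _ EtaField a)) := by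
    intro a
    induction a using MvPolynomial.induction_on with
    | C z => simp [algebraMap_C]
    | add p q hp hq => simp only [map_add, hp, hq]
    | mul_X p n hp =>
      rw [map_mul, Derivation.leibniz, map_mul, Derivation.leibniz, ← hp, algebraMap_X, D_var,
        map_add, smul_eq_mul, smul_eq_mul, map_mul, map_mul, hvar, hvar,
        Function.iterate_succ_apply']
      rfl
  refine ⟨F, fun P => ?_, hvar 0⟩
  obtain ⟨a, b, hb, rfl⟩ := exists_div P
  rw [Derivation.leibniz_div, map_div₀, Derivation.leibniz_div, ← hpoly, ← hpoly]
  simp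

/-- The denominator `b η + d`. -/
def moebiusDen (g : SL2) : EtaField :=
  algebraMap ℂ EtaField (g 0 1) * eta + algebraMap ℂ EtaField (g 1 1)

/-- The fraction `(a η + c)/(b η + d)`. -/
def moebiusElt (g : SL2) : EtaField :=
  (algebraMap ℂ EtaField (g 0 0) * eta + algebraMap ℂ EtaField (g 1 0)) / moebiusDen g

theorem det_entries (g : SL2) : g 0 0 * g 1 1 - g 0 1 * g 1 0 = 1 := by
  rw [← Matrix.det_fin_two, g.2]

theorem linear_eta_ne_zero {z w : ℂ} (h : z ≠ 0 ∨ w ≠ 0) :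
    algebraMap ℂ EtaField z * eta + algebraMap ℂ EtaField w ≠ 0 := by
  intro h0
  have h1 := congrArg (partialD 0) h0
  rw [map_add, Derivation.leibniz, Derivation.map_algebraMap, Derivation.map_algebraMap, eta,
    partialD_var] at h1
  have hz : z = 0 := by simpa using h1
  rw [hz] at h0 h
  have hw : w = 0 := by simpa using h0
  simp [hw] at h

theorem moebiusDen_ne_zero (g : SL2) : moebiusDen g ≠ 0 := by
  refine linear_eta_ne_zero ?_
  by_contra! h
  have := det_entries g
  rw [h.1, h.2] at this
  simp at this

theorem partialD_moebiusElt_pos (g : SL2) {i : ℕ} (hi : 0 < i) : partialD i (moebiusElt g) = 0 := by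
  have : partialD i eta = 0 := by rw [eta, partialD_var, if_neg hi.ne]
  simp [moebiusElt, moebiusDen, Derivation.leibniz_div, this]

/-- The determinant ad − bc = 1 is the numerator of the quotient rule. An arbitrary derivation is
allowed because both ∂ and ∂/∂η are needed. -/
theorem derivation_moebiusElt (A : Derivation ℂ EtaField EtaField) (g : SL2) :
    A (moebiusElt g) = A eta / moebiusDen g ^ 2 := by
  have hne := moebiusDen_ne_zero g
  have hdet := congrArg (algebraMap ℂ EtaField) (det_entries g)
  simp only [map_sub, map_mul, map_one] at hdet
  rw [moebiusElt, Derivation.leibniz_div, eq_div_iff (pow_ne_zero 2 hne)]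
  simp only [moebiusDen] at hne ⊢
  simp only [map_add, Derivation.leibniz, Derivation.map_algebraMap, smul_eq_mul, mul_zero,
    add_zero]
  field_simp
  linear_combination (A eta) * hdet

theorem partialD_moebiusElt_zero (g : SL2) :
    partialD 0 (moebiusElt g) = 1 / moebiusDen g ^ 2 := by
  rw [derivation_moebiusElt, eta, partialD_var, if_pos rfl]

theorem exists_moebius_hom (g : SL2) :
    ∃ F : EtaField →ₐ[ℂ] EtaField, (∀ P, F (D P) = D (F P)) ∧ F eta = moebiusElt g :=
  exists_differential_hom (fun _ hi => partialD_moebiusElt_pos g hi) (by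
    rw [partialD_moebiusElt_zero]
    exact one_div_ne_zero (pow_ne_zero 2 (moebiusDen_ne_zero g)))

/-- The action of `g` on `ℂ⟨η⟩`, as an endomorphism. -/
def moebiusHom (g : SL2) : EtaField →ₐ[ℂ] EtaField := (exists_moebius_hom g).choose

theorem moebiusHom_D (g : SL2) (P : EtaField) : moebiusHom g (D P) = D (moebiusHom g P) :=
  (exists_moebius_hom g).choose_spec.1 P

theorem moebiusHom_eta (g : SL2) : moebiusHom g eta = moebiusElt g :=
  (exists_moebius_hom g).choose_spec.2

/-- The fraction is formed with the transposed matrix, which makes substitution covariant: the order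
of the product is kept. Invertibility of the action follows. -/
theorem moebiusHom_mul (g h : SL2) :
    (moebiusHom g).comp (moebiusHom h) = moebiusHom (g * h) := by
  refine algHom_ext_eta (fun P => ?_) (moebiusHom_D _) ?_
  · simp [moebiusHom_D]
  · rw [AlgHom.comp_apply, moebiusHom_eta, moebiusHom_eta]
    have h1 := moebiusDen_ne_zero (g * h)
    have h2 := moebiusDen_ne_zero g
    rw [moebiusElt, moebiusElt]
    simp only [moebiusDen, map_div₀, map_add, map_mul, AlgHom.commutes, moebiusHom_eta,
      mul_entries] at h1 ⊢
    have hL : moebiusElt g * moebiusDen g = algebraMap ℂ EtaField (g 0 0) * eta +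
        algebraMap ℂ EtaField (g 1 0) := div_mul_cancel₀ _ h2
    have hL' : moebiusDen g = algebraMap ℂ EtaField (g 0 1) * eta +
        algebraMap ℂ EtaField (g 1 1) := rfl
    generalize moebiusElt g = m at *
    generalize moebiusDen g = L at *
    rw [← mul_div_mul_right _ _ h2]
    congr 1
    · linear_combination algebraMap ℂ EtaField (h 0 0) * hL + algebraMap ℂ EtaField (h 1 0) * hL'
    · linear_combination algebraMap ℂ EtaField (h 0 1) * hL + algebraMap ℂ EtaField (h 1 1) * hL'

theorem moebiusHom_one : moebiusHom 1 = AlgHom.id ℂ EtaField :=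
  algHom_ext_eta (moebiusHom_D _) (fun _ => rfl) (by
    rw [moebiusHom_eta]; simp [moebiusElt, moebiusDen])

/-- The action of `g` on `ℂ⟨η⟩`. -/
def moebiusEquiv (g : SL2) : EtaField ≃ₐ[ℂ] EtaField :=
  AlgEquiv.ofAlgHom (moebiusHom g) (moebiusHom g⁻¹)
    (by rw [moebiusHom_mul, mul_inv_cancel, moebiusHom_one])
    (by rw [moebiusHom_mul, inv_mul_cancel, moebiusHom_one])

theorem isMoebius_iff (g : SL2) (σ : EtaField ≃ₐ[ℂ] EtaField) :
    IsMoebius g σ ↔ ∀ P, σ P = moebiusHom g P := by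
  constructor
  · intro h
    have : σ.toAlgHom = moebiusHom g :=
      algHom_ext_eta h.1 (moebiusHom_D g) (h.2.trans (moebiusHom_eta g).symm)
    exact fun P => DFunLike.congr_fun this P
  · intro h
    refine ⟨fun P => ?_, ?_⟩
    · rw [h, h, moebiusHom_D]
    · rw [h, moebiusHom_eta]; rfl

theorem existsUnique_moebius (g : SL2) : ∃! σ : EtaField ≃ₐ[ℂ] EtaField, IsMoebius g σ :=
  ⟨moebiusEquiv g, (isMoebius_iff _ _).2 fun _ => rfl, fun τ hτ =>
    AlgEquiv.ext fun P => (isMoebius_iff g τ).1 hτ P⟩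

theorem mem_invariants_iff {S : Subgroup SL2} {P : EtaField} :
    P ∈ invariants S ↔ ∀ g ∈ S, moebiusHom g P = P :=
  ⟨fun h g hg => h g hg (moebiusEquiv g) ((isMoebius_iff _ _).2 fun _ => rfl),
    fun h g hg σ hσ => ((isMoebius_iff g σ).1 hσ P).trans (h g hg)⟩

theorem D_mem_invariants {S : Subgroup SL2} {P : EtaField} (h : P ∈ invariants S) :
    D P ∈ invariants S :=
  mem_invariants_iff.2 fun g hg => by rw [moebiusHom_D, mem_invariants_iff.1 h g hg]

theorem invariants_anti {S T : Subgroup SL2} (h : S ≤ T) : invariants T ≤ invariants S :=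
  fun _ hP g hg => hP g (h hg)

theorem cartan_le_borelLower : cartan ≤ borelLower := fun _ h => h.1

theorem unipotent_le_borelLower : unipotent ≤ borelLower := fun _ h => h.1

/-! ### The wave functions -/

/-- The ratio φ/ψ is homogeneous of degree zero, so the part a · wᵢ(x)wⱼ(y) of the exchange bracket,
with the same coefficient for all i and j, contributes nothing. -/
theorem waveBracket_etaAt (a : ℝ → ℂ) (x y : ℝ) :
    waveBracket a (etaAt x) (etaAt y) =
      etaAt x ^ 2 - etaAt y ^ 2 - ((Real.sign (x - y) : ℝ) : ℂ) • (etaAt x - etaAt y) ^ 2 := by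
  have hne : ∀ p : ℝ × Fin 2, (var p : WaveField) ≠ 0 := fun p => algebraMap_ne_zero (X_ne_zero p)
  have h1 := hne (x, 1)
  have h2 := hne (y, 1)
  simp only [waveBracket, etaAt, Derivation.leibniz_div, extDer_var, exchange]
  simp only [Algebra.smul_def, map_add, map_sub]
  simp
  field_simp
  ring

/-! ### The fields of invariants -/

/-- An element of `F(t)` fixed by infinitely many `F`-endomorphisms which separate `t` is in `F`. -/
theorem mem_of_fixed_of_infinite {K ι : Type*} [Field K] [Algebra ℂ K] [Infinite ι]
    (F : IntermediateField ℂ K) {t P : K} (hP : P ∈ IntermediateField.adjoin F {t})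
    (σ : ι → K →ₐ[ℂ] K) (hF : ∀ i, ∀ x ∈ F, σ i x = x) (hσP : ∀ i, σ i P = P)
    (hinj : Function.Injective fun i => σ i t) : P ∈ F := by
  obtain ⟨r, s, h⟩ := (IntermediateField.mem_adjoin_simple_iff _ _).1 hP
  by_cases hs : Polynomial.aeval t s = 0
  · rw [h, hs, div_zero]
    exact zero_mem F
  have hσ : ∀ (i : ι) (q : Polynomial F),
      σ i (Polynomial.aeval t q) = Polynomial.aeval (σ i t) q := by
    intro i q
    induction q using Polynomial.induction_on' with
    | add p q hp hq => simp [hp, hq]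
    | monomial n x => simp [Polynomial.aeval_monomial, hF i x x.2]
  -- P·s(X) − r(X) vanishes at every σᵢ(t), because σᵢ fixes P and the coefficients of r and s. It
  -- is therefore zero, and its coefficient in degree deg s exhibits P as a quotient of elements of
  -- F.
  have hq : Polynomial.C P * s.map (algebraMap F K) - r.map (algebraMap F K) = 0 := by
    refine Polynomial.eq_zero_of_infinite_isRoot _
      ((Set.infinite_range_of_injective hinj).mono ?_)
    rintro _ ⟨i, rfl⟩
    have h1 : P * Polynomial.aeval t s = Polynomial.aeval t r := by rw [h, div_mul_cancel₀ _ hs]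
    have h2 := congrArg (σ i) h1
    rw [map_mul, hσP, hσ, hσ] at h2
    simp [h2]
  have hs0 : s ≠ 0 := by
    rintro rfl
    simp at hs
  have hc := congrArg (fun q => Polynomial.coeff q s.natDegree) hq
  simp only [Polynomial.coeff_sub, Polynomial.coeff_C_mul, Polynomial.coeff_map,
    Polynomial.coeff_zero] at hc
  have hlead : algebraMap F K (s.coeff s.natDegree) ≠ 0 := by
    simpa using hs0
  have : P = algebraMap F K (r.coeff s.natDegree) / algebraMap F K (s.coeff s.natDegree) := by
    rw [eq_div_iff hlead]
    exact sub_eq_zero.1 hc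
  rw [this]
  exact div_mem (r.coeff s.natDegree).2 (s.coeff s.natDegree).2

theorem D_mem_adjoin {F : IntermediateField ℂ EtaField} (hF : ∀ x ∈ F, D x ∈ F)
    {S : Set EtaField} (hS : ∀ s ∈ S, D s ∈ IntermediateField.adjoin F S) {x : EtaField}
    (hx : x ∈ IntermediateField.adjoin F S) : D x ∈ IntermediateField.adjoin F S := by
  induction hx using IntermediateField.adjoin_induction with
  | mem x hx => exact hS x hx
  | algebraMap x =>
    exact (IntermediateField.adjoin F S).algebraMap_mem ⟨D x, hF x x.2⟩
  | add x y _ _ hx hy => rw [map_add]; exact add_mem hx hy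
  | inv x hx0 hx =>
    rw [Derivation.leibniz_inv, smul_eq_mul]
    exact mul_mem (neg_mem (pow_mem (inv_mem hx0) 2)) hx
  | mul x y hx0 hy0 hx hy =>
    rw [Derivation.leibniz]
    exact add_mem (mul_mem hx0 hy) (mul_mem hy0 hx)

theorem diffAdjoin_le {E : IntermediateField ℂ EtaField} (hE : ∀ x ∈ E, D x ∈ E) {P : EtaField}
    (hP : P ∈ E) : diffAdjoin P ≤ E := by
  refine IntermediateField.adjoin_le_iff.2 ?_
  rintro _ ⟨n, rfl⟩
  induction n with
  | zero => exact hP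
  | succ n ih => simp only [Function.iterate_succ_apply']; exact hE _ ih

theorem mem_diffAdjoin_self (P : EtaField) : P ∈ diffAdjoin P :=
  IntermediateField.subset_adjoin ℂ _ ⟨0, rfl⟩

theorem D_mem_diffAdjoin {P x : EtaField} (hx : x ∈ diffAdjoin P) : D x ∈ diffAdjoin P := by
  unfold diffAdjoin at *
  induction hx using IntermediateField.adjoin_induction with
  | mem x hx =>
    obtain ⟨n, rfl⟩ := hx
    exact IntermediateField.subset_adjoin ℂ _ ⟨n + 1, Function.iterate_succ_apply' _ _ _⟩
  | algebraMap x => rw [Derivation.map_algebraMap]; exact zero_mem _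
  | add x y _ _ hx hy => rw [map_add]; exact add_mem hx hy
  | inv x hx0 hx =>
    rw [Derivation.leibniz_inv, smul_eq_mul]
    exact mul_mem (neg_mem (pow_mem (inv_mem hx0) 2)) hx
  | mul x y hx0 hy0 hx hy =>
    rw [Derivation.leibniz]
    exact add_mem (mul_mem hx0 hy) (mul_mem hy0 hx)

/-- Once ∂Q is rational in Q over ℂ⟨P⟩, the field ℂ⟨P⟩(Q) is closed under ∂. A differential
extension thereby becomes a simple field extension. -/
theorem diffAdjoin_le_adjoin {P Q : EtaField}
    (hQ : D Q ∈ IntermediateField.adjoin (diffAdjoin P) {Q}) {x : EtaField}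
    (hx : x ∈ diffAdjoin Q) : x ∈ IntermediateField.adjoin (diffAdjoin P) {Q} := by
  have h : diffAdjoin Q ≤
      (IntermediateField.adjoin (diffAdjoin P) {Q}).restrictScalars ℂ :=
    diffAdjoin_le
      (fun x hx => D_mem_adjoin (F := diffAdjoin P) (fun _ => D_mem_diffAdjoin)
        (fun s hs => by rw [Set.mem_singleton_iff.1 hs]; exact hQ) hx)
      (IntermediateField.mem_adjoin_simple_self _ Q)
  exact h hx

theorem diffAdjoin_eta : diffAdjoin eta = ⊤ := by
  refine eq_top_iff.2 fun P _ => ?_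
  have key : ∀ a : MvPolynomial ℕ ℂ, algebraMap _ EtaField a ∈ diffAdjoin eta := by
    intro a
    induction a using MvPolynomial.induction_on with
    | C z => rw [algebraMap_C]; exact (diffAdjoin eta).algebraMap_mem z
    | add p q hp hq => rw [map_add]; exact add_mem hp hq
    | mul_X p n hp =>
      rw [map_mul, algebraMap_X]
      exact mul_mem hp (IntermediateField.subset_adjoin ℂ _ ⟨n, D_iterate_eta n⟩)
  obtain ⟨a, b, -, rfl⟩ := exists_div P
  exact div_mem (key a) (key b)

theorem mem_adjoin_diffAdjoin_of_subset {P x : EtaField} {S : Set EtaField}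
    (h : x ∈ diffAdjoin P) : x ∈ IntermediateField.adjoin (diffAdjoin P) S :=
  (IntermediateField.adjoin (diffAdjoin P) S).algebraMap_mem ⟨x, h⟩

/-! ### The generators θ, v, u and their transformation laws -/

theorem theta_ne_zero : theta ≠ 0 := by
  rw [theta, eta, D_var]
  exact algebraMap_ne_zero (X_ne_zero _)

theorem vField_eq : vField = (1 / 2) * (D theta / theta) := rfl

theorem D_theta : D theta = 2 * vField * theta := by
  rw [vField_eq]
  field_simp [theta_ne_zero]

theorem D_half : D (1 / 2 : EtaField) = 0 := by
  have : (1 / 2 : EtaField) = algebraMap ℂ EtaField (1 / 2) := by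
    rw [map_div₀, map_one, map_ofNat]
  rw [this, Derivation.map_algebraMap]

theorem uField_eq : uField = D vField - vField ^ 2 := by
  have h := theta_ne_zero
  have h1 : D vField = (1 / 2) * D (D theta / theta) := by
    rw [vField_eq, Derivation.leibniz, D_half]; simp
  rw [h1, uField, schwarzian, vField_eq, Derivation.leibniz_div]
  change (1 / 2) * (D (D theta) / theta - (3 / 2) * (D theta / theta) ^ 2) = _
  simp only [smul_eq_mul]
  field_simp
  ring

theorem algebraicIndependent_theta : AlgebraicIndependent ℂ fun n : ℕ => D^[n] theta := by
  have h := algebraicIndependent_D_iterate (y := eta)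
    (fun i hi => by rw [eta, partialD_var, if_neg hi.ne])
    (by rw [eta, partialD_var, if_pos rfl]; exact one_ne_zero)
  exact h.comp Nat.succ Nat.succ_injective

theorem D_moebiusDen (g : SL2) : D (moebiusDen g) = algebraMap ℂ EtaField (g 0 1) * theta := by
  simp [moebiusDen, theta, Derivation.leibniz]

theorem moebiusHom_theta (g : SL2) : moebiusHom g theta = theta / moebiusDen g ^ 2 := by
  rw [theta, moebiusHom_D, moebiusHom_eta, derivation_moebiusElt]

/-- v is half the logarithmic derivative of θ, and θ is divided by (bη + d)²; so v loses the
logarithmic derivative of bη + d. -/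
theorem moebiusHom_vField (g : SL2) :
    moebiusHom g vField = vField - algebraMap ℂ EtaField (g 0 1) * theta / moebiusDen g := by
  have h := theta_ne_zero
  have h' := moebiusDen_ne_zero g
  have h1 : moebiusHom g vField = (1 / 2) * (D (moebiusHom g theta) / moebiusHom g theta) := by
    rw [vField_eq, map_mul, map_div₀ _ (D theta), moebiusHom_D, map_div₀, map_one, map_ofNat]
  rw [h1, moebiusHom_theta, Derivation.leibniz_div, Derivation.leibniz_pow, D_moebiusDen,
    D_theta]
  simp only [smul_eq_mul, nsmul_eq_mul]
  field_simp
  push_cast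
  ring

/-- With s = bθ/(bη + d) the law is v ↦ v − s, and s' = 2vs − s² makes v' − v² invariant. -/
theorem moebiusHom_uField (g : SL2) : moebiusHom g uField = uField := by
  have h' := moebiusDen_ne_zero g
  rw [uField_eq, map_sub, map_pow, moebiusHom_D, moebiusHom_vField, map_sub,
    Derivation.leibniz_div, Derivation.leibniz, Derivation.map_algebraMap, D_moebiusDen, D_theta]
  simp only [smul_eq_mul]
  field_simp
  ring

theorem moebiusDen_of_borel {g : SL2} (hg : g 0 1 = 0) :
    moebiusDen g = algebraMap ℂ EtaField (g 1 1) := by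
  simp [moebiusDen, hg]

/-- The matrix `(1 0; c 1)`. -/
def lowerShear (c : ℂ) : SL2 := ⟨!![1, 0; c, 1], by simp⟩

/-- The matrix `(1 b; 0 1)`. -/
def upperShear (b : ℂ) : SL2 := ⟨!![1, b; 0, 1], by simp⟩

/-- The diagonal matrix with entries `n + 1`, `(n + 1)⁻¹`. -/
def dilation (n : ℕ) : SL2 :=
  ⟨!![(n + 1 : ℂ), 0; 0, (n + 1 : ℂ)⁻¹], by
    rw [Matrix.det_fin_two_of, mul_inv_cancel₀ (Nat.cast_add_one_ne_zero n)]; simp⟩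

theorem moebiusHom_eq_self_of_mem_diffAdjoin {g : SL2} {P Q : EtaField}
    (h : moebiusHom g P = P) (hQ : Q ∈ diffAdjoin P) : moebiusHom g Q = Q := by
  let E : IntermediateField ℂ EtaField :=
    { carrier := {x | moebiusHom g x = x}
      mul_mem' := fun {x y} hx hy => (map_mul _ _ _).trans (congrArg₂ _ hx hy)
      add_mem' := fun {x y} hx hy => (map_add _ _ _).trans (congrArg₂ _ hx hy)
      algebraMap_mem' := AlgHom.commutes _
      inv_mem' := fun x hx => (map_inv₀ _ _).trans (congrArg _ hx) }
  exact diffAdjoin_le (E := E) (fun x hx => (moebiusHom_D g x).trans (congrArg D hx)) h hQ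

/-- ℂ⟨η⟩ = ℂ⟨θ⟩(η) because η' = θ, and the translations η ↦ η + c fix θ and separate η. -/
theorem invariants_unipotent : invariants unipotent = diffAdjoin theta := by
  apply le_antisymm
  · intro P hP
    refine mem_of_fixed_of_infinite (diffAdjoin theta) (t := eta) ?_
      (fun c : ℂ => moebiusHom (lowerShear c)) ?_ (fun c => ?_) fun b c hbc => ?_
    · refine diffAdjoin_le_adjoin ?_ (by rw [diffAdjoin_eta]; trivial)
      exact mem_adjoin_diffAdjoin_of_subset (mem_diffAdjoin_self theta)
    · refine fun c x hx => moebiusHom_eq_self_of_mem_diffAdjoin ?_ hx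
      rw [moebiusHom_theta, moebiusDen_of_borel rfl]
      simp [lowerShear]
    · exact mem_invariants_iff.1 hP _ ⟨rfl, rfl, rfl⟩
    · have h : ∀ c, moebiusHom (lowerShear c) eta = eta + algebraMap ℂ EtaField c := fun c => by
        rw [moebiusHom_eta, moebiusElt, moebiusDen_of_borel rfl]
        simp [lowerShear]
      simp only [h] at hbc
      exact (algebraMap ℂ EtaField).injective (add_left_cancel hbc)
  · refine diffAdjoin_le (fun _ => D_mem_invariants) (mem_invariants_iff.2 fun g hg => ?_)
    rw [moebiusHom_theta, moebiusDen_of_borel hg.1, hg.2.2]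
    simp

/-- A B-invariant lies in ℂ⟨θ⟩, which is contained in ℂ⟨v⟩(θ) because θ' = 2vθ; diagonal matrices
fix v and rescale θ. -/
theorem invariants_borelLower : invariants borelLower = diffAdjoin vField := by
  apply le_antisymm
  · intro P hP
    refine mem_of_fixed_of_infinite (diffAdjoin vField) (t := theta) ?_
      (fun n : ℕ => moebiusHom (dilation n)) ?_ (fun c => ?_) fun b c hbc => ?_
    · refine diffAdjoin_le_adjoin ?_
        (invariants_unipotent ▸ invariants_anti unipotent_le_borelLower hP)
      rw [D_theta]
      refine mul_mem (mul_mem (ofNat_mem _ 2) ?_) (IntermediateField.mem_adjoin_simple_self _ _)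
      exact mem_adjoin_diffAdjoin_of_subset (mem_diffAdjoin_self _)
    · refine fun c x hx => moebiusHom_eq_self_of_mem_diffAdjoin ?_ hx
      rw [moebiusHom_vField]
      simp [dilation]
    · exact mem_invariants_iff.1 hP _ rfl
    -- The dilation multiplies θ by (n + 1)². Since only the square is seen, the entries are taken
    -- to be positive integers, which their squares separate.
    · simp only [moebiusHom_theta, moebiusDen_of_borel (g := dilation b) rfl,
        moebiusDen_of_borel (g := dilation c) rfl, div_eq_mul_inv] at hbc
      have h2 := mul_left_cancel₀ theta_ne_zero hbc
      rw [← map_pow, ← map_pow, ← map_inv₀, ← map_inv₀] at h2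
      have h3 := (algebraMap ℂ EtaField).injective h2
      simp only [dilation, Matrix.SpecialLinearGroup.coe_mk, Matrix.of_apply, Matrix.cons_val_one,
        Matrix.cons_val_fin_one, inv_pow, inv_inv] at h3
      have h4 : (b + 1) ^ 2 = (c + 1) ^ 2 := by exact_mod_cast h3
      have h5 := Nat.pow_left_injective (n := 2) two_ne_zero h4
      omega
  · refine diffAdjoin_le (fun _ => D_mem_invariants) (mem_invariants_iff.2 fun g hg => ?_)
    rw [moebiusHom_vField, show g 0 1 = 0 from hg]
    simp

/-- A G-invariant lies in ℂ⟨v⟩, which is contained in ℂ⟨u⟩(v) because v' = u + v². The upper shears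
move v by −bθ/(bη + 1); when two such shifts are equated and cross-multiplied, the terms in η cancel
and the parameters agree. -/
theorem invariants_top : invariants ⊤ = diffAdjoin uField := by
  apply le_antisymm
  · intro P hP
    refine mem_of_fixed_of_infinite (diffAdjoin uField) (t := vField) ?_
      (fun b : ℂ => moebiusHom (upperShear b)) ?_ (fun c => ?_) fun b c hbc => ?_
    · refine diffAdjoin_le_adjoin ?_ (invariants_borelLower ▸ invariants_anti le_top hP)
      rw [show D vField = uField + vField ^ 2 by rw [uField_eq]; ring]
      exact add_mem (mem_adjoin_diffAdjoin_of_subset (mem_diffAdjoin_self _))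
        (pow_mem (IntermediateField.mem_adjoin_simple_self _ _) 2)
    · exact fun c x hx => moebiusHom_eq_self_of_mem_diffAdjoin (moebiusHom_uField _) hx
    · exact mem_invariants_iff.1 hP _ trivial
    · simp only [moebiusHom_vField] at hbc
      have h1 := sub_right_injective hbc
      have hb := moebiusDen_ne_zero (upperShear b)
      have hc := moebiusDen_ne_zero (upperShear c)
      simp only [div_eq_div_iff hb hc] at h1
      simp only [moebiusDen, upperShear, Matrix.SpecialLinearGroup.coe_mk, Matrix.of_apply,
        Matrix.cons_val_one, Matrix.cons_val_zero, Matrix.cons_val_fin_one, map_one] at h1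
      have h2 : theta * algebraMap ℂ EtaField b = theta * algebraMap ℂ EtaField c := by
        linear_combination h1
      exact (algebraMap ℂ EtaField).injective (mul_left_cancel₀ theta_ne_zero h2)
  · exact diffAdjoin_le (fun _ => D_mem_invariants)
      (mem_invariants_iff.2 fun g _ => moebiusHom_uField g)

/-! ### Evaluation of rational functions at a jet -/

/-- The rational function `P` has no pole at the jet `j`. -/
def Reg (j : ℕ → ℂ) (P : EtaField) : Prop :=
  eval j (IsFractionRing.den (MvPolynomial ℕ ℂ) P : MvPolynomial ℕ ℂ) ≠ 0

/-- The value of a rational function at a jet. -/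
def ev (j : ℕ → ℂ) (P : EtaField) : ℂ :=
  eval j (IsFractionRing.num (MvPolynomial ℕ ℂ) P) /
    eval j (IsFractionRing.den (MvPolynomial ℕ ℂ) P : MvPolynomial ℕ ℂ)

/-- The reduced denominator is coprime to the numerator, hence divides b. So any representation with
nonvanishing denominator computes regularity and value, and reduced fractions need not be considered
again. -/
theorem reg_ev_div {j : ℕ → ℂ} {a b : MvPolynomial ℕ ℂ} (hb : eval j b ≠ 0) :
    Reg j (algebraMap _ EtaField a / algebraMap _ EtaField b) ∧
      ev j (algebraMap _ EtaField a / algebraMap _ EtaField b) = eval j a / eval j b := by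
  have hb0 : b ≠ 0 := by rintro rfl; simp at hb
  set P := algebraMap _ EtaField a / algebraMap _ EtaField b with hP
  have hd := algebraMap_ne_zero (nonZeroDivisors.ne_zero
    (IsFractionRing.den (MvPolynomial ℕ ℂ) P).2)
  have h1 := (IsFractionRing.mk'_num_den' (MvPolynomial ℕ ℂ) P).trans hP
  rw [div_eq_div_iff hd (algebraMap_ne_zero hb0), ← map_mul, ← map_mul] at h1
  have h2 := IsFractionRing.injective (MvPolynomial ℕ ℂ) EtaField h1
  obtain ⟨k, hk⟩ := (IsFractionRing.num_den_reduced (MvPolynomial ℕ ℂ) P).symm.dvd_of_dvd_mul_left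
    (Dvd.intro_left a h2.symm)
  have hreg : Reg j P := fun h0 => hb (by rw [hk, map_mul, h0, zero_mul])
  refine ⟨hreg, ?_⟩
  rw [ev, div_eq_div_iff hreg hb, ← map_mul, ← map_mul, h2]

theorem Reg.exists_div {j : ℕ → ℂ} {P : EtaField} (h : Reg j P) :
    ∃ a b : MvPolynomial ℕ ℂ, eval j b ≠ 0 ∧
      P = algebraMap _ EtaField a / algebraMap _ EtaField b :=
  ⟨_, _, h, (IsFractionRing.mk'_num_den' (MvPolynomial ℕ ℂ) P).symm⟩

theorem algebraMap_ne_zero_of_eval {j : ℕ → ℂ} {b : MvPolynomial ℕ ℂ} (hb : eval j b ≠ 0) :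
    algebraMap _ EtaField b ≠ 0 :=
  algebraMap_ne_zero (by rintro rfl; simp at hb)

theorem reg_ev_poly (j : ℕ → ℂ) (a : MvPolynomial ℕ ℂ) :
    Reg j (algebraMap _ EtaField a) ∧ ev j (algebraMap _ EtaField a) = eval j a := by
  have h := reg_ev_div (j := j) (a := a) (b := 1) (by simp)
  simpa using h

theorem reg_ev_add {j : ℕ → ℂ} {P Q : EtaField} (hP : Reg j P) (hQ : Reg j Q) :
    Reg j (P + Q) ∧ ev j (P + Q) = ev j P + ev j Q := by
  obtain ⟨a, b, hb, rfl⟩ := hP.exists_div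
  obtain ⟨c, d, hd, rfl⟩ := hQ.exists_div
  rw [div_add_div _ _ (algebraMap_ne_zero_of_eval hb) (algebraMap_ne_zero_of_eval hd), ← map_mul,
    ← map_mul, ← map_mul, ← map_add, (reg_ev_div hb).2, (reg_ev_div hd).2,
    div_add_div _ _ hb hd, ← map_mul, ← map_mul, ← map_mul, ← map_add]
  exact reg_ev_div (by rw [map_mul]; exact mul_ne_zero hb hd)

theorem reg_ev_mul {j : ℕ → ℂ} {P Q : EtaField} (hP : Reg j P) (hQ : Reg j Q) :
    Reg j (P * Q) ∧ ev j (P * Q) = ev j P * ev j Q := by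
  obtain ⟨a, b, hb, rfl⟩ := hP.exists_div
  obtain ⟨c, d, hd, rfl⟩ := hQ.exists_div
  rw [div_mul_div_comm, ← map_mul, ← map_mul, (reg_ev_div hb).2, (reg_ev_div hd).2,
    div_mul_div_comm, ← map_mul, ← map_mul]
  exact reg_ev_div (by rw [map_mul]; exact mul_ne_zero hb hd)

theorem reg_ev_inv {j : ℕ → ℂ} {P : EtaField} (hP : Reg j P) (h0 : ev j P ≠ 0) :
    Reg j P⁻¹ ∧ ev j P⁻¹ = (ev j P)⁻¹ := by
  obtain ⟨a, b, hb, rfl⟩ := hP.exists_div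
  rw [(reg_ev_div hb).2] at h0 ⊢
  have ha : eval j a ≠ 0 := fun h => h0 (by rw [h, zero_div])
  rw [inv_div, inv_div]
  exact reg_ev_div ha

theorem reg_ev_const (j : ℕ → ℂ) (z : ℂ) :
    Reg j (algebraMap ℂ EtaField z) ∧ ev j (algebraMap ℂ EtaField z) = z := by
  have h := reg_ev_poly j (C z)
  rwa [algebraMap_C, eval_C] at h

theorem reg_ev_var (j : ℕ → ℂ) (n : ℕ) : Reg j (var n) ∧ ev j (var n) = j n := by
  have h := reg_ev_poly j (X n)
  rwa [algebraMap_X, eval_X] at h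

theorem reg_ev_zero (j : ℕ → ℂ) : Reg j 0 ∧ ev j 0 = 0 := by
  simpa using reg_ev_const j 0

theorem reg_ev_one (j : ℕ → ℂ) : Reg j 1 ∧ ev j 1 = 1 := by
  simpa using reg_ev_const j 1

theorem reg_ev_neg {j : ℕ → ℂ} {P : EtaField} (hP : Reg j P) :
    Reg j (-P) ∧ ev j (-P) = -ev j P := by
  have h := reg_ev_mul (reg_ev_const j (-1)).1 hP
  rw [(reg_ev_const j (-1)).2] at h
  simpa using h

theorem reg_ev_sub {j : ℕ → ℂ} {P Q : EtaField} (hP : Reg j P) (hQ : Reg j Q) :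
    Reg j (P - Q) ∧ ev j (P - Q) = ev j P - ev j Q := by
  have h := reg_ev_add hP (reg_ev_neg hQ).1
  rwa [(reg_ev_neg hQ).2, ← sub_eq_add_neg, ← sub_eq_add_neg] at h

theorem reg_ev_pow {j : ℕ → ℂ} {P : EtaField} (hP : Reg j P) (n : ℕ) :
    Reg j (P ^ n) ∧ ev j (P ^ n) = ev j P ^ n := by
  induction n with
  | zero => simpa using reg_ev_one j
  | succ n ih =>
    rw [pow_succ, pow_succ, ← ih.2]
    exact reg_ev_mul ih.1 hP

theorem reg_ev_fdiv {j : ℕ → ℂ} {P Q : EtaField} (hP : Reg j P) (hQ : Reg j Q) (h0 : ev j Q ≠ 0) :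
    Reg j (P / Q) ∧ ev j (P / Q) = ev j P / ev j Q := by
  rw [div_eq_mul_inv, div_eq_mul_inv, ← (reg_ev_inv hQ h0).2]
  exact reg_ev_mul hP (reg_ev_inv hQ h0).1

theorem reg_ev_sum {ι : Type*} {j : ℕ → ℂ} (s : Finset ι) {P : ι → EtaField}
    (hP : ∀ i ∈ s, Reg j (P i)) :
    Reg j (∑ i ∈ s, P i) ∧ ev j (∑ i ∈ s, P i) = ∑ i ∈ s, ev j (P i) := by
  classical
  induction s using Finset.induction_on with
  | empty => simpa using reg_ev_zero j
  | insert i s hi ih =>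
    have h := ih fun k hk => hP k (Finset.mem_insert_of_mem hk)
    rw [Finset.sum_insert hi, Finset.sum_insert hi, ← h.2]
    exact reg_ev_add (hP i (Finset.mem_insert_self i s)) h.1

/-- The quotient rule only squares the denominator, so no new pole arises. -/
theorem reg_derivation {j : ℕ → ℂ} {A : Derivation ℂ EtaField EtaField}
    (hA : ∀ n, Reg j (A (var n))) {P : EtaField} (hP : Reg j P) : Reg j (A P) := by
  have key : ∀ a : MvPolynomial ℕ ℂ, Reg j (A (algebraMap _ EtaField a)) := by
    intro a
    induction a using MvPolynomial.induction_on with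
    | C z => rw [algebraMap_C, Derivation.map_algebraMap]; exact (reg_ev_zero j).1
    | add p q hp hq => rw [map_add, map_add]; exact (reg_ev_add hp hq).1
    | mul_X p n hp =>
      rw [map_mul, Derivation.leibniz]
      exact (reg_ev_add (reg_ev_mul (reg_ev_poly j p).1 (hA n)).1
        (reg_ev_mul (reg_ev_poly j _).1 hp).1).1
  obtain ⟨a, b, hb, rfl⟩ := hP.exists_div
  rw [Derivation.leibniz_div]
  have hb' := reg_ev_poly j b
  exact (reg_ev_mul (reg_ev_pow (reg_ev_inv hb'.1 (hb'.2 ▸ hb)).1 2).1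
    (reg_ev_sub (reg_ev_mul hb'.1 (key a)).1 (reg_ev_mul (reg_ev_poly j a).1 (key b)).1).1).1

theorem Reg.D {j : ℕ → ℂ} {P : EtaField} (hP : Reg j P) : Reg j (D P) :=
  reg_derivation (fun n => by rw [D_var]; exact (reg_ev_var j _).1) hP

theorem Reg.partialD {j : ℕ → ℂ} {P : EtaField} (hP : Reg j P) (i : ℕ) : Reg j (partialD i P) :=
  reg_derivation (fun n => by
    rw [partialD_var]; split_ifs; exacts [(reg_ev_one j).1, (reg_ev_zero j).1]) hP

/-- The chain rule for the evaluation along a path of jets. -/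
theorem hasDerivAt_ev {c : ℝ → ℕ → ℂ} {s : ℝ} {A : Derivation ℂ EtaField EtaField}
    (hA : ∀ n, Reg (c s) (A (var n)))
    (hc : ∀ n, HasDerivAt (fun t => c t n) (ev (c s) (A (var n))) s) {P : EtaField}
    (hP : Reg (c s) P) : HasDerivAt (fun t => ev (c t) P) (ev (c s) (A P)) s := by
  have key : ∀ a : MvPolynomial ℕ ℂ,
      HasDerivAt (fun t => eval (c t) a) (ev (c s) (A (algebraMap _ EtaField a))) s := by
    intro a
    induction a using MvPolynomial.induction_on with
    | C z =>
      simp only [eval_C]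
      rw [algebraMap_C, Derivation.map_algebraMap, (reg_ev_zero _).2]
      exact hasDerivAt_const s z
    | add p q hp hq =>
      simp only [map_add]
      rw [(reg_ev_add (reg_derivation hA (reg_ev_poly _ p).1)
        (reg_derivation hA (reg_ev_poly _ q).1)).2]
      exact hp.add hq
    | mul_X p n hp =>
      have h1 := reg_ev_mul (reg_ev_poly (c s) p).1 (hA n)
      have h2 := reg_ev_mul (reg_ev_var (c s) n).1 (reg_derivation hA (reg_ev_poly (c s) p).1)
      simp only [map_mul, eval_X]
      rw [algebraMap_X, Derivation.leibniz, smul_eq_mul, smul_eq_mul, (reg_ev_add h1.1 h2.1).2,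
        h1.2, h2.2, (reg_ev_poly _ p).2, (reg_ev_var _ n).2]
      exact (hp.mul (hc n)).congr_deriv (by ring)
  have hd := (key (IsFractionRing.num (MvPolynomial ℕ ℂ) P)).div
    (key (IsFractionRing.den (MvPolynomial ℕ ℂ) P : MvPolynomial ℕ ℂ)) hP
  refine hd.congr_deriv ?_
  conv_rhs => rw [← IsFractionRing.mk'_num_den' (MvPolynomial ℕ ℂ) P]
  rw [Derivation.leibniz_div]
  set a := IsFractionRing.num (MvPolynomial ℕ ℂ) P
  set b := (IsFractionRing.den (MvPolynomial ℕ ℂ) P : MvPolynomial ℕ ℂ)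
  have hb : eval (c s) b ≠ 0 := hP
  have ha' := reg_ev_poly (c s) a
  have hb' := reg_ev_poly (c s) b
  have h1 := reg_ev_mul hb'.1 (reg_derivation hA ha'.1)
  have h2 := reg_ev_mul ha'.1 (reg_derivation hA hb'.1)
  have h3 := reg_ev_sub h1.1 h2.1
  have h4 := reg_ev_inv hb'.1 (hb'.2 ▸ hb)
  have h5 := reg_ev_pow h4.1 2
  simp only [smul_eq_mul]
  rw [(reg_ev_mul h5.1 h3.1).2, h5.2, h4.2, h3.2, h1.2, h2.2, ha'.2, hb'.2]
  field_simp

theorem continuousAt_ev {T : Type*} [TopologicalSpace T] {c : T → ℕ → ℂ} {t : T}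
    (hc : ContinuousAt c t) {P : EtaField} (hP : Reg (c t) P) :
    ContinuousAt (fun s => ev (c s) P) t :=
  ((MvPolynomial.continuous_eval _).continuousAt.comp hc).div
    ((MvPolynomial.continuous_eval _).continuousAt.comp hc) hP

theorem isOpen_reg (P : EtaField) : IsOpen {j | Reg j P} :=
  isOpen_ne_fun (MvPolynomial.continuous_eval _) continuous_const

/-! ### Test functions -/

theorem IsTest.mono {V W : Set ℝ} {f : ℝ → ℂ} (hf : IsTest V f) (h : V ⊆ W) : IsTest W f :=
  ⟨hf.1, hf.2.1, hf.2.2.trans h⟩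

theorem IsTest.eq_zero {V : Set ℝ} {f : ℝ → ℂ} (hf : IsTest V f) {x : ℝ} (hx : x ∉ V) : f x = 0 :=
  image_eq_zero_of_notMem_tsupport fun h => hx (hf.2.2 h)

theorem IsTest.eventuallyEq_zero {V : Set ℝ} {f : ℝ → ℂ} (hf : IsTest V f) {x : ℝ} (hx : x ∉ V) :
    f =ᶠ[nhds x] 0 :=
  notMem_tsupport_iff_eventuallyEq.1 fun h => hx (hf.2.2 h)

theorem IsTest.zero (V : Set ℝ) : IsTest V fun _ => 0 :=
  ⟨contDiff_const, HasCompactSupport.zero, by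
    have : tsupport (fun _ : ℝ => (0 : ℂ)) = ∅ := tsupport_eq_empty_iff.2 rfl
    rw [this]; exact Set.empty_subset _⟩

theorem IsTest.of_tsupport_subset {V : Set ℝ} {f g : ℝ → ℂ} (hf : IsTest V f)
    (hg : ContDiff ℝ ∞ g) (h : tsupport g ⊆ tsupport f) : IsTest V g :=
  ⟨hg, hf.2.1.of_isClosed_subset (isClosed_tsupport g) h, h.trans hf.2.2⟩

/-- Around a point outside V the function f is identically zero, so φ may be singular there. This is
why densities need be regular only on V. -/
theorem IsTest.mul_contDiffOn {V : Set ℝ} (hV : IsOpen V) {f φ : ℝ → ℂ} (hf : IsTest V f)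
    (hφ : ContDiffOn ℝ ∞ φ V) : IsTest V fun x => f x * φ x := by
  refine hf.of_tsupport_subset (contDiff_iff_contDiffAt.2 fun x => ?_) tsupport_mul_subset_left
  by_cases hx : x ∈ V
  · exact hf.1.contDiffAt.mul (hφ.contDiffAt (hV.mem_nhds hx))
  · refine contDiffAt_const (c := (0 : ℂ)) |>.congr_of_eventuallyEq ?_
    filter_upwards [hf.eventuallyEq_zero hx] with y hy
    rw [hy]; exact zero_mul _

theorem IsTest.add {V : Set ℝ} {f g : ℝ → ℂ} (hf : IsTest V f) (hg : IsTest V g) :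
    IsTest V fun x => f x + g x :=
  ⟨hf.1.add hg.1, hf.2.1.add hg.2.1, (tsupport_add f g).trans (Set.union_subset hf.2.2 hg.2.2)⟩

theorem IsTest.const_mul {V : Set ℝ} {f : ℝ → ℂ} (hf : IsTest V f) (z : ℂ) :
    IsTest V fun x => z * f x :=
  hf.of_tsupport_subset (contDiff_const.mul hf.1) tsupport_mul_subset_right

theorem IsTest.neg {V : Set ℝ} {f : ℝ → ℂ} (hf : IsTest V f) : IsTest V fun x => -f x := by
  simpa using hf.const_mul (-1)

theorem IsTest.sum {ι : Type*} {V : Set ℝ} (s : Finset ι) {f : ι → ℝ → ℂ}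
    (hf : ∀ i ∈ s, IsTest V (f i)) : IsTest V fun x => ∑ i ∈ s, f i x := by
  classical
  induction s using Finset.induction_on with
  | empty => simpa using IsTest.zero V
  | insert i s hi ih =>
    simp only [Finset.sum_insert hi]
    exact (hf i (Finset.mem_insert_self i s)).add
      (ih fun k hk => hf k (Finset.mem_insert_of_mem hk))

theorem IsTest.deriv {V : Set ℝ} {f : ℝ → ℂ} (hf : IsTest V f) : IsTest V (deriv f) :=
  hf.of_tsupport_subset (contDiff_infty_iff_deriv.1 hf.1).2 tsupport_deriv_subset

theorem IsTest.iteratedDeriv {V : Set ℝ} {f : ℝ → ℂ} (hf : IsTest V f) (n : ℕ) :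
    IsTest V (iteratedDeriv n f) := by
  induction n with
  | zero => rwa [iteratedDeriv_zero]
  | succ n ih => rw [iteratedDeriv_succ]; exact ih.deriv

theorem IsTest.contDiffAt {V : Set ℝ} {f : ℝ → ℂ} (hf : IsTest V f) (n : ℕ) (x : ℝ) :
    ContDiffAt ℝ n f x :=
  (hf.1.of_le (by exact_mod_cast le_top)).contDiffAt

theorem IsTest.hasDerivAt {V : Set ℝ} {f : ℝ → ℂ} (hf : IsTest V f) (x : ℝ) :
    HasDerivAt f (_root_.deriv f x) x :=
  (hf.1.differentiable (by simp)).differentiableAt.hasDerivAt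

theorem IsTest.deriv_mul {V : Set ℝ} {f φ φ' : ℝ → ℂ} (hf : IsTest V f)
    (hφ : ∀ x ∈ V, HasDerivAt φ (φ' x) x) :
    _root_.deriv (fun x => f x * φ x) = fun x => _root_.deriv f x * φ x + f x * φ' x := by
  funext x
  by_cases hx : x ∈ V
  · exact ((hf.hasDerivAt x).mul (hφ x hx)).deriv
  · have h : (fun x => f x * φ x) =ᶠ[nhds x] fun _ => 0 := by
      filter_upwards [hf.eventuallyEq_zero hx] with y hy
      rw [hy]; exact zero_mul _
    rw [h.deriv_eq, hf.eq_zero hx, hf.deriv.eq_zero hx]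
    simp

/-! ### Densities along a curve -/

theorem regularOn_iff {P : EtaField} {η : ℝ → ℂ} {V : Set ℝ} :
    RegularOn P η V ↔ ∀ x ∈ V, Reg (jet η x) P := Iff.rfl

theorem value_eq (P : EtaField) (η : ℝ → ℂ) (x : ℝ) : value P η x = ev (jet η x) P := rfl

theorem RegularOn.mono {P : EtaField} {η : ℝ → ℂ} {V W : Set ℝ} (h : RegularOn P η W)
    (hVW : V ⊆ W) : RegularOn P η V := fun x hx => h x (hVW hx)

theorem RegularOn.D {P : EtaField} {η : ℝ → ℂ} {V : Set ℝ} (h : RegularOn P η V) :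
    RegularOn (D P) η V := fun x hx => Reg.D (h x hx)

theorem RegularOn.partialD {P : EtaField} {η : ℝ → ℂ} {V : Set ℝ} (h : RegularOn P η V) (i : ℕ) :
    RegularOn (partialD i P) η V := fun x hx => Reg.partialD (h x hx) i

theorem RegularOn.mul {P Q : EtaField} {η : ℝ → ℂ} {V : Set ℝ} (hP : RegularOn P η V)
    (hQ : RegularOn Q η V) : RegularOn (P * Q) η V := fun x hx => (reg_ev_mul (hP x hx) (hQ x hx)).1

theorem regularOn_const (z : ℂ) (η : ℝ → ℂ) (V : Set ℝ) : RegularOn (algebraMap ℂ EtaField z) η V :=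
  fun _ _ => (reg_ev_const _ z).1

theorem regularOn_var (n : ℕ) (η : ℝ → ℂ) (V : Set ℝ) : RegularOn (var n) η V :=
  fun _ _ => (reg_ev_var _ n).1

theorem jet_congr {η ζ : ℝ → ℂ} {V : Set ℝ} (hV : IsOpen V) (h : Set.EqOn η ζ V) {x : ℝ}
    (hx : x ∈ V) : jet η x = jet ζ x :=
  funext fun n => h.iteratedDeriv_of_isOpen hV n hx

theorem value_congr {η ζ : ℝ → ℂ} {V : Set ℝ} (hV : IsOpen V) (h : Set.EqOn η ζ V) {x : ℝ}
    (hx : x ∈ V) (P : EtaField) : value P η x = value P ζ x := by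
  rw [value_eq, value_eq, jet_congr hV h hx]

theorem RegularOn.congr {P : EtaField} {η ζ : ℝ → ℂ} {V : Set ℝ} (hP : RegularOn P η V)
    (hV : IsOpen V) (h : Set.EqOn η ζ V) : RegularOn P ζ V := fun x hx =>
  jet_congr hV h hx ▸ hP x hx

theorem contDiffOn_iteratedDeriv {η : ℝ → ℂ} {V : Set ℝ} (hV : IsOpen V)
    (hη : ContDiffOn ℝ ∞ η V) (n : ℕ) : ContDiffOn ℝ ∞ (iteratedDeriv n η) V := by
  induction n with
  | zero => rwa [iteratedDeriv_zero]
  | succ n ih => rw [iteratedDeriv_succ]; exact ih.deriv_of_isOpen hV (by simp)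

theorem hasDerivAt_jet {η : ℝ → ℂ} {V : Set ℝ} (hV : IsOpen V) (hη : ContDiffOn ℝ ∞ η V) {x : ℝ}
    (hx : x ∈ V) (n : ℕ) : HasDerivAt (fun y => jet η y n) (jet η x (n + 1)) x := by
  have h := ((contDiffOn_iteratedDeriv hV hη n).contDiffAt (hV.mem_nhds hx)).differentiableAt
    (by simp)
  have h' := h.hasDerivAt
  rwa [← iteratedDeriv_succ] at h'

theorem hasDerivAt_value {η : ℝ → ℂ} {V : Set ℝ} (hV : IsOpen V) (hη : ContDiffOn ℝ ∞ η V)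
    {P : EtaField} (hP : RegularOn P η V) {x : ℝ} (hx : x ∈ V) :
    HasDerivAt (value P η) (value (D P) η x) x :=
  hasDerivAt_ev (fun n => by rw [D_var]; exact (reg_ev_var _ _).1)
    (fun n => by rw [D_var, (reg_ev_var _ _).2]; exact hasDerivAt_jet hV hη hx n) (hP x hx)

theorem contDiffOn_eval {η : ℝ → ℂ} {V : Set ℝ} (hV : IsOpen V) (hη : ContDiffOn ℝ ∞ η V)
    (a : MvPolynomial ℕ ℂ) : ContDiffOn ℝ ∞ (fun x => eval (jet η x) a) V := by
  induction a using MvPolynomial.induction_on with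
  | C z => simpa using contDiffOn_const
  | add p q hp hq => simpa using hp.add hq
  | mul_X p n hp =>
    simp only [map_mul, eval_X]
    exact hp.mul (contDiffOn_iteratedDeriv hV hη n)

theorem contDiffOn_value {η : ℝ → ℂ} {V : Set ℝ} (hV : IsOpen V) (hη : ContDiffOn ℝ ∞ η V)
    {P : EtaField} (hP : RegularOn P η V) : ContDiffOn ℝ ∞ (value P η) V := by
  have h := (contDiffOn_eval hV hη (IsFractionRing.num (MvPolynomial ℕ ℂ) P)).mul
    ((contDiffOn_eval hV hη (IsFractionRing.den (MvPolynomial ℕ ℂ) P : MvPolynomial ℕ ℂ)).inv hP)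
  exact h.congr fun x _ => div_eq_mul_inv _ _

theorem IsTest.mul_value {V : Set ℝ} (hV : IsOpen V) {η f : ℝ → ℂ} (hη : ContDiffOn ℝ ∞ η V)
    (hf : IsTest V f) {P : EtaField} (hP : RegularOn P η V) :
    IsTest V fun x => f x * value P η x :=
  hf.mul_contDiffOn hV (contDiffOn_value hV hη hP)

theorem deriv_mul_value {V : Set ℝ} (hV : IsOpen V) {η f : ℝ → ℂ} (hη : ContDiffOn ℝ ∞ η V)
    (hf : IsTest V f) {P : EtaField} (hP : RegularOn P η V) :
    deriv (fun x => f x * value P η x) =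
      fun x => deriv f x * value P η x + f x * value (D P) η x :=
  hf.deriv_mul fun _ hx => hasDerivAt_value hV hη hP hx

theorem IsTest.mul_congr {V : Set ℝ} {f φ ψ : ℝ → ℂ} (hf : IsTest V f) (h : ∀ x ∈ V, φ x = ψ x) :
    (fun x => f x * φ x) = fun x => f x * ψ x := by
  funext x
  by_cases hx : x ∈ V
  · rw [h x hx]
  · rw [hf.eq_zero hx, zero_mul, zero_mul]

/-! ### Variational derivatives -/

theorem value_zero (η : ℝ → ℂ) (x : ℝ) : value 0 η x = 0 := (reg_ev_zero _).2

theorem partialD_eq_zero_of_order {P : EtaField} {N : ℕ} (hN : ∀ M, N ≤ M → ∀ f : ℕ → EtaField,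
    extDer f P = ∑ i ∈ Finset.range M, f i * partialD i P) {i : ℕ} (hi : N ≤ i) :
    partialD i P = 0 := by
  rw [partialD, hN i hi]
  exact Finset.sum_eq_zero fun k hk => by
    rw [Pi.single_eq_of_ne (Finset.mem_range.1 hk).ne, zero_mul]

theorem exists_partialD_eq_zero (P : EtaField) : ∃ N, ∀ i, N ≤ i → partialD i P = 0 := by
  obtain ⟨N, hN⟩ := exists_order P
  exact ⟨N, fun i hi => partialD_eq_zero_of_order hN hi⟩

theorem grad_eq_sum {P : EtaField} {M : ℕ} (hM : ∀ i, M ≤ i → partialD i P = 0) (η f : ℝ → ℂ)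
    (x : ℝ) : grad P η f x =
      ∑ i ∈ Finset.range M,
        (-1) ^ i * iteratedDeriv i (fun y => f y * value (partialD i P) η y) x := by
  refine finsum_eq_sum_of_support_subset _ fun i hi => ?_
  rw [Finset.mem_coe, Finset.mem_range]
  by_contra h
  refine hi ?_
  have h0 : (fun y => f y * value (partialD i P) η y) = fun _ => 0 := by
    funext y
    rw [hM i (not_lt.1 h), value_zero, mul_zero]
  simp only [h0]
  rw [iteratedDeriv_const]
  simp

theorem isTest_grad {V : Set ℝ} (hV : IsOpen V) {η f : ℝ → ℂ} (hη : ContDiffOn ℝ ∞ η V)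
    (hf : IsTest V f) {P : EtaField} (hP : RegularOn P η V) : IsTest V (grad P η f) := by
  obtain ⟨N, hN⟩ := exists_partialD_eq_zero P
  rw [show grad P η f = _ from funext (grad_eq_sum hN η f)]
  exact IsTest.sum _ fun i _ => ((hf.mul_value hV hη (hP.partialD i)).iteratedDeriv i).const_mul _

theorem grad_congr {V : Set ℝ} (hV : IsOpen V) {η ζ f : ℝ → ℂ} (h : Set.EqOn η ζ V)
    (hf : IsTest V f) (P : EtaField) : grad P η f = grad P ζ f := by
  funext x
  simp only [grad]
  congr 1
  funext i
  rw [hf.mul_congr fun x hx => value_congr hV h hx (partialD i P)]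

theorem iteratedDeriv_add_test {V : Set ℝ} {f g : ℝ → ℂ} (hf : IsTest V f) (hg : IsTest V g)
    (n : ℕ) (x : ℝ) : iteratedDeriv n (fun y => f y + g y) x =
      iteratedDeriv n f x + iteratedDeriv n g x :=
  iteratedDeriv_add (hf.contDiffAt n x) (hg.contDiffAt n x)

theorem grad_add {V : Set ℝ} (hV : IsOpen V) {η : ℝ → ℂ} (hη : ContDiffOn ℝ ∞ η V)
    {P Q : EtaField} (hP : RegularOn P η V) (hQ : RegularOn Q η V) {f : ℝ → ℂ}
    (hf : IsTest V f) (x : ℝ) : grad (P + Q) η f x = grad P η f x + grad Q η f x := by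
  obtain ⟨M, hM⟩ := exists_partialD_eq_zero P
  obtain ⟨N, hN⟩ := exists_partialD_eq_zero Q
  have hM' : ∀ i, max M N ≤ i → partialD i P = 0 := fun i hi => hM i (le_trans (le_max_left _ _) hi)
  have hN' : ∀ i, max M N ≤ i → partialD i Q = 0 :=
    fun i hi => hN i (le_trans (le_max_right _ _) hi)
  rw [grad_eq_sum hM', grad_eq_sum hN', grad_eq_sum (M := max M N)
    (fun i hi => by rw [map_add, hM' i hi, hN' i hi, add_zero]), ← Finset.sum_add_distrib]
  refine Finset.sum_congr rfl fun i _ => ?_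
  rw [← mul_add, ← iteratedDeriv_add_test (hf.mul_value hV hη (hP.partialD i))
    (hf.mul_value hV hη (hQ.partialD i))]
  congr 2
  simp_rw [← mul_add]
  exact hf.mul_congr fun y hy => by
    rw [map_add]; exact (reg_ev_add (hP.partialD i y hy) (hQ.partialD i y hy)).2

theorem grad_add_test {V : Set ℝ} (hV : IsOpen V) {η : ℝ → ℂ} (hη : ContDiffOn ℝ ∞ η V)
    {P : EtaField} (hP : RegularOn P η V) {f g : ℝ → ℂ}
    (hf : IsTest V f) (hg : IsTest V g) (x : ℝ) :
    grad P η (fun y => f y + g y) x = grad P η f x + grad P η g x := by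
  obtain ⟨M, hM⟩ := exists_partialD_eq_zero P
  rw [grad_eq_sum hM, grad_eq_sum hM, grad_eq_sum hM, ← Finset.sum_add_distrib]
  refine Finset.sum_congr rfl fun i _ => ?_
  rw [← mul_add, ← iteratedDeriv_add_test (hf.mul_value hV hη (hP.partialD i))
    (hg.mul_value hV hη (hP.partialD i))]
  simp_rw [add_mul]

theorem grad_const_mul_test {η : ℝ → ℂ} (P : EtaField) (f : ℝ → ℂ) (z : ℂ) (x : ℝ) :
    grad P η (fun y => z * f y) x = z * grad P η f x := by
  obtain ⟨M, hM⟩ := exists_partialD_eq_zero P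
  rw [grad_eq_sum hM, grad_eq_sum hM, Finset.mul_sum]
  refine Finset.sum_congr rfl fun i _ => ?_
  simp_rw [mul_assoc]
  rw [iteratedDeriv_const_mul_field]
  ring

/-- The other factor of the product rule is absorbed into the test function. With `grad_D` this
determines gradients from algebraic relations between densities, without expanding the differential
operator. -/
theorem grad_mul {V : Set ℝ} (hV : IsOpen V) {η : ℝ → ℂ} (hη : ContDiffOn ℝ ∞ η V)
    {P Q : EtaField} (hP : RegularOn P η V) (hQ : RegularOn Q η V) {f : ℝ → ℂ}
    (hf : IsTest V f) (x : ℝ) : grad (P * Q) η f x =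
      grad P η (fun y => f y * value Q η y) x + grad Q η (fun y => f y * value P η y) x := by
  obtain ⟨M, hM⟩ := exists_partialD_eq_zero P
  obtain ⟨N, hN⟩ := exists_partialD_eq_zero Q
  have hM' : ∀ i, max M N ≤ i → partialD i P = 0 := fun i hi => hM i (le_trans (le_max_left _ _) hi)
  have hN' : ∀ i, max M N ≤ i → partialD i Q = 0 :=
    fun i hi => hN i (le_trans (le_max_right _ _) hi)
  rw [grad_eq_sum hM', grad_eq_sum hN', grad_eq_sum (M := max M N)
    (fun i hi => by rw [Derivation.leibniz, hM' i hi, hN' i hi, smul_zero, smul_zero, add_zero]),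
    ← Finset.sum_add_distrib]
  refine Finset.sum_congr rfl fun i _ => ?_
  rw [← mul_add, ← iteratedDeriv_add_test
    ((hf.mul_value hV hη hQ).mul_value hV hη (hP.partialD i))
    ((hf.mul_value hV hη hP).mul_value hV hη (hQ.partialD i))]
  congr 2
  simp_rw [mul_assoc, ← mul_add]
  refine hf.mul_congr fun y hy => ?_
  have h1 := reg_ev_mul (hP y hy) (hQ.partialD i y hy)
  have h2 := reg_ev_mul (hQ y hy) (hP.partialD i y hy)
  rw [Derivation.leibniz, smul_eq_mul, smul_eq_mul, value_eq, (reg_ev_add h1.1 h2.1).2, h1.2, h2.2,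
    add_comm]
  rfl

/-- This is ∫ f ∂P = −∫ f' P at the level of gradients; formally it rests on the commutator
[∂/∂η⁽ⁱ⁺¹⁾, ∂] = ∂/∂η⁽ⁱ⁾. -/
theorem grad_D {V : Set ℝ} (hV : IsOpen V) {η : ℝ → ℂ} (hη : ContDiffOn ℝ ∞ η V)
    {P : EtaField} (hP : RegularOn P η V) {f : ℝ → ℂ} (hf : IsTest V f) (x : ℝ) :
    grad (D P) η f x = -grad P η (deriv f) x := by
  obtain ⟨M, hM⟩ := exists_partialD_eq_zero P
  have hDP : ∀ i, M + 1 ≤ i → partialD i (D P) = 0 := by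
    intro i hi
    obtain ⟨k, rfl⟩ : ∃ k, i = k + 1 := ⟨i - 1, by omega⟩
    rw [partialD_succ_D, hM _ (by omega), hM _ (by omega), map_zero, add_zero]
  rw [grad_eq_sum hDP, grad_eq_sum hM]
  have hT : ∀ i, IsTest V fun y => f y * value (D (partialD i P)) η y :=
    fun i => hf.mul_value hV hη (hP.partialD i).D
  have hS : ∀ i, IsTest V fun y => deriv f y * value (partialD i P) η y :=
    fun i => hf.deriv.mul_value hV hη (hP.partialD i)
  have hR : ∀ i, IsTest V fun y => f y * value (partialD i P) η y :=
    fun i => hf.mul_value hV hη (hP.partialD i)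
  have hR' : ∀ k, iteratedDeriv (k + 1) (fun y => f y * value (partialD k P) η y) x =
      iteratedDeriv k (fun y => deriv f y * value (partialD k P) η y) x +
        iteratedDeriv k (fun y => f y * value (D (partialD k P)) η y) x := fun k => by
    rw [iteratedDeriv_succ', deriv_mul_value hV hη hf (hP.partialD k),
      iteratedDeriv_add_test (hS k) (hT k)]
  have hstep : ∀ k, iteratedDeriv (k + 1) (fun y => f y * value (partialD (k + 1) (D P)) η y) x =
      iteratedDeriv (k + 1) (fun y => f y * value (D (partialD (k + 1) P)) η y) x +
        (iteratedDeriv k (fun y => deriv f y * value (partialD k P) η y) x +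
        iteratedDeriv k (fun y => f y * value (D (partialD k P)) η y) x) := fun k => by
    rw [← hR', ← iteratedDeriv_add_test (hT _) (hR _)]
    congr 1
    simp_rw [← mul_add]
    exact hf.mul_congr fun y hy => by
      rw [partialD_succ_D]
      exact (reg_ev_add ((hP.partialD _).D y hy) (hP.partialD _ y hy)).2
  rw [Finset.sum_range_succ', partialD_zero_D]
  simp only [hstep, mul_add, Finset.sum_add_distrib]
  -- The terms with f · ∂(∂P/∂η⁽ᵏ⁾) occur twice with opposite signs, once with the index shifted by
  -- one. They cancel except for k = M, which is zero since M exceeds the order of P.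
  have h1 := Finset.sum_range_succ'
    (fun k => (-1 : ℂ) ^ k * iteratedDeriv k (fun y => f y * value (D (partialD k P)) η y) x) M
  have h2 : iteratedDeriv M (fun y => f y * value (D (partialD M P)) η y) x = 0 := by
    have h0 : (fun y => f y * value (D (partialD M P)) η y) = fun _ => 0 := by
      funext y
      rw [hM M le_rfl, map_zero, value_zero, mul_zero]
    rw [h0, iteratedDeriv_const]
    simp
  rw [Finset.sum_range_succ, h2] at h1
  have h3 : ∑ k ∈ Finset.range M, (-1 : ℂ) ^ (k + 1) *
      iteratedDeriv k (fun y => f y * value (D (partialD k P)) η y) x =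
      -∑ k ∈ Finset.range M, (-1 : ℂ) ^ k *
        iteratedDeriv k (fun y => f y * value (D (partialD k P)) η y) x := by
    rw [← Finset.sum_neg_distrib]
    exact Finset.sum_congr rfl fun k _ => by ring
  have h4 : ∑ k ∈ Finset.range M, (-1 : ℂ) ^ (k + 1) *
      iteratedDeriv k (fun y => deriv f y * value (partialD k P) η y) x =
      -∑ k ∈ Finset.range M, (-1 : ℂ) ^ k *
        iteratedDeriv k (fun y => deriv f y * value (partialD k P) η y) x := by
    rw [← Finset.sum_neg_distrib]
    exact Finset.sum_congr rfl fun k _ => by ring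
  rw [h3, h4]
  linear_combination -h1

theorem grad_const {η : ℝ → ℂ} (z : ℂ) (f : ℝ → ℂ) (x : ℝ) : grad (algebraMap ℂ EtaField z) η f x = 0 := by
  rw [grad_eq_sum (M := 0) fun i _ => Derivation.map_algebraMap _ _]
  rfl

theorem grad_eta {η : ℝ → ℂ} (f : ℝ → ℂ) (x : ℝ) : grad eta η f x = f x := by
  rw [grad_eq_sum (M := 1) fun i hi => by rw [eta, partialD_var, if_neg (by omega)]]
  have : ∀ y, value (1 : EtaField) η y = 1 := fun y => (reg_ev_one _).2
  simp [eta, partialD_var, this]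

/-! ### Localization -/

/-- A smooth curve coincides near a compact set with a globally smooth curve. -/
theorem exists_global_curve {U K : Set ℝ} {η : ℝ → ℂ} (hU : IsOpen U) (hη : ContDiffOn ℝ ∞ η U)
    (hK : IsCompact K) (hKU : K ⊆ U) : ∃ (V : Set ℝ) (ζ : ℝ → ℂ), IsOpen V ∧ K ⊆ V ∧
      IsCompact (closure V) ∧ closure V ⊆ U ∧ ContDiff ℝ ∞ ζ ∧ Set.EqOn η ζ V := by
  -- Two nested neighbourhoods of K: the cutoff χ is 1 on the inner one and vanishes off the outer
  -- one, so χη is smooth on the whole line.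
  obtain ⟨V, hV, hKV, hVU, hVc⟩ := exists_open_between_and_isCompact_closure hK hU hKU
  obtain ⟨W, hW, hVW, hWU, hWc⟩ := exists_open_between_and_isCompact_closure hVc hU hVU
  obtain ⟨χ, hχ1, hχ0, -⟩ := exists_contMDiffMap_one_nhds_of_subset_interior
    (modelWithCornersSelf ℝ ℝ) (n := ⊤) (s := closure V) (t := W) isClosed_closure
    (hW.interior_eq.symm ▸ hVW)
  have hχ : ContDiff ℝ ∞ χ := χ.contMDiff.contDiff
  have htest : IsTest U fun x => (χ x : ℂ) := by
    have hts : tsupport (fun x => (χ x : ℂ)) ⊆ closure W := by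
      refine closure_mono fun x hx => ?_
      by_contra h
      exact hx (by simp [hχ0 x h])
    exact ⟨Complex.ofRealCLM.contDiff.comp hχ, hWc.of_isClosed_subset (isClosed_tsupport _) hts,
      hts.trans hWU⟩
  refine ⟨V, fun x => (χ x : ℂ) * η x, hV, hKV, hVc, hVU, (htest.mul_contDiffOn hU hη).1,
    fun x hx => ?_⟩
  simp [hχ1.self_of_nhdsSet x (subset_closure hx)]

theorem grad_eq_zero {V : Set ℝ} {f : ℝ → ℂ} (hf : IsTest V f) (P : EtaField) (η : ℝ → ℂ) {x : ℝ}
    (hx : x ∉ V) : grad P η f x = 0 := by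
  obtain ⟨N, hN⟩ := exists_partialD_eq_zero P
  rw [grad_eq_sum hN]
  refine Finset.sum_eq_zero fun i _ => ?_
  have h : (fun y => f y * value (partialD i P) η y) =ᶠ[nhds x] fun _ => 0 := by
    filter_upwards [hf.eventuallyEq_zero hx] with y hy
    rw [hy]; exact zero_mul _
  rw [h.iteratedDeriv_eq, iteratedDeriv_const]
  simp

theorem integral_congr_fun {T E : Type*} [MeasurableSpace T] [NormedAddCommGroup E]
    [NormedSpace ℝ E] {μ : MeasureTheory.Measure T} {f g : T → E} (h : ∀ x, f x = g x) :
    ∫ x, f x ∂μ = ∫ x, g x ∂μ :=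
  MeasureTheory.integral_congr_ae (Filter.Eventually.of_forall h)

/-- The gradients vanish outside V, so the double integral sees the curve on V only. Together with
`exists_global_curve` this reduces brackets to curves smooth on ℝ. -/
theorem bracket_congr {V : Set ℝ} (hV : IsOpen V) {η ζ f g : ℝ → ℂ} (h : Set.EqOn η ζ V)
    (hf : IsTest V f) (hg : IsTest V g) (P Q : EtaField) :
    bracket P Q η f g = bracket P Q ζ f g := by
  refine integral_congr_fun fun x => integral_congr_fun fun y => ?_
  rw [grad_congr hV h hf, grad_congr hV h hg]
  by_cases hx : x ∈ V
  · by_cases hy : y ∈ V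
    · rw [etaKernel, etaKernel, h hx, h hy]
    · rw [grad_eq_zero hg Q ζ hy]; simp
  · rw [grad_eq_zero hf P ζ hx]; simp

theorem hamVec_congr {V : Set ℝ} (hV : IsOpen V) {η ζ g : ℝ → ℂ} (h : Set.EqOn η ζ V)
    (hg : IsTest V g) (Q : EtaField) : Set.EqOn (hamVec Q η g) (hamVec Q ζ g) V := by
  intro x hx
  refine integral_congr_fun fun y => ?_
  rw [grad_congr hV h hg]
  by_cases hy : y ∈ V
  · rw [etaKernel, etaKernel, h hx, h hy]
  · rw [grad_eq_zero hg Q ζ hy]; simp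

/-! ### Integrals against `sign` -/

theorem measurable_sign : Measurable Real.sign :=
  Measurable.ite measurableSet_Iio measurable_const
    (Measurable.ite measurableSet_Ioi measurable_const measurable_const)

theorem norm_sign_le (r : ℝ) : ‖((Real.sign r : ℝ) : ℂ)‖ ≤ 1 := by
  rcases Real.sign_apply_eq r with h | h | h <;> simp [h]

theorem IsTest.integrable {V : Set ℝ} {f : ℝ → ℂ} (hf : IsTest V f) : MeasureTheory.Integrable f :=
  hf.1.continuous.integrable_of_hasCompactSupport hf.2.1

/-- The convolution with `sign`. -/
def signInt (H : ℝ → ℂ) (x : ℝ) : ℂ := ∫ y, ((Real.sign (x - y) : ℝ) : ℂ) * H y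

theorem measurable_sign_sub (x : ℝ) : Measurable fun y => ((Real.sign (x - y) : ℝ) : ℂ) :=
  Complex.measurable_ofReal.comp (measurable_sign.comp (measurable_const.sub measurable_id))

theorem IsTest.integrable_sign_mul {V : Set ℝ} {f : ℝ → ℂ} (hf : IsTest V f) (x : ℝ) :
    MeasureTheory.Integrable fun y => ((Real.sign (x - y) : ℝ) : ℂ) * f y :=
  hf.integrable.bdd_mul (measurable_sign_sub x).aestronglyMeasurable
    (Filter.Eventually.of_forall fun _ => norm_sign_le _)

theorem signInt_eq {V : Set ℝ} {H : ℝ → ℂ} (hH : IsTest V H) (x : ℝ) :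
    signInt H x = 2 * (∫ y in Set.Iic x, H y) - ∫ y, H y := by
  have hi := hH.integrable
  have h1 := MeasureTheory.integral_add_compl (measurableSet_Iic (a := x))
    (hH.integrable_sign_mul x)
  have h2 := MeasureTheory.integral_add_compl (measurableSet_Iic (a := x)) hi
  have h3 : ∫ y in Set.Iic x, ((Real.sign (x - y) : ℝ) : ℂ) * H y = ∫ y in Set.Iic x, H y := by
    -- The endpoint y = x, where sign takes the value 0, is a null set and is dropped.
    rw [MeasureTheory.integral_Iic_eq_integral_Iio, MeasureTheory.integral_Iic_eq_integral_Iio]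
    refine MeasureTheory.setIntegral_congr_fun measurableSet_Iio fun y hy => ?_
    simp [Real.sign_of_pos (sub_pos.2 (Set.mem_Iio.1 hy))]
  have h4 : ∫ y in (Set.Iic x)ᶜ, ((Real.sign (x - y) : ℝ) : ℂ) * H y =
      -∫ y in (Set.Iic x)ᶜ, H y := by
    rw [← MeasureTheory.integral_neg]
    refine MeasureTheory.setIntegral_congr_fun measurableSet_Iic.compl fun y hy => ?_
    simp [Real.sign_of_neg (sub_neg.2 (not_le.1 hy))]
  rw [signInt, ← h1, h3, h4, ← h2]
  ring

/-- The derivative of sign is twice the Dirac function. -/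
theorem hasDerivAt_signInt {V : Set ℝ} {H : ℝ → ℂ} (hH : IsTest V H) (x : ℝ) :
    HasDerivAt (signInt H) (2 * H x) x := by
  have hi := hH.integrable
  have h : ∀ y, signInt H y =
      2 * ((∫ z in Set.Iic 0, H z) + ∫ z in (0 : ℝ)..y, H z) - ∫ z, H z := fun y => by
    rw [signInt_eq hH, ← intervalIntegral.integral_Iic_sub_Iic hi.integrableOn hi.integrableOn]
    ring
  rw [show signInt H = _ from funext h]
  have hc := hH.1.continuous
  have := (hc.integral_hasStrictDerivAt 0 x).hasDerivAt
  exact ((this.const_add _).const_mul 2).sub_const _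

theorem contDiff_signInt {V : Set ℝ} {H : ℝ → ℂ} (hH : IsTest V H) : ContDiff ℝ ∞ (signInt H) := by
  refine contDiff_infty_iff_deriv.2 ⟨fun x => (hasDerivAt_signInt hH x).differentiableAt, ?_⟩
  rw [show deriv (signInt H) = _ from funext fun x => (hasDerivAt_signInt hH x).deriv]
  exact contDiff_const.mul hH.1

theorem IsTest.integral_deriv {V : Set ℝ} {f : ℝ → ℂ} (hf : IsTest V f) :
    ∫ x, _root_.deriv f x = 0 :=
  MeasureTheory.integral_eq_zero_of_hasDerivAt_of_integrable hf.hasDerivAt hf.deriv.integrable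
    hf.integrable

theorem signInt_deriv {V : Set ℝ} {f : ℝ → ℂ} (hf : IsTest V f) (x : ℝ) :
    signInt (deriv f) x = 2 * f x := by
  rw [signInt_eq hf.deriv, hf.integral_deriv, sub_zero,
    HasCompactSupport.integral_Iic_deriv_eq (hf.1.of_le (by exact_mod_cast le_top)) hf.2.1]

theorem signInt_add {V W : Set ℝ} {f g : ℝ → ℂ} (hf : IsTest V f) (hg : IsTest W g) (x : ℝ) :
    signInt (fun y => f y + g y) x = signInt f x + signInt g x := by
  simp only [signInt, mul_add]
  exact MeasureTheory.integral_add (hf.integrable_sign_mul x) (hg.integrable_sign_mul x)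

theorem signInt_const_mul (f : ℝ → ℂ) (z : ℂ) (x : ℝ) :
    signInt (fun y => z * f y) x = z * signInt f x := by
  simp only [signInt, mul_left_comm _ z]
  exact MeasureTheory.integral_const_mul _ _

/-- Integration by parts. -/
theorem IsTest.integral_deriv_mul {V : Set ℝ} (hV : IsOpen V) {f φ φ' : ℝ → ℂ} (hf : IsTest V f)
    (hφ : ContDiffOn ℝ ∞ φ V) (hφ' : ∀ x ∈ V, HasDerivAt φ (φ' x) x) :
    ∫ x, _root_.deriv f x * φ x = -∫ x, f x * φ' x := by
  have h0 := (hf.mul_contDiffOn hV hφ).integral_deriv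
  rw [hf.deriv_mul hφ'] at h0
  have h1 := (hf.deriv.mul_contDiffOn hV hφ).integrable
  have h2 : MeasureTheory.Integrable fun x => f x * φ' x := by
    have : ContDiffOn ℝ ∞ φ' V :=
      (hφ.deriv_of_isOpen hV (m := ∞) (by simp)).congr fun x hx => (hφ' x hx).deriv.symm
    exact (hf.mul_contDiffOn hV this).integrable
  rw [MeasureTheory.integral_add h1 h2] at h0
  exact eq_neg_of_add_eq_zero_left h0

/-! ### Hamiltonian vector fields -/

theorem bracket_eq_integral_hamVec (P Q : EtaField) (η f g : ℝ → ℂ) :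
    bracket P Q η f g = ∫ x, grad P η f x * hamVec Q η g x := by
  refine integral_congr_fun fun x => ?_
  rw [hamVec, ← MeasureTheory.integral_const_mul]
  exact integral_congr_fun fun y => by ring

theorem IsTest.contDiff_mul {V : Set ℝ} {φ f : ℝ → ℂ} (hφ : ContDiff ℝ ∞ φ) (hf : IsTest V f) :
    IsTest V fun x => φ x * f x :=
  hf.of_tsupport_subset (hφ.mul hf.1) tsupport_mul_subset_right

/-- The vector field `∫ K(x, y) H(y) dy` for the kernel `K` of the basic bracket. -/
def kernelInt (η H : ℝ → ℂ) (x : ℝ) : ℂ := ∫ y, etaKernel η x y * H y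

theorem hamVec_eq_kernelInt (Q : EtaField) (η g : ℝ → ℂ) :
    hamVec Q η g = kernelInt η (grad Q η g) := rfl

/-- Expanding (η(x) − η(y))² separates the variables. All dependence on x sits in powers of η(x) and
in `signInt`, which are smooth although the kernel is not. -/
theorem kernelInt_eq {V : Set ℝ} {η H : ℝ → ℂ} (hη : ContDiff ℝ ∞ η) (hH : IsTest V H)
    (x : ℝ) : kernelInt η H x =
      η x ^ 2 * (∫ y, H y) - (∫ y, η y ^ 2 * H y) -
        (η x ^ 2 * signInt H x - 2 * η x * signInt (fun y => η y * H y) x +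
          signInt (fun y => η y ^ 2 * H y) x) := by
  have h1 : IsTest V fun y => η y * H y := hH.contDiff_mul hη
  have h2 : IsTest V fun y => η y ^ 2 * H y := hH.contDiff_mul (hη.pow 2)
  have e : ∀ y, etaKernel η x y * H y = η x ^ 2 * H y - η y ^ 2 * H y -
      (η x ^ 2 * (((Real.sign (x - y) : ℝ) : ℂ) * H y) -
        2 * η x * (((Real.sign (x - y) : ℝ) : ℂ) * (η y * H y)) +
        ((Real.sign (x - y) : ℝ) : ℂ) * (η y ^ 2 * H y)) := fun y => by
    rw [etaKernel]; ring
  have i0 := hH.integrable.const_mul (η x ^ 2)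
  have i1 := (hH.integrable_sign_mul x).const_mul (η x ^ 2)
  have i2 := (h1.integrable_sign_mul x).const_mul (2 * η x)
  have i3 := h2.integrable_sign_mul x
  have j1 : MeasureTheory.Integrable fun y => η x ^ 2 * H y - η y ^ 2 * H y := i0.sub h2.integrable
  have j2 : MeasureTheory.Integrable fun y => η x ^ 2 * (((Real.sign (x - y) : ℝ) : ℂ) * H y) -
      2 * η x * (((Real.sign (x - y) : ℝ) : ℂ) * (η y * H y)) := i1.sub i2
  have j3 : MeasureTheory.Integrable fun y =>
      η x ^ 2 * (((Real.sign (x - y) : ℝ) : ℂ) * H y) -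
        2 * η x * (((Real.sign (x - y) : ℝ) : ℂ) * (η y * H y)) +
        ((Real.sign (x - y) : ℝ) : ℂ) * (η y ^ 2 * H y) := j2.add i3
  rw [kernelInt, MeasureTheory.integral_congr_ae (Filter.Eventually.of_forall e),
    MeasureTheory.integral_sub j1 j3,
    MeasureTheory.integral_sub i0 h2.integrable, MeasureTheory.integral_add j2 i3,
    MeasureTheory.integral_sub i1 i2, MeasureTheory.integral_const_mul,
    MeasureTheory.integral_const_mul, MeasureTheory.integral_const_mul]
  rfl

theorem contDiff_kernelInt {V : Set ℝ} {η H : ℝ → ℂ} (hη : ContDiff ℝ ∞ η) (hH : IsTest V H) :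
    ContDiff ℝ ∞ (kernelInt η H) := by
  rw [show kernelInt η H = _ from funext (kernelInt_eq hη hH)]
  have h0 := contDiff_signInt hH
  have h1 := contDiff_signInt (hH.contDiff_mul hη)
  have h2 := contDiff_signInt (hH.contDiff_mul (hη.pow 2))
  exact (((hη.pow 2).mul contDiff_const).sub contDiff_const).sub
    ((((hη.pow 2).mul h0).sub ((contDiff_const.mul hη).mul h1)).add h2)

/-- The local terms are 2η²H − 4η²H + 2η²H = 0, a trace of the double zero of (η(x) − η(y))² on the
diagonal. -/
theorem hasDerivAt_kernelInt {V : Set ℝ} {η H : ℝ → ℂ} (hη : ContDiff ℝ ∞ η) (hH : IsTest V H)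
    (x : ℝ) : HasDerivAt (kernelInt η H)
      (2 * deriv η x * (η x * (∫ y, H y) - η x * signInt H x + signInt (fun y => η y * H y) x))
      x := by
  rw [show kernelInt η H = _ from funext (kernelInt_eq hη hH)]
  have hd : HasDerivAt η (deriv η x) x := (hη.differentiable (by simp)).differentiableAt.hasDerivAt
  have h0 := hasDerivAt_signInt hH x
  have h1 := hasDerivAt_signInt (hH.contDiff_mul hη) x
  have h2 := hasDerivAt_signInt (hH.contDiff_mul (hη.pow 2)) x
  refine (((hd.fun_pow 2).mul_const _).sub_const _ |>.sub
    ((((hd.fun_pow 2).mul h0).sub ((hd.const_mul 2).mul h1)).add h2)).congr_deriv ?_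
  push_cast
  ring

theorem etaKernel_swap (η : ℝ → ℂ) (x y : ℝ) : etaKernel η y x = -etaKernel η x y := by
  rw [etaKernel, etaKernel, ← neg_sub x y, Real.sign_neg]
  push_cast
  ring

theorem continuous_hasCompactSupport_prod {V W : Set ℝ} {G H : ℝ → ℂ} (hG : IsTest V G)
    (hH : IsTest W H) : HasCompactSupport fun p : ℝ × ℝ => G p.1 * H p.2 := by
  refine HasCompactSupport.intro (hG.2.1.prod hH.2.1) fun p hp => ?_
  by_contra h
  exact hp ⟨subset_tsupport _ (left_ne_zero_of_mul h), subset_tsupport _ (right_ne_zero_of_mul h)⟩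

theorem measurable_sign_fst_sub_snd :
    Measurable fun p : ℝ × ℝ => ((Real.sign (p.1 - p.2) : ℝ) : ℂ) :=
  Complex.measurable_ofReal.comp (measurable_sign.comp (measurable_fst.sub measurable_snd))

theorem integrable_mul_etaKernel {V W : Set ℝ} {η G H : ℝ → ℂ} (hη : Continuous η)
    (hG : IsTest V G) (hH : IsTest W H) :
    MeasureTheory.Integrable fun p : ℝ × ℝ => G p.1 * H p.2 * etaKernel η p.1 p.2 := by
  have hc := continuous_hasCompactSupport_prod hG hH
  have hGH : Continuous fun p : ℝ × ℝ => G p.1 * H p.2 :=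
    (hG.1.continuous.comp continuous_fst).mul (hH.1.continuous.comp continuous_snd)
  have hη1 : Continuous fun p : ℝ × ℝ => η p.1 := hη.comp continuous_fst
  have hη2 : Continuous fun p : ℝ × ℝ => η p.2 := hη.comp continuous_snd
  have i1 : MeasureTheory.Integrable fun p : ℝ × ℝ => G p.1 * H p.2 * (η p.1 ^ 2 - η p.2 ^ 2) :=
    (hGH.mul ((hη1.pow 2).sub (hη2.pow 2))).integrable_of_hasCompactSupport hc.mul_right
  have i2 : MeasureTheory.Integrable fun p : ℝ × ℝ => G p.1 * H p.2 * (η p.1 - η p.2) ^ 2 :=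
    (hGH.mul ((hη1.sub hη2).pow 2)).integrable_of_hasCompactSupport hc.mul_right
  have i3 := i2.bdd_mul measurable_sign_fst_sub_snd.aestronglyMeasurable
    (Filter.Eventually.of_forall fun _ => norm_sign_le _)
  refine (i1.sub i3).congr (Filter.Eventually.of_forall fun p => ?_)
  simp only [etaKernel, Pi.sub_apply]
  ring

theorem kernelInt_skew {V W : Set ℝ} {η G H : ℝ → ℂ} (hη : Continuous η) (hG : IsTest V G)
    (hH : IsTest W H) : ∫ x, G x * kernelInt η H x = -∫ x, H x * kernelInt η G x := by
  have h := MeasureTheory.integral_integral_swap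
    (f := fun x y => G x * H y * etaKernel η x y) (integrable_mul_etaKernel hη hG hH)
  have h1 : ∀ x, ∫ y, G x * H y * etaKernel η x y = G x * kernelInt η H x := fun x => by
    rw [kernelInt, ← MeasureTheory.integral_const_mul]
    exact integral_congr_fun fun y => by ring
  have h2 : ∀ y, ∫ x, G x * H y * etaKernel η x y = -(H y * kernelInt η G y) := fun y => by
    rw [kernelInt, ← MeasureTheory.integral_const_mul, ← MeasureTheory.integral_neg]
    exact integral_congr_fun fun x => by rw [etaKernel_swap η x y]; ring
  simp only [h1, h2, MeasureTheory.integral_neg] at h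
  exact h

theorem integrable_mul_kernelInt {V W : Set ℝ} {η G H : ℝ → ℂ} (hη : ContDiff ℝ ∞ η)
    (hG : IsTest V G) (hH : IsTest W H) :
    MeasureTheory.Integrable fun x => G x * kernelInt η H x := by
  have := hG.contDiff_mul (contDiff_kernelInt hη hH)
  simpa only [mul_comm] using this.integrable

/-! ### The bracket -/

theorem IsTest.of_subset {U V : Set ℝ} {f : ℝ → ℂ} (hf : IsTest U f) (h : tsupport f ⊆ V) :
    IsTest V f := ⟨hf.1, hf.2.1, h⟩

theorem bracket_skew {V : Set ℝ} (hV : IsOpen V) {η : ℝ → ℂ} (hη : ContDiff ℝ ∞ η)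
    {P Q : EtaField} (hP : RegularOn P η V) (hQ : RegularOn Q η V) {f g : ℝ → ℂ}
    (hf : IsTest V f) (hg : IsTest V g) : bracket P Q η f g = -bracket Q P η g f := by
  rw [bracket_eq_integral_hamVec, bracket_eq_integral_hamVec]
  exact kernelInt_skew hη.continuous (isTest_grad hV hη.contDiffOn hf hP)
    (isTest_grad hV hη.contDiffOn hg hQ)

theorem bracket_mul {V : Set ℝ} (hV : IsOpen V) {η : ℝ → ℂ} (hη : ContDiff ℝ ∞ η)
    {P Q R : EtaField} (hP : RegularOn P η V) (hQ : RegularOn Q η V) (hR : RegularOn R η V)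
    {f h : ℝ → ℂ} (hf : IsTest V f) (hh : IsTest V h) :
    bracket (P * Q) R η f h = bracket P R η (fun x => f x * value Q η x) h +
      bracket Q R η (fun x => f x * value P η x) h := by
  have hη' := hη.contDiffOn (s := V)
  have hX := isTest_grad hV hη' hh hR
  rw [bracket_eq_integral_hamVec, bracket_eq_integral_hamVec, bracket_eq_integral_hamVec,
    hamVec_eq_kernelInt, ← MeasureTheory.integral_add
      (integrable_mul_kernelInt hη (isTest_grad hV hη' (hf.mul_value hV hη' hQ) hP) hX)
      (integrable_mul_kernelInt hη (isTest_grad hV hη' (hf.mul_value hV hη' hP) hQ) hX)]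
  exact integral_congr_fun fun x => by rw [grad_mul hV hη' hP hQ hf, add_mul]

theorem bracket_D {V : Set ℝ} (hV : IsOpen V) {η : ℝ → ℂ} (hη : ContDiffOn ℝ ∞ η V)
    {P : EtaField} (hP : RegularOn P η V) (Q : EtaField) {f : ℝ → ℂ} (hf : IsTest V f)
    (g : ℝ → ℂ) : bracket (D P) Q η f g = -bracket P Q η (deriv f) g := by
  rw [bracket_eq_integral_hamVec, bracket_eq_integral_hamVec, ← MeasureTheory.integral_neg]
  exact integral_congr_fun fun x => by rw [grad_D hV hη hP hf, neg_mul]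

theorem bracket_eta (η f g : ℝ → ℂ) : bracket eta eta η f g =
    ∫ x, ∫ y, f x * g y *
      (η x ^ 2 - η y ^ 2 - (Real.sign (x - y) : ℝ) * (η x - η y) ^ 2) :=
  integral_congr_fun fun x => integral_congr_fun fun y => by
    rw [grad_eta, grad_eta, etaKernel]

/-! ### The brackets of θ, v and u -/

theorem value_theta (η : ℝ → ℂ) (x : ℝ) : value theta η x = deriv η x := by
  rw [theta, eta, D_var, value_eq, (reg_ev_var _ _).2, jet, iteratedDeriv_one]

theorem regularOn_eta (η : ℝ → ℂ) (V : Set ℝ) : RegularOn eta η V := regularOn_var 0 η V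

theorem regularOn_theta (η : ℝ → ℂ) (V : Set ℝ) : RegularOn theta η V := (regularOn_eta η V).D

theorem grad_theta {V : Set ℝ} (hV : IsOpen V) {η : ℝ → ℂ} (hη : ContDiffOn ℝ ∞ η V) {f : ℝ → ℂ}
    (hf : IsTest V f) (x : ℝ) : grad theta η f x = -deriv f x := by
  rw [theta, grad_D hV hη (regularOn_eta η V) hf, grad_eta]

theorem hasDerivAt_of_contDiff {η : ℝ → ℂ} (hη : ContDiff ℝ ∞ η) (x : ℝ) :
    HasDerivAt η (deriv η x) x :=
  (hη.differentiable (by simp)).differentiableAt.hasDerivAt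

theorem contDiff_deriv {η : ℝ → ℂ} (hη : ContDiff ℝ ∞ η) : ContDiff ℝ ∞ (deriv η) :=
  (contDiff_infty_iff_deriv.1 hη).2

theorem signInt_mul_deriv {V : Set ℝ} {η w : ℝ → ℂ} (hη : ContDiff ℝ ∞ η) (hw : IsTest V w)
    (x : ℝ) : signInt (fun y => η y * deriv w y) x =
      2 * (η x * w x) - signInt (fun y => deriv η y * w y) x := by
  have h1 : IsTest V fun y => η y * w y := hw.contDiff_mul hη
  have h2 : IsTest V fun y => η y * deriv w y := hw.deriv.contDiff_mul hη
  have h3 : IsTest V fun y => deriv η y * w y := hw.contDiff_mul (contDiff_deriv hη)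
  rw [← signInt_deriv h1, eq_sub_iff_add_eq, ← signInt_add h2 h3]
  congr 1
  funext y
  rw [((hasDerivAt_of_contDiff hη y).fun_mul (hw.hasDerivAt y)).deriv]
  ring

/-- Both gradients are derivatives. For the inner one, ∫ g' = 0 removes the part without sign and
integration by parts gives X' = 2η' · sign∗(η'g); for the outer one, the derivative moves from f to
X. -/
theorem bracket_theta_aux {V : Set ℝ} (hV : IsOpen V) {η : ℝ → ℂ} (hη : ContDiff ℝ ∞ η)
    {f g : ℝ → ℂ} (hf : IsTest V f) (hg : IsTest V g) : bracket theta theta η f g =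
      ∫ x, ∫ y, f x * g y *
        (2 * (Real.sign (x - y) : ℝ) * value theta η x * value theta η y) := by
  have hη' := hη.contDiffOn (s := V)
  have hH : grad theta η g = fun y => (-1) * deriv g y := by
    funext y; rw [grad_theta hV hη' hg]; ring
  have hHt : IsTest V fun y => (-1) * deriv g y := hg.deriv.const_mul _
  have hX : ∀ x, HasDerivAt (hamVec theta η g)
      (2 * deriv η x * signInt (fun y => deriv η y * g y) x) x := by
    intro x
    rw [hamVec_eq_kernelInt, hH]
    refine (hasDerivAt_kernelInt hη hHt x).congr_deriv ?_
    have h1 : (fun y => η y * ((-1) * deriv g y)) = fun y => (-1) * (η y * deriv g y) := by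
      funext y; ring
    rw [h1, signInt_const_mul, signInt_const_mul, signInt_mul_deriv hη hg, signInt_deriv hg,
      MeasureTheory.integral_const_mul, hg.integral_deriv]
    ring
  have hXc : ContDiff ℝ ∞ (hamVec theta η g) := by
    rw [hamVec_eq_kernelInt, hH]
    exact contDiff_kernelInt hη hHt
  have h := hf.integral_deriv_mul hV hXc.contDiffOn fun x _ => hX x
  rw [bracket_eq_integral_hamVec]
  simp only [grad_theta hV hη' hf, neg_mul, MeasureTheory.integral_neg]
  rw [h, neg_neg]
  refine integral_congr_fun fun x => ?_
  rw [signInt, ← MeasureTheory.integral_const_mul, ← MeasureTheory.integral_const_mul]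
  refine integral_congr_fun fun y => ?_
  rw [value_theta, value_theta]
  ring

theorem bracket_theta {U : Set ℝ} {η : ℝ → ℂ} (hU : IsOpen U) (hη : ContDiffOn ℝ ∞ η U)
    {f g : ℝ → ℂ} (hf : IsTest U f) (hg : IsTest U g) : bracket theta theta η f g =
      ∫ x, ∫ y, f x * g y *
        (2 * (Real.sign (x - y) : ℝ) * value theta η x * value theta η y) := by
  obtain ⟨V, ζ, hV, hKV, -, -, hζ, heq⟩ := exists_global_curve hU hη
    (hf.2.1.isCompact.union hg.2.1.isCompact) (Set.union_subset hf.2.2 hg.2.2)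
  have hf' := hf.of_subset (Set.subset_union_left.trans hKV)
  have hg' := hg.of_subset (Set.subset_union_right.trans hKV)
  rw [bracket_congr hV heq hf' hg', bracket_theta_aux hV hζ hf' hg']
  refine integral_congr_fun fun x => integral_congr_fun fun y => ?_
  by_cases hx : x ∈ V
  · by_cases hy : y ∈ V
    · rw [value_congr hV heq hx, value_congr hV heq hy]
    · rw [hg'.eq_zero hy]; simp
  · rw [hf'.eq_zero hx]; simp

theorem reg_theta_inv {η : ℝ → ℂ} {V : Set ℝ} (h : ∀ x ∈ V, deriv η x ≠ 0) :
    RegularOn theta⁻¹ η V ∧ ∀ x ∈ V, value theta⁻¹ η x = (deriv η x)⁻¹ := by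
  have key : ∀ x ∈ V, Reg (jet η x) theta⁻¹ ∧ ev (jet η x) theta⁻¹ = (deriv η x)⁻¹ := by
    intro x hx
    have hv : ev (jet η x) theta = deriv η x := value_theta η x
    have h1 := reg_ev_inv (regularOn_theta η V x hx) (hv ▸ h x hx)
    rwa [hv] at h1
  exact ⟨fun x hx => (key x hx).1, fun x hx => (key x hx).2⟩

theorem vField_eq_algebraMap :
    vField = algebraMap ℂ EtaField (1 / 2) * (D theta * theta⁻¹) := by
  rw [vField_eq, map_div₀, map_one, map_ofNat, div_eq_mul_inv (D theta)]

theorem regularOn_vField {η : ℝ → ℂ} {V : Set ℝ} (h : ∀ x ∈ V, deriv η x ≠ 0) :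
    RegularOn vField η V := by
  rw [vField_eq_algebraMap]
  exact (regularOn_const _ _ _).mul ((regularOn_theta η V).D.mul (reg_theta_inv h).1)

theorem regularOn_uField {η : ℝ → ℂ} {V : Set ℝ} (h : ∀ x ∈ V, deriv η x ≠ 0) :
    RegularOn uField η V := fun x hx => by
  rw [uField_eq]
  exact (reg_ev_sub ((regularOn_vField h).D x hx) (reg_ev_pow (regularOn_vField h x hx) 2).1).1

/-- The variational derivative of `v` is `(1/2) (f' / η')'`. -/
theorem grad_vField {V : Set ℝ} (hV : IsOpen V) {η : ℝ → ℂ} (hη : ContDiffOn ℝ ∞ η V)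
    (h0 : ∀ x ∈ V, deriv η x ≠ 0) {f : ℝ → ℂ} (hf : IsTest V f) (x : ℝ) :
    grad vField η f x = (1 / 2) * deriv (fun y => deriv f y * value theta⁻¹ η y) x := by
  have hθ := regularOn_theta η V
  have hv := regularOn_vField h0
  obtain ⟨hi, hiv⟩ := reg_theta_inv h0
  -- The relation θ' = 2vθ is tested on q = f/θ, so that the Leibniz rule produces grad v on qθ = f:
  -- q'' = 2 grad v[f] − 2(qv)'.
  set q : ℝ → ℂ := fun y => f y * value theta⁻¹ η y with hq
  have hqt : IsTest V q := hf.mul_value hV hη hi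
  have hqθ : (fun y => q y * value theta η y) = f := by
    funext y
    by_cases hy : y ∈ V
    · simp only [hq]
      rw [hiv y hy, value_theta, mul_assoc, inv_mul_cancel₀ (h0 y hy), mul_one]
    · simp only [hq]
      rw [hf.eq_zero hy]; simp
  -- the relation `∂θ = 2 v θ`
  have hrel : D theta = algebraMap ℂ EtaField 2 * (vField * theta) := by
    rw [D_theta, map_ofNat]; ring
  have h1 : grad (D theta) η q x = deriv (deriv q) x := by
    rw [grad_D hV hη hθ hqt, grad_theta hV hη hqt.deriv, neg_neg]
  have h2 := grad_mul hV hη (regularOn_const 2 η V) (hv.mul hθ) hqt x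
  rw [← hrel, h1, grad_const, zero_add] at h2
  have hc : (fun y => q y * value (algebraMap ℂ EtaField 2) η y) = fun y => 2 * q y := by
    funext y
    rw [value_eq, (reg_ev_const _ _).2, mul_comm]
  rw [hc, grad_const_mul_test, grad_mul hV hη hv hθ hqt, hqθ,
    grad_theta hV hη (hqt.mul_value hV hη hv)] at h2
  -- Since (1/θ)' = −2v/θ, the function whose derivative has been found is f'/θ.
  have h3 : (fun y => deriv f y * value theta⁻¹ η y) =
      fun y => deriv q y + 2 * (q y * value vField η y) := by
    have hd : deriv q = _ := deriv_mul_value hV hη hf hi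
    rw [hd]
    have e : (fun y => 2 * (q y * value vField η y)) =
        fun y => f y * (2 * (value theta⁻¹ η y * value vField η y)) := by
      funext y; simp only [hq]; ring
    have e' : (fun y => f y * value (D theta⁻¹) η y) =
        fun y => f y * (-(2 * (value theta⁻¹ η y * value vField η y))) := by
      refine hf.mul_congr fun y hy => ?_
      have hD : D theta⁻¹ = -(algebraMap ℂ EtaField 2 * (theta⁻¹ * vField)) := by
        rw [Derivation.leibniz_inv, D_theta, map_ofNat, smul_eq_mul]
        have := theta_ne_zero
        field_simp
      have r1 := reg_ev_mul (hi y hy) (hv y hy)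
      have r2 := reg_ev_mul (reg_ev_const (jet η y) 2).1 r1.1
      rw [hD, value_eq, (reg_ev_neg r2.1).2, r2.2, r1.2, (reg_ev_const _ _).2]
      rfl
    funext y
    have e1 := congrFun e y
    have e2 := congrFun e' y
    linear_combination -e1 - e2
  have ht := hqt.mul_value hV hη hv
  rw [h3, ((hqt.deriv.hasDerivAt x).fun_add ((ht.hasDerivAt x).const_mul 2)).deriv]
  linear_combination -(1 / 2) * h2

/-- The gradient of v on g is half the derivative of g'/θ; after one integration by parts θ cancels
and sign meets g' itself. This gives X' = −2θg, and pairing with f'/θ removes θ once more: nothing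
nonlocal survives. -/
theorem bracket_vField_aux {V : Set ℝ} (hV : IsOpen V) {η : ℝ → ℂ} (hη : ContDiff ℝ ∞ η)
    (h0 : ∀ x ∈ V, deriv η x ≠ 0) {f g : ℝ → ℂ} (hf : IsTest V f) (hg : IsTest V g) :
    bracket vField vField η f g = ∫ x, deriv f x * g x := by
  have hη' := hη.contDiffOn (s := V)
  obtain ⟨hi, hiv⟩ := reg_theta_inv h0
  set w : ℝ → ℂ := fun y => deriv g y * value theta⁻¹ η y with hw
  have hwt : IsTest V w := hg.deriv.mul_value hV hη' hi
  have hθw : (fun y => deriv η y * w y) = deriv g := by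
    funext y
    by_cases hy : y ∈ V
    · simp only [hw]
      rw [hiv y hy, mul_left_comm, mul_inv_cancel₀ (h0 y hy), mul_one]
    · rw [hwt.eq_zero hy, hg.deriv.eq_zero hy, mul_zero]
  have hH : grad vField η g = fun y => (1 / 2) * deriv w y := by
    funext y; rw [grad_vField hV hη' h0 hg]
  have hHt : IsTest V fun y => (1 / 2) * deriv w y := hwt.deriv.const_mul _
  have hX : ∀ x, HasDerivAt (hamVec vField η g) (-2 * deriv η x * g x) x := by
    intro x
    rw [hamVec_eq_kernelInt, hH]
    refine (hasDerivAt_kernelInt hη hHt x).congr_deriv ?_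
    have h1 : (fun y => η y * ((1 / 2) * deriv w y)) = fun y => (1 / 2) * (η y * deriv w y) := by
      funext y; ring
    rw [h1, signInt_const_mul, signInt_const_mul, signInt_mul_deriv hη hwt, signInt_deriv hwt,
      MeasureTheory.integral_const_mul, hwt.integral_deriv, hθw, signInt_deriv hg]
    ring
  have hXc : ContDiff ℝ ∞ (hamVec vField η g) := by
    rw [hamVec_eq_kernelInt, hH]
    exact contDiff_kernelInt hη hHt
  have hft : IsTest V fun y => deriv f y * value theta⁻¹ η y := hf.deriv.mul_value hV hη' hi
  have h := hft.integral_deriv_mul hV hXc.contDiffOn fun x _ => hX x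
  rw [bracket_eq_integral_hamVec]
  simp only [grad_vField hV hη' h0 hf, mul_assoc, MeasureTheory.integral_const_mul]
  rw [h, ← MeasureTheory.integral_neg, ← MeasureTheory.integral_const_mul]
  refine integral_congr_fun fun x => ?_
  by_cases hx : x ∈ V
  · rw [hiv x hx]
    have := h0 x hx
    field_simp
  · rw [hg.eq_zero hx]; simp

/-- The variational derivative of `u` in terms of that of `v`. -/
theorem grad_uField {V : Set ℝ} (hV : IsOpen V) {η : ℝ → ℂ} (hη : ContDiffOn ℝ ∞ η V)
    (h0 : ∀ x ∈ V, deriv η x ≠ 0) {f : ℝ → ℂ} (hf : IsTest V f) (x : ℝ) :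
    grad uField η f x =
      grad vField η (fun y => (-1) * deriv f y + (-2) * (f y * value vField η y)) x := by
  have hv := regularOn_vField h0
  have hu := regularOn_uField h0
  have hft := hf.mul_value hV hη hv
  -- The Miura relation, used as u + v² = v', reads grad u[f] + 2 grad v[fv] = −grad v[f'].
  have h1 := grad_add hV hη hu (hv.mul hv) hf x
  rw [show uField + vField * vField = D vField by rw [uField_eq]; ring, grad_D hV hη hv hf,
    grad_mul hV hη hv hv hf] at h1
  rw [grad_add_test hV hη hv (hf.deriv.const_mul _) (hft.const_mul _), grad_const_mul_test,
    grad_const_mul_test]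
  linear_combination -h1

theorem value_uField {η : ℝ → ℂ} {V : Set ℝ} (h0 : ∀ x ∈ V, deriv η x ≠ 0) {x : ℝ} (hx : x ∈ V) :
    value uField η x = value (D vField) η x - value vField η x ^ 2 := by
  have h1 := regularOn_vField h0 x hx
  have h2 := reg_ev_pow h1 2
  rw [uField_eq, value_eq, (reg_ev_sub (Reg.D h1) h2.1).2, h2.2]
  rfl

/-- Equals ∫ φ'ψ with φ = −f' − 2fv and ψ = −g' − 2gv. The terms in f'' cancel, and v enters only
through v' − v² and its derivative. -/
theorem bracket_uField_aux {V : Set ℝ} (hV : IsOpen V) {η : ℝ → ℂ} (hη : ContDiff ℝ ∞ η)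
    (h0 : ∀ x ∈ V, deriv η x ≠ 0) {f g : ℝ → ℂ} (hf : IsTest V f) (hg : IsTest V g) :
    bracket uField uField η f g = ∫ x, (-iteratedDeriv 3 f x * g x -
      2 * (deriv f x * g x * (2 * value uField η x) + f x * g x * value (D uField) η x)) := by
  have hη' := hη.contDiffOn (s := V)
  have hv := regularOn_vField h0
  set φ : ℝ → ℂ := fun y => (-1) * deriv f y + (-2) * (f y * value vField η y) with hφ
  set ψ : ℝ → ℂ := fun y => (-1) * deriv g y + (-2) * (g y * value vField η y) with hψ
  have hφt : IsTest V φ := (hf.deriv.const_mul _).add ((hf.mul_value hV hη' hv).const_mul _)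
  have hψt : IsTest V ψ := (hg.deriv.const_mul _).add ((hg.mul_value hV hη' hv).const_mul _)
  have hb : bracket uField uField η f g = bracket vField vField η φ ψ :=
    integral_congr_fun fun x => integral_congr_fun fun y => by
      rw [grad_uField hV hη' h0 hf, grad_uField hV hη' h0 hg]
  rw [hb, bracket_vField_aux hV hη h0 hφt hψt]
  have h1 : ∫ x, deriv g x * deriv φ x = -∫ x, g x * deriv (deriv φ) x :=
    hg.integral_deriv_mul hV hφt.deriv.1.contDiffOn fun x _ => hφt.deriv.hasDerivAt x
  have i1 : MeasureTheory.Integrable fun x => deriv g x * deriv φ x :=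
    (hφt.deriv.contDiff_mul hg.deriv.1).integrable
  have i1' : MeasureTheory.Integrable fun x => -(deriv g x * deriv φ x) := i1.neg
  have i2 : MeasureTheory.Integrable fun x => g x * deriv (deriv φ) x :=
    (hφt.deriv.deriv.contDiff_mul hg.1).integrable
  have i3 : MeasureTheory.Integrable fun x => (-2) * deriv φ x * (g x * value vField η x) := by
    have := ((hg.mul_value hV hη' hv).contDiff_mul (contDiff_const (c := (-2 : ℂ)) |>.mul
      hφt.deriv.1))
    exact this.integrable
  -- Integration by parts leaves g undifferentiated, so the rest can be checked pointwise.
  have h2 : ∫ x, deriv φ x * ψ x = ∫ x, (g x * deriv (deriv φ) x +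
      (-2) * deriv φ x * (g x * value vField η x)) := by
    rw [MeasureTheory.integral_add i2 i3]
    have : ∀ x, deriv φ x * ψ x =
        -(deriv g x * deriv φ x) + (-2) * deriv φ x * (g x * value vField η x) := fun x => by
      simp only [hψ]; ring
    rw [integral_congr_fun this, MeasureTheory.integral_add i1' i3,
      MeasureTheory.integral_neg, h1, neg_neg]
  rw [h2]
  refine integral_congr_fun fun x => ?_
  by_cases hx : x ∈ V
  · have hvx : ∀ y ∈ V, HasDerivAt (value vField η) (value (D vField) η y) y :=
      fun y hy => hasDerivAt_value hV hη' hv hy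
    have hvx' : ∀ y ∈ V, HasDerivAt (value (D vField) η) (value (D (D vField)) η y) y :=
      fun y hy => hasDerivAt_value hV hη' hv.D hy
    have d1 : deriv φ = fun y => (-1) * deriv (deriv f) y +
        (-2) * (deriv f y * value vField η y + f y * value (D vField) η y) := by
      funext y
      have := congrFun (deriv_mul_value hV hη' hf hv) y
      simp only [hφ]
      rw [(((hf.deriv.hasDerivAt y).const_mul (-1)).fun_add
        (((hf.mul_value hV hη' hv).hasDerivAt y).const_mul (-2))).deriv, this]
    have d2 : deriv (deriv φ) x = (-1) * deriv (deriv (deriv f)) x +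
        (-2) * ((deriv (deriv f) x * value vField η x + deriv f x * value (D vField) η x) +
          (deriv f x * value (D vField) η x + f x * value (D (D vField)) η x)) := by
      rw [d1]
      exact (((hf.deriv.deriv.hasDerivAt x).const_mul (-1)).fun_add
        ((((hf.deriv.hasDerivAt x).fun_mul (hvx x hx)).fun_add
          ((hf.hasDerivAt x).fun_mul (hvx' x hx))).const_mul (-2))).deriv
    have hDu : value (D uField) η x =
        value (D (D vField)) η x - 2 * (value vField η x * value (D vField) η x) := by
      have e : D uField = D (D vField) - algebraMap ℂ EtaField 2 * (vField * D vField) := by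
        rw [uField_eq, map_sub, Derivation.leibniz_pow, map_ofNat]
        simp only [smul_eq_mul, nsmul_eq_mul]
        push_cast
        ring
      have r1 := reg_ev_mul (hv x hx) (hv.D x hx)
      have r2 := reg_ev_mul (reg_ev_const (jet η x) 2).1 r1.1
      rw [e, value_eq, (reg_ev_sub (hv.D.D x hx) r2.1).2, r2.2, r1.2, (reg_ev_const _ _).2]
      rfl
    rw [d2, d1, hDu, value_uField h0 hx, iteratedDeriv_eq_iterate]
    simp only [Function.iterate_succ, Function.iterate_zero, Function.comp_apply, id]
    ring
  · rw [hg.eq_zero hx]; simp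

theorem deltaPairing_one_mul {V : Set ℝ} {f g : ℝ → ℂ} (hf : IsTest V f) :
    deltaPairing 1 (fun x y => f x * g y) = 2 * ∫ y, -(deriv f y * g y) := by
  rw [deltaPairing]
  congr 1
  refine integral_congr_fun fun y => ?_
  rw [iteratedDeriv_one, ((hf.hasDerivAt y).mul_const (g y)).deriv]
  ring

theorem bracket_vField {U : Set ℝ} {η : ℝ → ℂ} (hU : IsOpen U) (hη : ContDiffOn ℝ ∞ η U)
    (h0 : ∀ x ∈ U, deriv η x ≠ 0) {f g : ℝ → ℂ} (hf : IsTest U f) (hg : IsTest U g) :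
    bracket vField vField η f g = -(1 / 2) * deltaPairing 1 (fun x y => f x * g y) := by
  obtain ⟨V, ζ, hV, hKV, -, hVU, hζ, heq⟩ := exists_global_curve hU hη
    (hf.2.1.isCompact.union hg.2.1.isCompact) (Set.union_subset hf.2.2 hg.2.2)
  have hf' := hf.of_subset (Set.subset_union_left.trans hKV)
  have hg' := hg.of_subset (Set.subset_union_right.trans hKV)
  have h0' : ∀ x ∈ V, deriv ζ x ≠ 0 := fun x hx => by
    rw [← value_theta, ← value_congr hV heq hx, value_theta]
    exact h0 x (hVU (subset_closure hx))
  rw [bracket_congr hV heq hf' hg', bracket_vField_aux hV hζ h0' hf' hg', deltaPairing_one_mul hf,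
    MeasureTheory.integral_neg]
  ring

theorem bracket_uField {U : Set ℝ} {η : ℝ → ℂ} (hU : IsOpen U) (hη : ContDiffOn ℝ ∞ η U)
    (h0 : ∀ x ∈ U, deriv η x ≠ 0) {f g : ℝ → ℂ} (hf : IsTest U f) (hg : IsTest U g) :
    bracket uField uField η f g = (1 / 2) * deltaPairing 3 (fun x y => f x * g y) +
      deltaPairing 1 (fun x y => f x * g y * (value uField η x + value uField η y)) := by
  obtain ⟨V, ζ, hV, hKV, -, hVU, hζ, heq⟩ := exists_global_curve hU hη
    (hf.2.1.isCompact.union hg.2.1.isCompact) (Set.union_subset hf.2.2 hg.2.2)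
  have hf' := hf.of_subset (Set.subset_union_left.trans hKV)
  have hg' := hg.of_subset (Set.subset_union_right.trans hKV)
  have h0' : ∀ x ∈ V, deriv ζ x ≠ 0 := fun x hx => by
    rw [← value_theta, ← value_congr hV heq hx, value_theta]
    exact h0 x (hVU (subset_closure hx))
  have hu := regularOn_uField h0'
  rw [bracket_congr hV heq hf' hg', bracket_uField_aux hV hζ h0' hf' hg', deltaPairing,
    deltaPairing]
  have e3 : ∀ y, (-1 : ℂ) ^ 3 * iteratedDeriv 3 (fun x => f x * g y) y =
      -iteratedDeriv 3 f y * g y := fun y => by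
    rw [iteratedDeriv_mul_const_field]; ring
  have e1 : ∀ y, (-1 : ℂ) ^ 1 * iteratedDeriv 1
      (fun x => f x * g y * (value uField η x + value uField η y)) y =
      -(deriv f y * g y * (2 * value uField ζ y) + f y * g y * value (D uField) ζ y) := fun y => by
    by_cases hy : y ∈ V
    · have hd := (hasDerivAt_value hV hζ.contDiffOn hu hy).congr_of_eventuallyEq
        (Filter.eventuallyEq_of_mem (hV.mem_nhds hy) fun x hx => value_congr hV heq hx uField)
      rw [iteratedDeriv_one, (((hf.hasDerivAt y).mul_const (g y)).fun_mul
        (hd.add_const (value uField η y))).deriv, value_congr hV heq hy]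
      ring
    · rw [hg'.eq_zero hy]
      simp
  rw [integral_congr_fun e3, integral_congr_fun e1]
  have i1 : MeasureTheory.Integrable fun y => -iteratedDeriv 3 f y * g y :=
    (hg.contDiff_mul (hf.iteratedDeriv 3).neg.1).integrable
  have i2 : MeasureTheory.Integrable fun y => 2 * (deriv f y * g y * (2 * value uField ζ y) +
      f y * g y * value (D uField) ζ y) := by
    have t1 := ((hg'.contDiff_mul hf.deriv.1).mul_value hV hζ.contDiffOn hu).const_mul 2
    have t2 := (hg'.contDiff_mul hf.1).mul_value hV hζ.contDiffOn hu.D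
    have t3 := ((t1.add t2).const_mul 2).integrable
    refine t3.congr (Filter.Eventually.of_forall fun y => ?_)
    simp only
    ring
  rw [MeasureTheory.integral_sub i1 i2, MeasureTheory.integral_const_mul,
    MeasureTheory.integral_neg]
  ring

/-! ### Transformation of curves -/

/-- The jet of `(a η + c)/(b η + d)` in terms of the jet of `η`. -/
def moebiusJet (g : SL2) (j : ℕ → ℂ) (n : ℕ) : ℂ := ev j (D^[n] (moebiusElt g))

theorem reg_ev_moebiusDen (g : SL2) (j : ℕ → ℂ) :
    Reg j (moebiusDen g) ∧ ev j (moebiusDen g) = g 0 1 * j 0 + g 1 1 := by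
  have h1 := reg_ev_mul (reg_ev_const j (g 0 1)).1 (reg_ev_var j 0).1
  have h2 := reg_ev_add h1.1 (reg_ev_const j (g 1 1)).1
  rw [h1.2, (reg_ev_const j _).2, (reg_ev_const j _).2, (reg_ev_var j 0).2] at h2
  exact h2

theorem reg_ev_moebiusElt {g : SL2} {j : ℕ → ℂ} (h : g 0 1 * j 0 + g 1 1 ≠ 0) :
    Reg j (moebiusElt g) ∧
      ev j (moebiusElt g) = (g 0 0 * j 0 + g 1 0) / (g 0 1 * j 0 + g 1 1) := by
  have h1 := reg_ev_mul (reg_ev_const j (g 0 0)).1 (reg_ev_var j 0).1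
  have h2 := reg_ev_add h1.1 (reg_ev_const j (g 1 0)).1
  have h3 := reg_ev_moebiusDen g j
  have h4 := reg_ev_fdiv h2.1 h3.1 (h3.2 ▸ h)
  rw [h2.2, h1.2, h3.2, (reg_ev_const j _).2, (reg_ev_const j _).2, (reg_ev_var j 0).2] at h4
  exact h4

theorem reg_D_iterate {j : ℕ → ℂ} {P : EtaField} (h : Reg j P) (n : ℕ) : Reg j (D^[n] P) := by
  induction n with
  | zero => exact h
  | succ n ih => rw [Function.iterate_succ_apply']; exact ih.D

theorem moebiusHom_var (g : SL2) (n : ℕ) : moebiusHom g (var n) = D^[n] (moebiusElt g) := by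
  induction n with
  | zero => exact moebiusHom_eta g
  | succ n ih => rw [← D_var, moebiusHom_D, ih, Function.iterate_succ_apply']

/-- g acts by substituting ∂ⁿ of the Möbius fraction for η⁽ⁿ⁾, and evaluation turns this
substitution into a change of jet. -/
theorem reg_ev_moebiusHom {g : SL2} {j : ℕ → ℂ} (h : g 0 1 * j 0 + g 1 1 ≠ 0) {P : EtaField}
    (hP : Reg (moebiusJet g j) P) :
    Reg j (moebiusHom g P) ∧ ev j (moebiusHom g P) = ev (moebiusJet g j) P := by
  have key : ∀ a : MvPolynomial ℕ ℂ, Reg j (moebiusHom g (algebraMap _ EtaField a)) ∧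
      ev j (moebiusHom g (algebraMap _ EtaField a)) = eval (moebiusJet g j) a := by
    intro a
    induction a using MvPolynomial.induction_on with
    | C z =>
      rw [algebraMap_C, AlgHom.commutes, eval_C]
      exact reg_ev_const j z
    | add p q hp hq =>
      rw [map_add, map_add, map_add, ← hp.2, ← hq.2]
      exact reg_ev_add hp.1 hq.1
    | mul_X p n hp =>
      rw [map_mul, map_mul, algebraMap_X, moebiusHom_var, map_mul, eval_X, ← hp.2]
      exact reg_ev_mul hp.1 (reg_D_iterate (reg_ev_moebiusElt h).1 n)
  obtain ⟨a, b, hb, rfl⟩ := hP.exists_div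
  rw [map_div₀, (reg_ev_div hb).2, ← (key a).2, ← (key b).2]
  exact reg_ev_fdiv (key a).1 (key b).1 ((key b).2 ▸ hb)

theorem moebiusJet_zero {g : SL2} {j : ℕ → ℂ} (h : g 0 1 * j 0 + g 1 1 ≠ 0) :
    moebiusJet g j 0 = (g 0 0 * j 0 + g 1 0) / (g 0 1 * j 0 + g 1 1) := (reg_ev_moebiusElt h).2

theorem inv_entries (g : SL2) :
    g⁻¹ 0 0 = g 1 1 ∧ g⁻¹ 0 1 = -g 0 1 ∧ g⁻¹ 1 0 = -g 1 0 ∧ g⁻¹ 1 1 = g 0 0 := by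
  rw [Matrix.SpecialLinearGroup.coe_inv, Matrix.adjugate_fin_two]
  simp

theorem moebiusJet_den {g : SL2} {j : ℕ → ℂ} (h : g 0 1 * j 0 + g 1 1 ≠ 0) :
    g⁻¹ 0 1 * moebiusJet g j 0 + g⁻¹ 1 1 ≠ 0 := by
  rw [moebiusJet_zero h, (inv_entries g).2.1, (inv_entries g).2.2.2]
  have : -g 0 1 * ((g 0 0 * j 0 + g 1 0) / (g 0 1 * j 0 + g 1 1)) + g 0 0 =
      (g 0 1 * j 0 + g 1 1)⁻¹ := by
    field_simp
    linear_combination det_entries g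
  rw [this]
  exact inv_ne_zero h

theorem moebiusJet_inv {g : SL2} {j : ℕ → ℂ} (h : g 0 1 * j 0 + g 1 1 ≠ 0) :
    moebiusJet g⁻¹ (moebiusJet g j) = j := by
  funext n
  have h1 := reg_D_iterate (reg_ev_moebiusElt (moebiusJet_den h)).1 n
  rw [moebiusJet, ← (reg_ev_moebiusHom h h1).2, ← moebiusHom_var, ← AlgHom.comp_apply,
    moebiusHom_mul, mul_inv_cancel, moebiusHom_one]
  exact (reg_ev_var j n).2

/-- The inverse of g takes the transformed jet back to j, where P is regular. So g⁻¹P, which is P,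
is regular at the transformed jet. -/
theorem reg_moebiusJet {g : SL2} {j : ℕ → ℂ} (h : g 0 1 * j 0 + g 1 1 ≠ 0) {P : EtaField}
    (hP : Reg j P) (hg : moebiusHom g⁻¹ P = P) : Reg (moebiusJet g j) P := by
  have := (reg_ev_moebiusHom (moebiusJet_den h) (P := P) ((moebiusJet_inv h).symm ▸ hP)).1
  rwa [hg] at this

theorem jet_moebiusCurve {V : Set ℝ} (hV : IsOpen V) {η : ℝ → ℂ} (hη : ContDiffOn ℝ ∞ η V)
    {g : SL2} (hg : ∀ x ∈ V, g 0 1 * η x + g 1 1 ≠ 0) {x : ℝ} (hx : x ∈ V) :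
    jet (moebiusCurve g η) x = moebiusJet g (jet η x) := by
  have hreg : ∀ n, RegularOn (D^[n] (moebiusElt g)) η V := fun n y hy =>
    reg_D_iterate (reg_ev_moebiusElt (j := jet η y) (hg y hy)).1 n
  funext n
  change iteratedDeriv n (moebiusCurve g η) x = value (D^[n] (moebiusElt g)) η x
  induction n generalizing x with
  | zero => exact (reg_ev_moebiusElt (j := jet η x) (hg x hx)).2.symm
  | succ n ih =>
    rw [iteratedDeriv_succ, Function.iterate_succ_apply']
    have h := hasDerivAt_value hV hη (hreg n) hx
    exact (h.congr_of_eventuallyEq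
      (Filter.eventuallyEq_of_mem (hV.mem_nhds hx) fun y hy => ih hy)).deriv

theorem contDiffOn_moebiusCurve {V : Set ℝ} {η : ℝ → ℂ} (hη : ContDiffOn ℝ ∞ η V)
    {g : SL2} (hg : ∀ x ∈ V, g 0 1 * η x + g 1 1 ≠ 0) : ContDiffOn ℝ ∞ (moebiusCurve g η) V := by
  have h := ((contDiffOn_const (c := g 0 0)).mul hη |>.add (contDiffOn_const (c := g 1 0))).mul
    (((contDiffOn_const (c := g 0 1)).mul hη |>.add (contDiffOn_const (c := g 1 1))).inv hg)
  exact h.congr fun x _ => div_eq_mul_inv _ _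

/-- The transformation of variational derivatives. -/
theorem grad_moebiusHom {V : Set ℝ} (hV : IsOpen V) {η : ℝ → ℂ} (hη : ContDiffOn ℝ ∞ η V)
    {g : SL2} (hg : ∀ x ∈ V, g 0 1 * η x + g 1 1 ≠ 0) {P : EtaField}
    (hP : RegularOn P (moebiusCurve g η) V) {f : ℝ → ℂ} (hf : IsTest V f) (x : ℝ) :
    grad (moebiusHom g P) η f x =
      1 / (g 0 1 * η x + g 1 1) ^ 2 * grad P (moebiusCurve g η) f x := by
  have hζ := contDiffOn_moebiusCurve hη hg
  have hre : ∀ {P : EtaField}, RegularOn P (moebiusCurve g η) V → ∀ x ∈ V,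
      Reg (jet η x) (moebiusHom g P) ∧
        value (moebiusHom g P) η x = value P (moebiusCurve g η) x := by
    intro P hP x hx
    have hj := jet_moebiusCurve hV hη hg hx
    have h := reg_ev_moebiusHom (j := jet η x) (hg x hx) (P := P) (hj ▸ hP x hx)
    rwa [← hj] at h
  have hreg : ∀ {P : EtaField}, RegularOn P (moebiusCurve g η) V →
      RegularOn (moebiusHom g P) η V := fun hP x hx => (hre hP x hx).1
  have hval : ∀ {P : EtaField}, RegularOn P (moebiusCurve g η) V → ∀ {f : ℝ → ℂ}, IsTest V f →
      (fun y => f y * value (moebiusHom g P) η y) =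
        fun y => f y * value P (moebiusCurve g η) y :=
    fun hP f hf => hf.mul_congr fun y hy => (hre hP y hy).2
  -- The factor is the derivative of the Möbius fraction in η. It is the same for every n, because
  -- `grad_D` moves derivatives to the test function on both sides alike.
  have hvar : ∀ n, ∀ {f : ℝ → ℂ}, IsTest V f → ∀ x, grad (moebiusHom g (var n)) η f x =
      1 / (g 0 1 * η x + g 1 1) ^ 2 * grad (var n) (moebiusCurve g η) f x := by
    intro n
    induction n with
    | zero =>
      intro f hf x
      rw [show var 0 = eta from rfl, grad_eta, moebiusHom_eta, grad_eq_sum (M := 1)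
        (fun i hi => partialD_moebiusElt_pos g (by omega))]
      simp only [Finset.range_one, Finset.sum_singleton, pow_zero, one_mul, iteratedDeriv_zero]
      by_cases hx : x ∈ V
      · have h3 := reg_ev_moebiusDen g (jet η x)
        have h4 := reg_ev_pow h3.1 2
        have h5 := reg_ev_fdiv (reg_ev_one (jet η x)).1 h4.1
          (by rw [h4.2, h3.2]; exact pow_ne_zero 2 (hg x hx))
        rw [partialD_moebiusElt_zero, value_eq, h5.2, h4.2, h3.2, (reg_ev_one _).2, mul_comm]
        rfl
      · rw [hf.eq_zero hx]; simp
    | succ n ih =>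
      intro f hf x
      rw [← D_var, moebiusHom_D, grad_D hV hη (hreg (regularOn_var n _ V)) hf,
        grad_D hV hζ (regularOn_var n _ V) hf, ih hf.deriv, mul_neg]
  have hpolyreg : ∀ a : MvPolynomial ℕ ℂ, RegularOn (algebraMap _ EtaField a)
      (moebiusCurve g η) V := fun a x _ => (reg_ev_poly _ a).1
  have hpoly : ∀ a : MvPolynomial ℕ ℂ, ∀ {f : ℝ → ℂ}, IsTest V f → ∀ x,
      grad (moebiusHom g (algebraMap _ EtaField a)) η f x =
      1 / (g 0 1 * η x + g 1 1) ^ 2 * grad (algebraMap _ EtaField a) (moebiusCurve g η) f x := by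
    intro a
    induction a using MvPolynomial.induction_on with
    | C z =>
      intro f hf x
      rw [algebraMap_C, AlgHom.commutes, grad_const, grad_const, mul_zero]
    | add p q hp hq =>
      intro f hf x
      rw [map_add, map_add, grad_add hV hη (hreg (hpolyreg p)) (hreg (hpolyreg q)) hf,
        grad_add hV hζ (hpolyreg p) (hpolyreg q) hf, hp hf, hq hf, mul_add]
    | mul_X p n hp =>
      intro f hf x
      have hX := hpolyreg (X n)
      rw [map_mul, map_mul, grad_mul hV hη (hreg (hpolyreg p)) (hreg hX) hf,
        grad_mul hV hζ (hpolyreg p) hX hf, hval hX hf, hval (hpolyreg p) hf,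
        hp (hf.mul_value hV hζ hX), algebraMap_X, hvar n (hf.mul_value hV hζ (hpolyreg p)),
        mul_add]
  set a := IsFractionRing.num (MvPolynomial ℕ ℂ) P
  set b := (IsFractionRing.den (MvPolynomial ℕ ℂ) P : MvPolynomial ℕ ℂ)
  have hb : ∀ x ∈ V, eval (jet (moebiusCurve g η) x) b ≠ 0 := hP
  have hbinv : ∀ x ∈ V, Reg (jet (moebiusCurve g η) x) (algebraMap _ EtaField b)⁻¹ ∧
      value (algebraMap _ EtaField b)⁻¹ (moebiusCurve g η) x *
        value (algebraMap _ EtaField b) (moebiusCurve g η) x = 1 := fun x hx => by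
    have h1 := reg_ev_poly (jet (moebiusCurve g η) x) b
    have h2 := reg_ev_inv h1.1 (h1.2 ▸ hb x hx)
    refine ⟨h2.1, ?_⟩
    rw [value_eq, value_eq, h2.2, inv_mul_cancel₀ (h1.2 ▸ hb x hx)]
  have hPab : algebraMap _ EtaField a = P * algebraMap _ EtaField b := by
    rw [← IsFractionRing.mk'_num_den' (MvPolynomial ℕ ℂ) P]
    exact (div_mul_cancel₀ _ (algebraMap_ne_zero (nonZeroDivisors.ne_zero
      (IsFractionRing.den (MvPolynomial ℕ ℂ) P).2))).symm
  -- From a = P b: the law for the polynomial a, tested on f/b, minus the Leibniz term that contains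
  -- grad b, is the law for P tested on f.
  have hq : IsTest V fun y => f y * value (algebraMap _ EtaField b)⁻¹ (moebiusCurve g η) y :=
    hf.mul_value hV hζ fun x hx => (hbinv x hx).1
  set q : ℝ → ℂ := fun y => f y * value (algebraMap _ EtaField b)⁻¹ (moebiusCurve g η) y
  have hqb : (fun y => q y * value (algebraMap _ EtaField b) (moebiusCurve g η) y) = f := by
    funext y
    by_cases hy : y ∈ V
    · simp only [q]
      rw [mul_assoc, (hbinv y hy).2, mul_one]
    · rw [hq.eq_zero hy, hf.eq_zero hy, zero_mul]
  have h1 := hpoly a hq x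
  rw [hPab, map_mul, grad_mul hV hη (hreg hP) (hreg (hpolyreg b)) hq,
    grad_mul hV hζ hP (hpolyreg b) hq, hval (hpolyreg b) hq, hval hP hq, hqb,
    hpoly b (hq.mul_value hV hζ hP)] at h1
  linear_combination h1

/-! ### The linearization of a density -/

/-- The linearization `∑ᵢ (∂P/∂η⁽ⁱ⁾) (d/dx)ⁱ` of the density `P` along the curve `η`. -/
def linearization (P : EtaField) (η φ : ℝ → ℂ) (x : ℝ) : ℂ :=
  ∑ᶠ i : ℕ, value (partialD i P) η x * iteratedDeriv i φ x

theorem linearization_eq_sum {P : EtaField} {M : ℕ} (hM : ∀ i, M ≤ i → partialD i P = 0)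
    (η φ : ℝ → ℂ) (x : ℝ) : linearization P η φ x =
      ∑ i ∈ Finset.range M, value (partialD i P) η x * iteratedDeriv i φ x := by
  refine finsum_eq_sum_of_support_subset _ fun i hi => ?_
  rw [Finset.mem_coe, Finset.mem_range]
  by_contra h
  exact hi (by simp only [hM i (not_lt.1 h), value_zero, zero_mul])

theorem contDiff_iteratedDeriv {φ : ℝ → ℂ} (hφ : ContDiff ℝ ∞ φ) (n : ℕ) :
    ContDiff ℝ ∞ (iteratedDeriv n φ) :=
  contDiffOn_univ.1 (contDiffOn_iteratedDeriv isOpen_univ hφ.contDiffOn n)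

theorem integral_iteratedDeriv_mul {V : Set ℝ} {f φ : ℝ → ℂ} (hf : IsTest V f)
    (hφ : ContDiff ℝ ∞ φ) (n : ℕ) :
    ∫ x, iteratedDeriv n f x * φ x = (-1) ^ n * ∫ x, f x * iteratedDeriv n φ x := by
  induction n generalizing φ with
  | zero => simp
  | succ n ih =>
    have h := ((hf.iteratedDeriv n).mono (Set.subset_univ V)).integral_deriv_mul isOpen_univ
      hφ.contDiffOn fun x _ => hasDerivAt_of_contDiff hφ x
    rw [iteratedDeriv_succ, h, ih (contDiff_deriv hφ), ← iteratedDeriv_succ', pow_succ]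
    ring

/-- `grad` is the formal adjoint of the linearization applied to f: the signs of the integrations by
parts cancel the (−1)ⁱ. -/
theorem integral_grad_mul {V : Set ℝ} (hV : IsOpen V) {η : ℝ → ℂ} (hη : ContDiffOn ℝ ∞ η V)
    {P : EtaField} (hP : RegularOn P η V) {f : ℝ → ℂ} (hf : IsTest V f) {φ : ℝ → ℂ}
    (hφ : ContDiff ℝ ∞ φ) :
    ∫ x, grad P η f x * φ x = ∫ x, f x * linearization P η φ x := by
  obtain ⟨M, hM⟩ := exists_partialD_eq_zero P
  simp only [grad_eq_sum hM, linearization_eq_sum hM, Finset.sum_mul, Finset.mul_sum]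
  have ht : ∀ i, IsTest V fun y => f y * value (partialD i P) η y :=
    fun i => hf.mul_value hV hη (hP.partialD i)
  rw [MeasureTheory.integral_finsetSum, MeasureTheory.integral_finsetSum]
  · refine Finset.sum_congr rfl fun i _ => ?_
    have h := integral_iteratedDeriv_mul (ht i) hφ i
    simp only [mul_assoc] at h ⊢
    rw [MeasureTheory.integral_const_mul, h, ← mul_assoc, ← mul_pow]
    simp
  · intro i _
    have := (ht i).contDiff_mul (contDiff_iteratedDeriv hφ i)
    exact this.integrable.congr (Filter.Eventually.of_forall fun y => by simp only; ring)
  · intro i _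
    have := (((ht i).iteratedDeriv i).const_mul ((-1) ^ i)).contDiff_mul hφ
    exact this.integrable.congr (Filter.Eventually.of_forall fun y => by simp only; ring)

/-- The bridge from algebra to analysis: with `integral_grad_mul`, the identity `evo w P = 0`
becomes the vanishing of an integral against grad P. -/
theorem linearization_value {V : Set ℝ} (hV : IsOpen V) {η : ℝ → ℂ} (hη : ContDiffOn ℝ ∞ η V)
    {P w : EtaField} (hP : RegularOn P η V) (hw : RegularOn w η V) {φ : ℝ → ℂ}
    (hφ : Set.EqOn φ (value w η) V) {x : ℝ} (hx : x ∈ V) :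
    linearization P η φ x = value (evo w P) η x := by
  obtain ⟨N, hN⟩ := exists_order P
  have hD : ∀ n, RegularOn (D^[n] w) η V := fun n y hy => reg_D_iterate (hw y hy) n
  have hval : ∀ n, ∀ x ∈ V, iteratedDeriv n φ x = value (D^[n] w) η x := by
    intro n
    induction n with
    | zero => exact fun x hx => hφ hx
    | succ n ih =>
      intro x hx
      rw [iteratedDeriv_succ, Function.iterate_succ_apply']
      exact ((hasDerivAt_value hV hη (hD n) hx).congr_of_eventuallyEq
        (Filter.eventuallyEq_of_mem (hV.mem_nhds hx) ih)).deriv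
  rw [linearization_eq_sum (fun i hi => partialD_eq_zero_of_order hN hi), evo, hN N le_rfl,
    value_eq, (reg_ev_sum _ fun i _ => (reg_ev_mul (hD i x hx) (hP.partialD i x hx)).1).2]
  refine Finset.sum_congr rfl fun i _ => ?_
  rw [(reg_ev_mul (hD i x hx) (hP.partialD i x hx)).2, hval i x hx, mul_comm]
  rfl

/-! ### Infinitesimal invariance -/

theorem evo_eq_zero_of_mem_diffAdjoin {w P Q : EtaField} (h : evo w P = 0)
    (hQ : Q ∈ diffAdjoin P) : evo w Q = 0 := by
  let E : IntermediateField ℂ EtaField :=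
    { carrier := {x | evo w x = 0}
      mul_mem' := fun {x y} hx hy => by
        simp only [Set.mem_ofPred_eq] at *
        rw [Derivation.leibniz, hx, hy, smul_zero, smul_zero, add_zero]
      add_mem' := fun {x y} hx hy => by
        simp only [Set.mem_ofPred_eq] at *
        rw [map_add, hx, hy, add_zero]
      algebraMap_mem' := fun z => Derivation.map_algebraMap _ _
      inv_mem' := fun x hx => by
        simp only [Set.mem_ofPred_eq] at *
        rw [Derivation.leibniz_inv, hx, smul_zero] }
  exact diffAdjoin_le (E := E) (fun x hx => by
    change evo w (D x) = 0
    rw [evo_D, show evo w x = 0 from hx, map_zero]) h hQ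

theorem evo_one_theta : evo 1 theta = 0 := by
  rw [theta, evo_D, evo_eta, Derivation.map_one_eq_zero]

theorem evo_vField (w : EtaField) :
    evo w vField = (D (D w) - 2 * vField * D w) / (2 * theta) := by
  have h := congrArg (evo w) D_theta
  rw [evo_D, Derivation.leibniz, Derivation.leibniz] at h
  have h2 : evo w (2 : EtaField) = 0 := by
    rw [← map_ofNat (algebraMap ℂ EtaField) 2, Derivation.map_algebraMap]
  have hθ : evo w theta = D w := by rw [theta, evo_D, evo_eta]
  rw [h2, hθ] at h
  simp only [smul_eq_mul, mul_zero, add_zero] at h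
  rw [eq_div_iff (mul_ne_zero two_ne_zero theta_ne_zero)]
  linear_combination -h

/-- The variation of v' − v² is z' − 2vz. The infinitesimal Möbius fields 1, η, η² move v by 0, 0,
θ, all of which solve z' = 2vz. -/
theorem evo_uField (w : EtaField) (z : EtaField) (hz : evo w vField = z)
    (hDz : D z = 2 * vField * z) : evo w uField = 0 := by
  rw [uField_eq, map_sub, evo_D, Derivation.leibniz_pow, hz, hDz]
  simp only [smul_eq_mul, nsmul_eq_mul]
  push_cast
  ring

theorem evo_uField_one : evo 1 uField = 0 :=
  evo_uField 1 0 (by rw [evo_vField, Derivation.map_one_eq_zero]; simp) (by simp)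

theorem evo_uField_eta : evo eta uField = 0 :=
  evo_uField eta 0 (by
    rw [evo_vField, show D eta = theta from rfl, D_theta]; simp) (by simp)

theorem evo_uField_eta_sq : evo (eta ^ 2) uField = 0 := by
  refine evo_uField (eta ^ 2) theta ?_ D_theta
  have h1 : D (eta ^ 2) = 2 * eta * theta := by
    rw [Derivation.leibniz_pow, theta]
    simp only [smul_eq_mul, nsmul_eq_mul]
    push_cast
    ring
  have h2 : D (D (eta ^ 2)) = 2 * theta ^ 2 + 2 * eta * D theta := by
    have h3 : D (2 : EtaField) = 0 := by
      rw [← map_ofNat (algebraMap ℂ EtaField) 2, Derivation.map_algebraMap]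
    rw [h1, Derivation.leibniz, Derivation.leibniz, h3]
    simp only [smul_eq_mul]
    change 2 * eta * D theta + theta * (2 * theta + eta * 0) = _
    ring
  rw [evo_vField, h2, h1, D_theta]
  have := theta_ne_zero
  field_simp
  ring

theorem evo_one_eq_zero {S : Subgroup SL2} (hS : unipotent ≤ S) {P : EtaField}
    (hP : P ∈ invariants S) : evo 1 P = 0 :=
  evo_eq_zero_of_mem_diffAdjoin evo_one_theta (invariants_unipotent ▸ invariants_anti hS hP)

theorem evo_eq_zero_of_mem_invariants_top {P : EtaField} (hP : P ∈ invariants ⊤) :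
    evo 1 P = 0 ∧ evo eta P = 0 ∧ evo (eta ^ 2) P = 0 := by
  rw [invariants_top] at hP
  exact ⟨evo_eq_zero_of_mem_diffAdjoin evo_uField_one hP,
    evo_eq_zero_of_mem_diffAdjoin evo_uField_eta hP,
    evo_eq_zero_of_mem_diffAdjoin evo_uField_eta_sq hP⟩

theorem integral_grad_mul_eq_zero {V : Set ℝ} (hV : IsOpen V) {η : ℝ → ℂ}
    (hη : ContDiff ℝ ∞ η) {P : EtaField} (hP : RegularOn P η V) {f : ℝ → ℂ} (hf : IsTest V f)
    {k : ℕ} (h : evo (eta ^ k) P = 0) : ∫ x, η x ^ k * grad P η f x = 0 := by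
  have hw : RegularOn (eta ^ k) η V := fun x hx => (reg_ev_pow (regularOn_eta η V x hx) k).1
  have hφ : Set.EqOn (fun x => η x ^ k) (value (eta ^ k) η) V := fun x hx => by
    have h1 : ev (jet η x) eta = η x := (reg_ev_var (jet η x) 0).2
    rw [value_eq, (reg_ev_pow (regularOn_eta η V x hx) k).2, h1]
  have h1 := integral_grad_mul hV hη.contDiffOn hP hf (hη.pow k)
  have h2 : ∀ x, f x * linearization P η (fun x => η x ^ k) x = 0 := fun x => by
    by_cases hx : x ∈ V
    · rw [linearization_value hV hη.contDiffOn hP hw hφ hx, h, value_zero, mul_zero]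
    · rw [hf.eq_zero hx, zero_mul]
  rw [integral_congr_fun h2, MeasureTheory.integral_zero] at h1
  rw [← h1]
  exact integral_congr_fun fun x => mul_comm _ _

/-! ### Invariance of the bracket -/

/-- Differences η(x) − η(y) transform exactly by the two factors, so the part with sign is
covariant. The defect comes from η(x)² − η(y)² alone and is therefore polynomial. -/
theorem etaKernel_moebiusCurve {g : SL2} {η : ℝ → ℂ} {x y : ℝ} (hx : g 0 1 * η x + g 1 1 ≠ 0)
    (hy : g 0 1 * η y + g 1 1 ≠ 0) : (g 0 1 * η x + g 1 1) ^ 2 * (g 0 1 * η y + g 1 1) ^ 2 *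
      etaKernel (moebiusCurve g η) x y = etaKernel η x y +
        2 * (g 0 0 * g 0 1 * (η x ^ 2 * η y - η x * η y ^ 2) +
          g 0 1 * g 1 0 * (η x ^ 2 - η y ^ 2) + g 1 0 * g 1 1 * (η x - η y)) := by
  have hdet := det_entries g
  have h1 : moebiusCurve g η x * (g 0 1 * η x + g 1 1) = g 0 0 * η x + g 1 0 :=
    div_mul_cancel₀ _ hx
  have h2 : moebiusCurve g η y * (g 0 1 * η y + g 1 1) = g 0 0 * η y + g 1 0 :=
    div_mul_cancel₀ _ hy
  rw [etaKernel, etaKernel]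
  generalize moebiusCurve g η x = X at *
  generalize moebiusCurve g η y = Y at *
  generalize ((Real.sign (x - y) : ℝ) : ℂ) = s at *
  have e1 : (g 0 1 * η x + g 1 1) * (g 0 1 * η y + g 1 1) * (X - Y) = η x - η y := by
    linear_combination (g 0 1 * η y + g 1 1) * h1 - (g 0 1 * η x + g 1 1) * h2 +
      (η x - η y) * hdet
  have e2 : (g 0 1 * η x + g 1 1) * (g 0 1 * η y + g 1 1) * (X + Y) =
      (g 0 0 * η x + g 1 0) * (g 0 1 * η y + g 1 1) +
        (g 0 0 * η y + g 1 0) * (g 0 1 * η x + g 1 1) := by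
    linear_combination (g 0 1 * η y + g 1 1) * h1 + (g 0 1 * η x + g 1 1) * h2
  have e3 : (g 0 1 * η x + g 1 1) ^ 2 * (g 0 1 * η y + g 1 1) ^ 2 *
      (X ^ 2 - Y ^ 2 - s * (X - Y) ^ 2) =
      ((g 0 1 * η x + g 1 1) * (g 0 1 * η y + g 1 1) * (X - Y)) *
        ((g 0 1 * η x + g 1 1) * (g 0 1 * η y + g 1 1) * (X + Y)) -
      s * ((g 0 1 * η x + g 1 1) * (g 0 1 * η y + g 1 1) * (X - Y)) ^ 2 := by ring
  rw [e3, e1, e2]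
  linear_combination (η x - η y) * (η x + η y) * hdet

/-- The gradients supply the factors of the kernel, so the brackets differ by products of moments ∫
ηᵏ grad P · ∫ ηˡ grad Q with k, l ≤ 2. For b = c = 0 there are none. For b = 0 one of k, l is zero
and the other one, so the zeroth moments of P and Q suffice. In general it is enough that the three
moments of P vanish. -/
theorem bracket_moebiusCurve {V : Set ℝ} (hV : IsOpen V) {η : ℝ → ℂ} (hη : ContDiff ℝ ∞ η)
    {g : SL2} (hg : ∀ x ∈ V, g 0 1 * η x + g 1 1 ≠ 0) {P Q : EtaField}
    (hP : RegularOn P η V) (hQ : RegularOn Q η V)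
    (hP' : RegularOn P (moebiusCurve g η) V) (hQ' : RegularOn Q (moebiusCurve g η) V)
    (hgP : moebiusHom g P = P) (hgQ : moebiusHom g Q = Q)
    (h1 : g 0 1 = 0 ∨ (evo 1 P = 0 ∧ evo eta P = 0 ∧ evo (eta ^ 2) P = 0))
    (h2 : g 0 1 = 0 ∧ g 1 0 = 0 ∨ evo 1 P = 0 ∧ evo 1 Q = 0) {f h : ℝ → ℂ} (hf : IsTest V f)
    (hh : IsTest V h) : bracket P Q (moebiusCurve g η) f h = bracket P Q η f h := by
  have hη' := hη.contDiffOn (s := V)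
  set G := grad P η f with hG
  set H := grad Q η h with hH
  have hGt : IsTest V G := isTest_grad hV hη' hf hP
  have hHt : IsTest V H := isTest_grad hV hη' hh hQ
  have hgrad : ∀ {P : EtaField} {f : ℝ → ℂ}, RegularOn P (moebiusCurve g η) V →
      moebiusHom g P = P → IsTest V f → ∀ x ∈ V,
      grad P (moebiusCurve g η) f x = (g 0 1 * η x + g 1 1) ^ 2 * grad P η f x := by
    intro P f hP' hgP hf x hx
    have e := grad_moebiusHom hV hη' hg hP' hf x
    rw [hgP] at e
    rw [e, ← mul_assoc, mul_one_div_cancel (pow_ne_zero 2 (hg x hx)), one_mul]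
  have hpt : ∀ x y, grad P (moebiusCurve g η) f x * grad Q (moebiusCurve g η) h y *
      etaKernel (moebiusCurve g η) x y = G x * (etaKernel η x y * H y) +
        2 * G x * (g 0 0 * g 0 1 * (η x ^ 2 * (η y ^ 1 * H y) - η x * (η y ^ 2 * H y)) +
          g 0 1 * g 1 0 * (η x ^ 2 * (η y ^ 0 * H y) - η y ^ 2 * H y) +
          g 1 0 * g 1 1 * (η x * (η y ^ 0 * H y) - η y ^ 1 * H y)) := by
    intro x y
    by_cases hx : x ∈ V
    · by_cases hy : y ∈ V
      · rw [hgrad hP' hgP hf x hx, hgrad hQ' hgQ hh y hy]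
        linear_combination G x * H y * etaKernel_moebiusCurve (hg x hx) (hg y hy)
      · rw [grad_eq_zero hh Q _ hy, hHt.eq_zero hy]; ring
    · rw [grad_eq_zero hf P _ hx, hGt.eq_zero hx]; ring
  have iH : ∀ k : ℕ, MeasureTheory.Integrable fun y => η y ^ k * H y :=
    fun k => (hHt.contDiff_mul (hη.pow k)).integrable
  have iG : ∀ k : ℕ, MeasureTheory.Integrable fun y => η y ^ k * G y :=
    fun k => (hGt.contDiff_mul (hη.pow k)).integrable
  have iK : ∀ x, MeasureTheory.Integrable fun y => etaKernel η x y * H y := by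
    intro x
    have h2 := (hHt.contDiff_mul (contDiff_const (c := η x) |>.sub hη |>.pow 2))
    have h3 := (hHt.contDiff_mul (contDiff_const (c := η x ^ 2) |>.sub (hη.pow 2))).integrable.sub
      (h2.integrable_sign_mul x)
    refine h3.congr (Filter.Eventually.of_forall fun y => ?_)
    simp only [etaKernel, Pi.sub_apply]
    ring
  set I : ℕ → ℂ := fun k => ∫ y, η y ^ k * H y with hI
  have hin : ∀ x, ∫ y, grad P (moebiusCurve g η) f x * grad Q (moebiusCurve g η) h y *
      etaKernel (moebiusCurve g η) x y = G x * kernelInt η H x +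
        (2 * (g 0 0 * g 0 1 * I 1 + g 0 1 * g 1 0 * I 0) * (η x ^ 2 * G x) +
          2 * (g 1 0 * g 1 1 * I 0 - g 0 0 * g 0 1 * I 2) * (η x ^ 1 * G x) +
          -2 * (g 0 1 * g 1 0 * I 2 + g 1 0 * g 1 1 * I 1) * (η x ^ 0 * G x)) := by
    intro x
    have e : ∀ y, grad P (moebiusCurve g η) f x * grad Q (moebiusCurve g η) h y *
        etaKernel (moebiusCurve g η) x y = G x * (etaKernel η x y * H y) +
        (2 * G x * (g 0 0 * g 0 1 * η x ^ 2 - g 1 0 * g 1 1) * (η y ^ 1 * H y) +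
        (2 * G x * (-g 0 0 * g 0 1 * η x - g 0 1 * g 1 0) * (η y ^ 2 * H y) +
        2 * G x * (g 0 1 * g 1 0 * η x ^ 2 + g 1 0 * g 1 1 * η x) * (η y ^ 0 * H y))) :=
      fun y => by rw [hpt x y]; ring
    have j2 : MeasureTheory.Integrable fun y =>
        (2 * G x * (-g 0 0 * g 0 1 * η x - g 0 1 * g 1 0) * (η y ^ 2 * H y) +
        2 * G x * (g 0 1 * g 1 0 * η x ^ 2 + g 1 0 * g 1 1 * η x) * (η y ^ 0 * H y)) :=
      ((iH 2).const_mul _).add ((iH 0).const_mul _)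
    have j1 : MeasureTheory.Integrable fun y =>
        (2 * G x * (g 0 0 * g 0 1 * η x ^ 2 - g 1 0 * g 1 1) * (η y ^ 1 * H y) +
        (2 * G x * (-g 0 0 * g 0 1 * η x - g 0 1 * g 1 0) * (η y ^ 2 * H y) +
        2 * G x * (g 0 1 * g 1 0 * η x ^ 2 + g 1 0 * g 1 1 * η x) * (η y ^ 0 * H y))) :=
      ((iH 1).const_mul _).add j2
    rw [integral_congr_fun e, MeasureTheory.integral_add ((iK x).const_mul _) j1,
      MeasureTheory.integral_add ((iH 1).const_mul _) j2,
      MeasureTheory.integral_add ((iH 2).const_mul _) ((iH 0).const_mul _),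
      MeasureTheory.integral_const_mul, MeasureTheory.integral_const_mul,
      MeasureTheory.integral_const_mul, MeasureTheory.integral_const_mul]
    change G x * kernelInt η H x + (_ * I 1 + (_ * I 2 + _ * I 0)) = _
    ring
  have j2 : MeasureTheory.Integrable fun x =>
      (2 * (g 0 0 * g 0 1 * I 1 + g 0 1 * g 1 0 * I 0) * (η x ^ 2 * G x) +
          2 * (g 1 0 * g 1 1 * I 0 - g 0 0 * g 0 1 * I 2) * (η x ^ 1 * G x)) :=
    ((iG 2).const_mul _).add ((iG 1).const_mul _)
  have j1 : MeasureTheory.Integrable fun x =>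
      (2 * (g 0 0 * g 0 1 * I 1 + g 0 1 * g 1 0 * I 0) * (η x ^ 2 * G x) +
          2 * (g 1 0 * g 1 1 * I 0 - g 0 0 * g 0 1 * I 2) * (η x ^ 1 * G x) +
          -2 * (g 0 1 * g 1 0 * I 2 + g 1 0 * g 1 1 * I 1) * (η x ^ 0 * G x)) :=
    j2.add ((iG 0).const_mul _)
  rw [bracket, integral_congr_fun hin, MeasureTheory.integral_add
    (integrable_mul_kernelInt hη hGt hHt) j1, MeasureTheory.integral_add j2 ((iG 0).const_mul _),
    MeasureTheory.integral_add ((iG 2).const_mul _) ((iG 1).const_mul _),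
    MeasureTheory.integral_const_mul, MeasureTheory.integral_const_mul,
    MeasureTheory.integral_const_mul, bracket_eq_integral_hamVec, hamVec_eq_kernelInt]
  have hz : ∀ {k : ℕ}, evo (eta ^ k) P = 0 → ∫ x, η x ^ k * G x = 0 := fun hk =>
    integral_grad_mul_eq_zero hV hη hP hf hk
  have hI0 : evo 1 Q = 0 → I 0 = 0 := fun hk =>
    integral_grad_mul_eq_zero hV hη hQ hh (k := 0) (by rwa [pow_zero])
  rcases h1 with hb | ⟨p0, p1, p2⟩
  · rcases h2 with ⟨-, hc⟩ | ⟨p0, q0⟩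
    · rw [hb, hc]; ring
    · rw [hb, hI0 q0, hz (k := 0) (by rwa [pow_zero])]; ring
  · rw [hz p2, hz (k := 1) (by rwa [pow_one]), hz (k := 0) (by rwa [pow_zero])]; ring

theorem isPoissonSubfield {S : Subgroup SL2}
    (hS : S = cartan ∨ S = unipotent ∨ S = borelLower ∨ S = ⊤) : IsPoissonSubfield S := by
  intro P hP Q hQ g hgS U η hU hη hPU hQU hgU
  have hfix : ∀ {P : EtaField}, P ∈ invariants S → ∀ k ∈ S, moebiusHom k P = P :=
    fun hP => mem_invariants_iff.1 hP
  have hreg : ∀ {P : EtaField}, P ∈ invariants S → RegularOn P η U →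
      RegularOn P (moebiusCurve g η) U := fun {P} hP hPU x hx => by
    have h := reg_moebiusJet (j := jet η x) (hgU x hx) (hPU x hx) (hfix hP _ (S.inv_mem hgS))
    rwa [← jet_moebiusCurve hU hη hgU hx] at h
  have hP' := hreg hP hPU
  have hQ' := hreg hQ hQU
  refine ⟨hP', hQ', fun f h hf hh => ?_⟩
  obtain ⟨V, ζ, hV, hKV, -, hVU, hζ, heq⟩ := exists_global_curve hU hη
    (hf.2.1.isCompact.union hh.2.1.isCompact) (Set.union_subset hf.2.2 hh.2.2)
  have hVU' : V ⊆ U := subset_closure.trans hVU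
  have hf' := hf.of_subset (Set.subset_union_left.trans hKV)
  have hh' := hh.of_subset (Set.subset_union_right.trans hKV)
  have heq' : Set.EqOn (moebiusCurve g η) (moebiusCurve g ζ) V := fun x hx => by
    rw [moebiusCurve, moebiusCurve, heq hx]
  have h1 : g 0 1 = 0 ∨ (evo 1 P = 0 ∧ evo eta P = 0 ∧ evo (eta ^ 2) P = 0) := by
    rcases hS with rfl | rfl | rfl | rfl
    · exact Or.inl hgS.1
    · exact Or.inl hgS.1
    · exact Or.inl hgS
    · exact Or.inr (evo_eq_zero_of_mem_invariants_top hP)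
  have h2 : g 0 1 = 0 ∧ g 1 0 = 0 ∨ evo 1 P = 0 ∧ evo 1 Q = 0 := by
    rcases hS with rfl | rfl | rfl | rfl
    · exact Or.inl hgS
    · exact Or.inr ⟨evo_one_eq_zero le_rfl hP, evo_one_eq_zero le_rfl hQ⟩
    · exact Or.inr ⟨evo_one_eq_zero unipotent_le_borelLower hP,
        evo_one_eq_zero unipotent_le_borelLower hQ⟩
    · exact Or.inr ⟨evo_one_eq_zero le_top hP, evo_one_eq_zero le_top hQ⟩
  rw [bracket_congr hV heq' hf' hh', bracket_congr hV heq hf' hh']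
  exact bracket_moebiusCurve hV hζ (fun x hx => heq hx ▸ hgU x (hVU' hx))
    ((hPU.mono hVU').congr hV heq) ((hQU.mono hVU').congr hV heq)
    ((hP'.mono hVU').congr hV heq') ((hQ'.mono hVU').congr hV heq')
    (hfix hP g hgS) (hfix hQ g hgS) h1 h2 hf' hh'

/-! ### Variations of a curve -/

theorem jet_add_mul {η ξ : ℝ → ℂ} (hη : ContDiff ℝ ∞ η) (hξ : ContDiff ℝ ∞ ξ) (t x : ℝ) (n : ℕ) :
    jet (fun y => η y + t * ξ y) x n = jet η x n + t * jet ξ x n := by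
  have h1 : ContDiffAt ℝ n η x := (hη.of_le (by exact_mod_cast le_top)).contDiffAt
  have h2 : ContDiffAt ℝ n ξ x := (hξ.of_le (by exact_mod_cast le_top)).contDiffAt
  rw [jet, iteratedDeriv_fun_add h1 (contDiffAt_const.mul h2), iteratedDeriv_const_mul_field]
  rfl

theorem continuous_jet_add_mul {η ξ : ℝ → ℂ} (hη : ContDiff ℝ ∞ η) (hξ : ContDiff ℝ ∞ ξ) :
    Continuous fun p : ℝ × ℝ => jet (fun y => η y + p.1 * ξ y) p.2 := by
  refine continuous_pi fun n => ?_
  simp only [jet_add_mul hη hξ]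
  have h1 : Continuous (iteratedDeriv n η) := (contDiff_iteratedDeriv hη n).continuous
  have h2 : Continuous (iteratedDeriv n ξ) := (contDiff_iteratedDeriv hξ n).continuous
  exact (h1.comp continuous_snd).add
    ((Complex.continuous_ofReal.comp continuous_fst).mul (h2.comp continuous_snd))

theorem contDiff_add_mul {η ξ : ℝ → ℂ} (hη : ContDiff ℝ ∞ η) (hξ : ContDiff ℝ ∞ ξ) (t : ℝ) :
    ContDiff ℝ ∞ fun y => η y + t * ξ y :=
  hη.add (contDiff_const.mul hξ)

/-- Regularity along a compact piece of a curve is an open condition. -/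
theorem exists_regularOn_add_mul {K : Set ℝ} (hK : IsCompact K) {η ξ : ℝ → ℂ}
    (hη : ContDiff ℝ ∞ η) (hξ : ContDiff ℝ ∞ ξ) {P : EtaField} (hP : RegularOn P η K) :
    ∃ ε > 0, ∀ t ∈ Set.Ioo (-ε) ε, RegularOn P (fun y => η y + (t : ℝ) * ξ y) K := by
  have h : ∀ᶠ t : ℝ in nhds 0, ∀ x ∈ K, Reg (jet (fun y => η y + t * ξ y) x) P := by
    refine hK.eventually_forall_of_forall_eventually fun x hx => ?_
    refine (continuous_jet_add_mul hη hξ).continuousAt.eventually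
      ((isOpen_reg P).mem_nhds ?_)
    simpa [Reg] using hP x hx
  obtain ⟨ε, hε, h⟩ := Metric.eventually_nhds_iff.1 h
  refine ⟨ε, hε, fun t ht => h ?_⟩
  rw [Real.dist_eq, sub_zero]
  exact abs_lt.2 ht

/-- For fixed x the jet is affine in t, so the chain rule applies with the derivation that takes
constant values on the variables, namely the jet of ξ. -/
theorem hasDerivAt_value_add_mul {η ξ : ℝ → ℂ} (hη : ContDiff ℝ ∞ η) (hξ : ContDiff ℝ ∞ ξ)
    {P : EtaField} {t x : ℝ} (hP : Reg (jet (fun y => η y + t * ξ y) x) P) :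
    HasDerivAt (fun s : ℝ => value P (fun y => η y + s * ξ y) x)
      (linearization P (fun y => η y + t * ξ y) ξ x) t := by
  obtain ⟨N, hN⟩ := exists_order P
  set A := extDer fun n => algebraMap ℂ EtaField (jet ξ x n) with hA
  have hAv : ∀ n, A (var n) = algebraMap ℂ EtaField (jet ξ x n) := extDer_var _
  have h := hasDerivAt_ev (c := fun s : ℝ => jet (fun y => η y + s * ξ y) x) (s := t) (A := A)
    (fun n => by rw [hAv]; exact (reg_ev_const _ _).1) (fun n => by
      rw [hAv, (reg_ev_const _ _).2]
      simp only [jet_add_mul hη hξ]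
      have := ((Complex.ofRealCLM.hasDerivAt (x := t)).mul_const (jet ξ x n)).const_add (jet η x n)
      simpa using this) hP
  refine h.congr_deriv ?_
  rw [linearization_eq_sum fun i hi => partialD_eq_zero_of_order hN hi, hA, hN N le_rfl,
    (reg_ev_sum _ fun i _ => (reg_ev_mul (reg_ev_const _ _).1 (hP.partialD i)).1).2]
  refine Finset.sum_congr rfl fun i _ => ?_
  rw [(reg_ev_mul (reg_ev_const _ _).1 (hP.partialD i)).2, (reg_ev_const _ _).2, mul_comm]
  rfl

/-- Once more the commutator of ∂ with ∂/∂η⁽ⁱ⁺¹⁾: linearizing intertwines ∂ with d/dx. -/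
theorem hasDerivAt_linearization {V : Set ℝ} (hV : IsOpen V) {η ξ : ℝ → ℂ}
    (hη : ContDiffOn ℝ ∞ η V) (hξ : ContDiff ℝ ∞ ξ) {P : EtaField} (hP : RegularOn P η V) {x : ℝ}
    (hx : x ∈ V) : HasDerivAt (linearization P η ξ) (linearization (D P) η ξ x) x := by
  obtain ⟨M, hM⟩ := exists_partialD_eq_zero P
  have hM' : ∀ i, M + 1 ≤ i → partialD i (D P) = 0 := fun i hi => by
    obtain ⟨i, rfl⟩ : ∃ k, i = k + 1 := ⟨i - 1, by omega⟩
    rw [partialD_succ_D, hM _ (by omega), hM _ (by omega), map_zero, add_zero]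
  rw [show linearization P η ξ = _ from
    funext (linearization_eq_sum (M := M + 1) (fun i hi => hM i (by omega)) η ξ)]
  have hd : ∀ i, HasDerivAt (fun y => value (partialD i P) η y * iteratedDeriv i ξ y)
      (value (D (partialD i P)) η x * iteratedDeriv i ξ x +
        value (partialD i P) η x * iteratedDeriv (i + 1) ξ x) x := fun i => by
    refine (hasDerivAt_value hV hη (hP.partialD i) hx).mul ?_
    rw [iteratedDeriv_succ]
    exact hasDerivAt_of_contDiff (contDiff_iteratedDeriv hξ i) x
  refine (HasDerivAt.fun_sum fun i _ => hd i).congr_deriv ?_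
  have e : ∀ i, value (partialD (i + 1) (D P)) η x =
      value (D (partialD (i + 1) P)) η x + value (partialD i P) η x := fun i => by
    rw [partialD_succ_D, value_eq, value_eq, value_eq,
      (reg_ev_add (hP.partialD (i + 1) |>.D x hx) (hP.partialD i x hx)).2]
  rw [linearization_eq_sum hM', Finset.sum_add_distrib, Finset.sum_range_succ',
    Finset.sum_range_succ (fun i => value (partialD i P) η x * iteratedDeriv (i + 1) ξ x),
    Finset.sum_range_succ' (fun i => value (partialD i (D P)) η x * iteratedDeriv i ξ x)]
  simp only [e, partialD_zero_D, hM M le_rfl, value_zero, add_mul, Finset.sum_add_distrib]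
  ring

/-- The Leibniz rule for products of a test function. -/
theorem exists_iteratedDeriv_mul_eq_sum {V : Set ℝ} {f : ℝ → ℂ} (hf : IsTest V f) (n : ℕ) :
    ∃ c : ℕ → ℝ → ℂ, (∀ k, IsTest V (c k)) ∧ ∀ φ : ℕ → ℝ → ℂ,
      (∀ k, ∀ x ∈ V, HasDerivAt (φ k) (φ (k + 1) x) x) → ∀ x,
        iteratedDeriv n (fun y => f y * φ 0 y) x = ∑ k ∈ Finset.range (n + 1), c k x * φ k x := by
  induction n with
  | zero => exact ⟨fun _ => f, fun _ => hf, fun φ _ x => by simp⟩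
  | succ n ih =>
    obtain ⟨c, hc, h⟩ := ih
    -- The product rule sends cₖ to cₖ' + cₖ₋₁. The case distinctions set the missing neighbours at
    -- both ends to zero, as `c` carries no meaning beyond n. The coefficients depend on f and n
    -- alone, so one choice serves every φ.
    refine ⟨fun k x => (if k ≤ n then deriv (c k) x else 0) + (if k = 0 then 0 else c (k - 1) x),
      fun k => IsTest.add ?_ ?_, fun φ hφ x => ?_⟩
    · split_ifs
      exacts [(hc k).deriv, IsTest.zero V]
    · split_ifs
      exacts [IsTest.zero V, hc _]
    · have hd : ∀ k, HasDerivAt (fun y => c k y * φ k y)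
          (deriv (c k) x * φ k x + c k x * φ (k + 1) x) x := fun k => by
        by_cases hx : x ∈ V
        · exact ((hc k).hasDerivAt x).mul (hφ k x hx)
        · have h0 : (fun y => c k y * φ k y) =ᶠ[nhds x] fun _ => 0 := by
            filter_upwards [(hc k).eventuallyEq_zero hx] with y hy
            simp [hy]
          refine ((hasDerivAt_const x (0 : ℂ)).congr_of_eventuallyEq h0).congr_deriv ?_
          rw [(hc k).eq_zero hx, (hc k).deriv.eq_zero hx]
          ring
      rw [iteratedDeriv_succ, show iteratedDeriv n (fun y => f y * φ 0 y) = _ from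
        funext (h φ hφ), (HasDerivAt.fun_sum fun k _ => hd k).deriv]
      simp only [add_mul, Finset.sum_add_distrib]
      congr 1
      · rw [Finset.sum_range_succ _ (n + 1)]
        simp only [add_le_iff_nonpos_right, nonpos_iff_eq_zero, one_ne_zero, if_false, zero_mul,
          add_zero]
        refine Finset.sum_congr rfl fun k hk => ?_
        rw [if_pos (by simpa [Nat.lt_succ_iff] using hk)]
      · rw [Finset.sum_range_succ' _ (n + 1)]
        simp

/-! ### Differentiable families of functions -/

/-- `F'` is the derivative of the family `F` in the parameter `|t| < ε`, and both are jointly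
continuous. -/
structure IsC1Family {X : Type*} [TopologicalSpace X] (ε : ℝ) (F F' : ℝ → X → ℂ) : Prop where
  continuousOn : ContinuousOn (fun p : ℝ × X => F p.1 p.2) (Set.Ioo (-ε) ε ×ˢ Set.univ)
  continuousOn' : ContinuousOn (fun p : ℝ × X => F' p.1 p.2) (Set.Ioo (-ε) ε ×ˢ Set.univ)
  hasDerivAt : ∀ t ∈ Set.Ioo (-ε) ε, ∀ x, HasDerivAt (fun s => F s x) (F' t x) t

namespace IsC1Family

variable {X : Type*} [TopologicalSpace X] {ε : ℝ}

theorem congr {F F' G G' : ℝ → X → ℂ} (h : IsC1Family ε F F')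
    (e : ∀ t ∈ Set.Ioo (-ε) ε, ∀ x, G t x = F t x)
    (e' : ∀ t ∈ Set.Ioo (-ε) ε, ∀ x, G' t x = F' t x) : IsC1Family ε G G' where
  continuousOn := h.continuousOn.congr fun p hp => e p.1 hp.1 p.2
  continuousOn' := h.continuousOn'.congr fun p hp => e' p.1 hp.1 p.2
  hasDerivAt t ht x := ((h.hasDerivAt t ht x).congr_of_eventuallyEq
    (Filter.eventually_of_mem (isOpen_Ioo.mem_nhds ht) fun s hs => e s hs x)).congr_deriv
      (e' t ht x).symm

theorem add_mul {φ ψ : X → ℂ} (hφ : Continuous φ) (hψ : Continuous ψ) :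
    IsC1Family ε (fun t x => φ x + t * ψ x) (fun _ => ψ) where
  continuousOn := ((hφ.comp continuous_snd).add
    ((Complex.continuous_ofReal.comp continuous_fst).mul (hψ.comp continuous_snd))).continuousOn
  continuousOn' := (hψ.comp continuous_snd).continuousOn
  hasDerivAt t _ x := by
    simpa using ((Complex.ofRealCLM.hasDerivAt (x := t)).mul_const (ψ x)).const_add (φ x)

theorem add {F F' G G' : ℝ → X → ℂ} (h : IsC1Family ε F F') (k : IsC1Family ε G G') :
    IsC1Family ε (fun t x => F t x + G t x) (fun t x => F' t x + G' t x) where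
  continuousOn := h.continuousOn.add k.continuousOn
  continuousOn' := h.continuousOn'.add k.continuousOn'
  hasDerivAt t ht x := (h.hasDerivAt t ht x).add (k.hasDerivAt t ht x)

theorem mul {F F' G G' : ℝ → X → ℂ} (h : IsC1Family ε F F') (k : IsC1Family ε G G') :
    IsC1Family ε (fun t x => F t x * G t x) (fun t x => F' t x * G t x + F t x * G' t x) where
  continuousOn := h.continuousOn.mul k.continuousOn
  continuousOn' := (h.continuousOn'.mul k.continuousOn).add (h.continuousOn.mul k.continuousOn')
  hasDerivAt t ht x := (h.hasDerivAt t ht x).mul (k.hasDerivAt t ht x)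

theorem const_mul {F F' : ℝ → X → ℂ} (h : IsC1Family ε F F') (z : ℂ) :
    IsC1Family ε (fun t x => z * F t x) (fun t x => z * F' t x) where
  continuousOn := continuousOn_const.mul h.continuousOn
  continuousOn' := continuousOn_const.mul h.continuousOn'
  hasDerivAt t ht x := (h.hasDerivAt t ht x).const_mul z

theorem sum {ι : Type*} (s : Finset ι) {F F' : ι → ℝ → X → ℂ}
    (h : ∀ i ∈ s, IsC1Family ε (F i) (F' i)) :
    IsC1Family ε (fun t x => ∑ i ∈ s, F i t x) (fun t x => ∑ i ∈ s, F' i t x) where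
  continuousOn := continuousOn_finsetSum s fun i hi => (h i hi).continuousOn
  continuousOn' := continuousOn_finsetSum s fun i hi => (h i hi).continuousOn'
  hasDerivAt t ht x := HasDerivAt.fun_sum fun i hi => (h i hi).hasDerivAt t ht x

theorem comp {Y : Type*} [TopologicalSpace Y] {F F' : ℝ → X → ℂ} (h : IsC1Family ε F F')
    {φ : Y → X} (hφ : Continuous φ) :
    IsC1Family ε (fun t y => F t (φ y)) (fun t y => F' t (φ y)) where
  continuousOn := h.continuousOn.comp (f := fun p : ℝ × Y => (p.1, φ p.2))
    (continuous_fst.prodMk (hφ.comp continuous_snd)).continuousOn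
    fun _ hp => ⟨hp.1, Set.mem_univ _⟩
  continuousOn' := h.continuousOn'.comp (f := fun p : ℝ × Y => (p.1, φ p.2))
    (continuous_fst.prodMk (hφ.comp continuous_snd)).continuousOn
    fun _ hp => ⟨hp.1, Set.mem_univ _⟩
  hasDerivAt t ht y := h.hasDerivAt t ht (φ y)

theorem continuous {F F' : ℝ → X → ℂ} (h : IsC1Family ε F F') {t : ℝ}
    (ht : t ∈ Set.Ioo (-ε) ε) : Continuous (F t) :=
  h.continuousOn.comp_continuous (f := fun x => (t, x)) (by fun_prop)
    fun _ => ⟨ht, Set.mem_univ _⟩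

theorem continuous' {F F' : ℝ → X → ℂ} (h : IsC1Family ε F F') {t : ℝ}
    (ht : t ∈ Set.Ioo (-ε) ε) : Continuous (F' t) :=
  h.continuousOn'.comp_continuous (f := fun x => (t, x)) (by fun_prop)
    fun _ => ⟨ht, Set.mem_univ _⟩

theorem deriv_eq_zero {F F' : ℝ → X → ℂ} (h : IsC1Family ε F F') {x : X}
    (h0 : ∀ t ∈ Set.Ioo (-ε) ε, F t x = 0) {t : ℝ} (ht : t ∈ Set.Ioo (-ε) ε) : F' t x = 0 :=
  (h.hasDerivAt t ht x).unique ((hasDerivAt_const t (0 : ℂ)).congr_of_eventuallyEq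
    (Filter.eventually_of_mem (isOpen_Ioo.mem_nhds ht) fun s hs => h0 s hs))

/-- Differentiation under the integral sign, for a compactly supported family with a bounded
measurable weight. -/
theorem hasDerivAt_integral [T2Space X] [SecondCountableTopology X] [MeasurableSpace X]
    [BorelSpace X] {μ : MeasureTheory.Measure X} [MeasureTheory.IsFiniteMeasureOnCompacts μ]
    {F F' : ℝ → X → ℂ} (h : IsC1Family ε F F') (hε : 0 < ε) {K : Set X} (hK : IsCompact K)
    (h0 : ∀ t ∈ Set.Ioo (-ε) ε, ∀ x ∉ K, F t x = 0) {σ : X → ℂ} (hσ : Measurable σ)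
    (hσ1 : ∀ x, ‖σ x‖ ≤ 1) :
    MeasureTheory.Integrable (fun x => σ x * F' 0 x) μ ∧
      HasDerivAt (fun t => ∫ x, σ x * F t x ∂μ) (∫ x, σ x * F' 0 x ∂μ) 0 := by
  -- On a closed interval times K the parameter derivative is bounded, which provides the dominating
  -- function.
  have hsub : Set.Icc (-(ε / 2)) (ε / 2) ⊆ Set.Ioo (-ε) ε := fun t ht =>
    ⟨by linarith [ht.1], by linarith [ht.2]⟩
  obtain ⟨C, hC⟩ := (isCompact_Icc.prod hK).exists_bound_of_continuousOn
    (h.continuousOn'.mono (Set.prod_mono hsub (Set.subset_univ K)))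
  have h00 : (0 : ℝ) ∈ Set.Ioo (-ε) ε := ⟨by linarith, hε⟩
  have hcs : HasCompactSupport (F 0) := HasCompactSupport.intro hK (h0 0 h00)
  refine hasDerivAt_integral_of_dominated_loc_of_deriv_le (bound := K.indicator fun _ => C)
    (s := Set.Icc (-(ε / 2)) (ε / 2)) (F := fun t x => σ x * F t x)
    (F' := fun t x => σ x * F' t x)
    (Icc_mem_nhds (by linarith) (by linarith)) ?_ ?_ ?_ ?_ ?_ ?_
  · filter_upwards [isOpen_Ioo.mem_nhds h00] with t ht
    exact hσ.aestronglyMeasurable.mul (h.continuous ht).aestronglyMeasurable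
  · exact ((h.continuous h00).integrable_of_hasCompactSupport hcs).bdd_mul
      hσ.aestronglyMeasurable (Filter.Eventually.of_forall hσ1)
  · exact hσ.aestronglyMeasurable.mul (h.continuous' h00).aestronglyMeasurable
  · refine Filter.Eventually.of_forall fun x t ht => ?_
    by_cases hx : x ∈ K
    · rw [Set.indicator_of_mem hx, norm_mul]
      have h1 := hC (t, x) ⟨ht, hx⟩
      nlinarith [hσ1 x, norm_nonneg (σ x), norm_nonneg (F' t x)]
    · rw [Set.indicator_of_notMem hx, h.deriv_eq_zero (fun s hs => h0 s hs x hx) (hsub ht)]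
      simp
  · exact (MeasureTheory.integrable_indicator_iff hK.measurableSet).2
      (MeasureTheory.integrableOn_const hK.measure_lt_top.ne)
  · exact Filter.Eventually.of_forall fun x t ht => (h.hasDerivAt t (hsub ht) x).const_mul _

end IsC1Family

/-- The derivative of the kernel of the basic bracket along `ξ`. -/
def kernelVar (η ξ : ℝ → ℂ) (x y : ℝ) : ℂ :=
  2 * η x * ξ x - 2 * η y * ξ y - (Real.sign (x - y) : ℝ) * (2 * (η x - η y) * (ξ x - ξ y))

/-- The derivative of the variational derivative along `ξ`. -/
def gradVar (P : EtaField) (η ξ f : ℝ → ℂ) (x : ℝ) : ℂ :=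
  ∑ᶠ i : ℕ, (-1) ^ i * iteratedDeriv i (fun y => f y * linearization (partialD i P) η ξ y) x

theorem linearization_zero (η ξ : ℝ → ℂ) (x : ℝ) : linearization 0 η ξ x = 0 := by
  rw [linearization_eq_sum (M := 0) fun i _ => map_zero _, Finset.sum_range_zero]

theorem gradVar_eq_sum {P : EtaField} {M : ℕ} (hM : ∀ i, M ≤ i → partialD i P = 0)
    (η ξ f : ℝ → ℂ) (x : ℝ) : gradVar P η ξ f x = ∑ i ∈ Finset.range M,
      (-1) ^ i * iteratedDeriv i (fun y => f y * linearization (partialD i P) η ξ y) x := by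
  refine finsum_eq_sum_of_support_subset _ fun i hi => ?_
  rw [Finset.mem_coe, Finset.mem_range]
  by_contra h
  exact hi (by simp [hM i (not_lt.1 h), linearization_zero])

theorem contDiffOn_linearization {V : Set ℝ} (hV : IsOpen V) {η ξ : ℝ → ℂ}
    (hη : ContDiffOn ℝ ∞ η V) (hξ : ContDiff ℝ ∞ ξ) {P : EtaField} (hP : RegularOn P η V) :
    ContDiffOn ℝ ∞ (linearization P η ξ) V := by
  obtain ⟨M, hM⟩ := exists_partialD_eq_zero P
  rw [show linearization P η ξ = _ from funext (linearization_eq_sum hM η ξ)]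
  exact ContDiffOn.sum fun i _ => (contDiffOn_value hV hη (hP.partialD i)).mul
    (contDiff_iteratedDeriv hξ i).contDiffOn

theorem isTest_gradVar {V : Set ℝ} (hV : IsOpen V) {η ξ f : ℝ → ℂ} (hη : ContDiffOn ℝ ∞ η V)
    (hξ : ContDiff ℝ ∞ ξ) (hf : IsTest V f) {P : EtaField} (hP : RegularOn P η V) :
    IsTest V (gradVar P η ξ f) := by
  obtain ⟨M, hM⟩ := exists_partialD_eq_zero P
  rw [show gradVar P η ξ f = _ from funext (gradVar_eq_sum hM η ξ f)]
  exact IsTest.sum _ fun i _ => ((hf.mul_contDiffOn hV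
    (contDiffOn_linearization hV hη hξ (hP.partialD i))).iteratedDeriv i).const_mul _

theorem regularOn_D_iterate {P : EtaField} {η : ℝ → ℂ} {V : Set ℝ} (h : RegularOn P η V) (n : ℕ) :
    RegularOn (D^[n] P) η V :=
  regularOn_iff.2 fun x hx => reg_D_iterate (regularOn_iff.1 h x hx) n

theorem continuousOn_value_add_mul {V : Set ℝ} {η ξ : ℝ → ℂ}
    (hη : ContDiff ℝ ∞ η) (hξ : ContDiff ℝ ∞ ξ) {P : EtaField} {ε : ℝ}
    (hP : ∀ t ∈ Set.Ioo (-ε) ε, RegularOn P (fun y => η y + (t : ℝ) * ξ y) V) :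
    ContinuousOn (fun p : ℝ × ℝ => value P (fun y => η y + p.1 * ξ y) p.2)
      (Set.Ioo (-ε) ε ×ˢ V) := fun p hp =>
  (continuousAt_ev (continuous_jet_add_mul hη hξ).continuousAt
    (hP p.1 hp.1 p.2 hp.2)).continuousWithinAt

theorem isC1Family_mul_value {V : Set ℝ} (hV : IsOpen V) {η ξ : ℝ → ℂ}
    (hη : ContDiff ℝ ∞ η) (hξ : ContDiff ℝ ∞ ξ) {P : EtaField} {ε : ℝ}
    (hP : ∀ t ∈ Set.Ioo (-ε) ε, RegularOn P (fun y => η y + (t : ℝ) * ξ y) V) {c : ℝ → ℂ}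
    (hc : IsTest V c) : IsC1Family ε (fun t x => c x * value P (fun y => η y + t * ξ y) x)
      (fun t x => c x * linearization P (fun y => η y + t * ξ y) ξ x) := by
  have key : ∀ Φ : ℝ × ℝ → ℂ, ContinuousOn Φ (Set.Ioo (-ε) ε ×ˢ V) →
      ContinuousOn (fun p : ℝ × ℝ => c p.2 * Φ p) (Set.Ioo (-ε) ε ×ˢ Set.univ) := by
    intro Φ hΦ p hp
    by_cases hx : p.2 ∈ V
    · exact ((hc.1.continuous.comp continuous_snd).continuousAt.mul (hΦ.continuousAt
        ((isOpen_Ioo.prod hV).mem_nhds ⟨hp.1, hx⟩))).continuousWithinAt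
    · have h0 : (fun p : ℝ × ℝ => c p.2 * Φ p) =ᶠ[nhds p] fun _ => 0 := by
        filter_upwards [continuous_snd.continuousAt.eventually (hc.eventuallyEq_zero hx)] with q hq
        simp [hq]
      exact (continuousAt_const.congr h0.symm).continuousWithinAt
  obtain ⟨M, hM⟩ := exists_partialD_eq_zero P
  refine ⟨key _ (continuousOn_value_add_mul hη hξ hP), key _ ?_, fun t ht x => ?_⟩
  · simp only [linearization_eq_sum hM]
    exact continuousOn_finsetSum _ fun i _ =>
      (continuousOn_value_add_mul hη hξ fun t ht => (hP t ht).partialD i).mul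
        ((contDiff_iteratedDeriv hξ i).continuous.comp continuous_snd).continuousOn
  · by_cases hx : x ∈ V
    · exact (hasDerivAt_value_add_mul hη hξ (hP t ht x hx)).const_mul _
    · simp only [hc.eq_zero hx, zero_mul]
      exact hasDerivAt_const _ _

/-- The Leibniz expansion has the same coefficients for values and for linearizations of
∂ᵏ(∂P/∂η⁽ⁱ⁾). So d/dt is applied term by term to values, and is never interchanged with iterated
derivatives in x. -/
theorem isC1Family_grad {V : Set ℝ} (hV : IsOpen V) {η ξ : ℝ → ℂ}
    (hη : ContDiff ℝ ∞ η) (hξ : ContDiff ℝ ∞ ξ) {P : EtaField} {ε : ℝ}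
    (hP : ∀ t ∈ Set.Ioo (-ε) ε, RegularOn P (fun y => η y + (t : ℝ) * ξ y) V) {f : ℝ → ℂ}
    (hf : IsTest V f) : IsC1Family ε (fun t x => grad P (fun y => η y + t * ξ y) f x)
      (fun t x => gradVar P (fun y => η y + t * ξ y) ξ f x) := by
  obtain ⟨M, hM⟩ := exists_partialD_eq_zero P
  choose c hc h using exists_iteratedDeriv_mul_eq_sum hf
  refine (IsC1Family.sum (Finset.range M) fun i _ => (IsC1Family.sum (Finset.range (i + 1))
    fun k _ => isC1Family_mul_value hV hη hξ
      (fun t ht => regularOn_D_iterate ((hP t ht).partialD i) k) (hc i k)).const_mul ((-1) ^ i)).congr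
    (fun t ht x => ?_) (fun t ht x => ?_)
  · rw [grad_eq_sum hM]
    refine Finset.sum_congr rfl fun i _ => ?_
    rw [← h i (fun k => value (D^[k] (partialD i P)) fun y => η y + t * ξ y)]
    · rfl
    · intro k y hy
      rw [Function.iterate_succ_apply']
      exact hasDerivAt_value hV (contDiff_add_mul hη hξ t).contDiffOn
        (regularOn_D_iterate ((hP t ht).partialD i) k) hy
  · rw [gradVar_eq_sum hM]
    refine Finset.sum_congr rfl fun i _ => ?_
    rw [← h i (fun k => linearization (D^[k] (partialD i P)) (fun y => η y + t * ξ y) ξ)]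
    · rfl
    · intro k y hy
      rw [Function.iterate_succ_apply']
      exact hasDerivAt_linearization hV (contDiff_add_mul hη hξ t).contDiffOn hξ
        (regularOn_D_iterate ((hP t ht).partialD i) k) hy

theorem bracket_eq_integral_prod {V : Set ℝ} (hV : IsOpen V) {η : ℝ → ℂ} (hη : ContDiff ℝ ∞ η)
    {P Q : EtaField} (hP : RegularOn P η V) (hQ : RegularOn Q η V) {f g : ℝ → ℂ} (hf : IsTest V f)
    (hg : IsTest V g) : bracket P Q η f g =
      ∫ p : ℝ × ℝ, grad P η f p.1 * grad Q η g p.2 * etaKernel η p.1 p.2 :=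
  (MeasureTheory.integral_prod _ (integrable_mul_etaKernel hη.continuous
    (isTest_grad hV hη.contDiffOn hf hP) (isTest_grad hV hη.contDiffOn hg hQ))).symm

theorem grad_eq_zero_of_notMem_tsupport (P : EtaField) (η f : ℝ → ℂ) {x : ℝ}
    (hf : ContDiff ℝ ∞ f) (hc : HasCompactSupport f) (hx : x ∉ tsupport f) : grad P η f x = 0 :=
  grad_eq_zero (V := tsupport f) ⟨hf, hc, le_rfl⟩ P η hx

theorem measurable_one_complex {X : Type*} [MeasurableSpace X] :
    Measurable fun _ : X => (1 : ℂ) := measurable_const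

/-- The derivative of the bracket along a variation of the curve. -/
theorem hasDerivAt_bracket {V : Set ℝ} (hV : IsOpen V) {η ξ : ℝ → ℂ} (hη : ContDiff ℝ ∞ η)
    (hξ : ContDiff ℝ ∞ ξ) {P Q : EtaField} {ε : ℝ} (hε : 0 < ε)
    (hP : ∀ t ∈ Set.Ioo (-ε) ε, RegularOn P (fun y => η y + (t : ℝ) * ξ y) V)
    (hQ : ∀ t ∈ Set.Ioo (-ε) ε, RegularOn Q (fun y => η y + (t : ℝ) * ξ y) V)
    {f g : ℝ → ℂ} (hf : IsTest V f) (hg : IsTest V g) :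
    HasDerivAt (fun t : ℝ => bracket P Q (fun x => η x + t * ξ x) f g)
      (∫ p : ℝ × ℝ, ((gradVar P η ξ f p.1 * grad Q η g p.2 + grad P η f p.1 * gradVar Q η ξ g p.2) *
        etaKernel η p.1 p.2 + grad P η f p.1 * grad Q η g p.2 * kernelVar η ξ p.1 p.2)) 0 := by
  have hGH := ((isC1Family_grad hV hη hξ hP hf).comp (Y := ℝ × ℝ) continuous_fst).mul
    ((isC1Family_grad hV hη hξ hQ hg).comp (Y := ℝ × ℝ) continuous_snd)
  have hx := IsC1Family.add_mul (ε := ε) (hη.continuous.comp (continuous_fst (Y := ℝ)))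
    (hξ.continuous.comp (continuous_fst (Y := ℝ)))
  have hy := IsC1Family.add_mul (ε := ε) (hη.continuous.comp (continuous_snd (X := ℝ)))
    (hξ.continuous.comp (continuous_snd (X := ℝ)))
  have hd := hx.add (hy.const_mul (-1))
  -- The integrand is split into a part without sign and a part multiplied by sign. Each is a
  -- continuous family times a fixed bounded weight.
  have hA := hGH.mul ((hx.mul hx).add ((hy.mul hy).const_mul (-1)))
  have hB := hGH.mul ((hd.mul hd).const_mul (-1))
  have hsupp : ∀ (t : ℝ) (p : ℝ × ℝ), p ∉ tsupport f ×ˢ tsupport g →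
      grad P (fun x => η x + t * ξ x) f p.1 * grad Q (fun x => η x + t * ξ x) g p.2 = 0 := by
    intro t p hp
    by_cases h1 : p.1 ∈ tsupport f
    · rw [grad_eq_zero_of_notMem_tsupport Q _ g hg.1 hg.2.1 fun h2 => hp ⟨h1, h2⟩, mul_zero]
    · rw [grad_eq_zero_of_notMem_tsupport P _ f hf.1 hf.2.1 h1, zero_mul]
  have hK := hf.2.1.isCompact.prod hg.2.1.isCompact
  obtain ⟨iA, dA⟩ := hA.hasDerivAt_integral (μ := MeasureTheory.volume) hε hK
    (fun t _ p hp => by rw [hsupp t p hp, zero_mul]) measurable_one_complex (by simp)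
  obtain ⟨iB, dB⟩ := hB.hasDerivAt_integral (μ := MeasureTheory.volume) hε hK
    (fun t _ p hp => by rw [hsupp t p hp, zero_mul]) measurable_sign_fst_sub_snd
    (fun p => norm_sign_le _)
  refine ((dA.fun_add dB).congr_of_eventuallyEq ?_).congr_deriv ?_
  · filter_upwards [isOpen_Ioo.mem_nhds (show (0 : ℝ) ∈ Set.Ioo (-ε) ε from ⟨by linarith, hε⟩)]
      with t ht
    have hηt := contDiff_add_mul hη hξ t
    have hG := isTest_grad hV hηt.contDiffOn hf (hP t ht)
    have hH := isTest_grad hV hηt.contDiffOn hg (hQ t ht)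
    have hc := continuous_hasCompactSupport_prod hG hH
    have cGH : Continuous fun p : ℝ × ℝ => grad P (fun x => η x + t * ξ x) f p.1 *
        grad Q (fun x => η x + t * ξ x) g p.2 :=
      (hG.1.continuous.comp continuous_fst).mul (hH.1.continuous.comp continuous_snd)
    rw [bracket_eq_integral_prod hV hηt (hP t ht) (hQ t ht) hf hg, ← MeasureTheory.integral_add]
    · refine integral_congr_fun fun p => ?_
      simp only [etaKernel, Function.comp]
      ring
    · simp only [one_mul]
      exact (hA.continuous ht).integrable_of_hasCompactSupport hc.mul_right
    · exact ((hB.continuous ht).integrable_of_hasCompactSupport hc.mul_right).bdd_mul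
        measurable_sign_fst_sub_snd.aestronglyMeasurable
        (Filter.Eventually.of_forall fun _ => norm_sign_le _)
  · rw [← MeasureTheory.integral_add iA iB]
    refine integral_congr_fun fun p => ?_
    simp only [etaKernel, kernelVar, Function.comp, Complex.ofReal_zero, zero_mul, add_zero]
    ring

/-- The second variation of the local functional `∫ f P dx`. -/
theorem integral_gradVar_mul {V : Set ℝ} (hV : IsOpen V) {η : ℝ → ℂ} (hη : ContDiffOn ℝ ∞ η V)
    {P : EtaField} (hP : RegularOn P η V) {f : ℝ → ℂ} (hf : IsTest V f) {ξ φ : ℝ → ℂ}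
    (hξ : ContDiff ℝ ∞ ξ) (hφ : ContDiff ℝ ∞ φ) {M : ℕ}
    (hM : ∀ i j, M ≤ i ∨ M ≤ j → partialD i (partialD j P) = 0)
    (hM' : ∀ i, M ≤ i → partialD i P = 0) :
    ∫ x, gradVar P η ξ f x * φ x =
      ∑ i ∈ Finset.range M, ∑ j ∈ Finset.range M,
        ∫ x, f x * value (partialD j (partialD i P)) η x *
          (iteratedDeriv i φ x * iteratedDeriv j ξ x) := by
  simp only [gradVar_eq_sum hM', Finset.sum_mul]
  have ht : ∀ i, IsTest V fun y => f y * linearization (partialD i P) η ξ y := fun i =>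
    hf.mul_contDiffOn hV (contDiffOn_linearization hV hη hξ (hP.partialD i))
  rw [MeasureTheory.integral_finsetSum]
  · refine Finset.sum_congr rfl fun i _ => ?_
    have h := integral_iteratedDeriv_mul (ht i) hφ i
    simp only [mul_assoc] at h ⊢
    rw [MeasureTheory.integral_const_mul, h, ← mul_assoc, ← mul_pow,
      ← MeasureTheory.integral_finsetSum]
    · rw [neg_one_mul, neg_neg, one_pow, one_mul]
      refine integral_congr_fun fun x => ?_
      rw [linearization_eq_sum fun j hj => hM j i (Or.inl hj), Finset.sum_mul, Finset.mul_sum]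
      exact Finset.sum_congr rfl fun j _ => by ring
    · intro j _
      have := ((hf.mul_value hV hη ((hP.partialD i).partialD j)).contDiff_mul
        (contDiff_iteratedDeriv hφ i)).contDiff_mul (contDiff_iteratedDeriv hξ j)
      exact this.integrable.congr (Filter.Eventually.of_forall fun y => by simp only; ring)
  · intro i _
    have := (((ht i).iteratedDeriv i).const_mul ((-1) ^ i)).contDiff_mul hφ
    exact this.integrable.congr (Filter.Eventually.of_forall fun y => by simp only; ring)

/-- The second variation is a symmetric form because ∂/∂η⁽ⁱ⁾ and ∂/∂η⁽ʲ⁾ commute. -/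
theorem integral_gradVar_mul_comm {V : Set ℝ} (hV : IsOpen V) {η : ℝ → ℂ}
    (hη : ContDiffOn ℝ ∞ η V) {P : EtaField} (hP : RegularOn P η V) {f : ℝ → ℂ} (hf : IsTest V f)
    {ξ φ : ℝ → ℂ} (hξ : ContDiff ℝ ∞ ξ) (hφ : ContDiff ℝ ∞ φ) :
    ∫ x, gradVar P η ξ f x * φ x = ∫ x, gradVar P η φ f x * ξ x := by
  obtain ⟨M, hM⟩ := exists_partialD_eq_zero P
  have hM' : ∀ i j, M ≤ i ∨ M ≤ j → partialD i (partialD j P) = 0 := by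
    rintro i j (h | h)
    · rw [partialD_comm, hM i h, map_zero]
    · rw [hM j h, map_zero]
  rw [integral_gradVar_mul hV hη hP hf hξ hφ hM' hM, integral_gradVar_mul hV hη hP hf hφ hξ hM' hM,
    Finset.sum_comm]
  refine Finset.sum_congr rfl fun i _ => Finset.sum_congr rfl fun j _ => ?_
  refine integral_congr_fun fun x => ?_
  rw [partialD_comm]
  ring

/-! ### The Jacobi identity for the kernel of the basic bracket -/

/-- The derivative of the kernel at `(x, y)` along the Hamiltonian vector field of `η(z)`. -/
def jacobiKernel (η : ℝ → ℂ) (x y z : ℝ) : ℂ :=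
  (2 * η x - 2 * (Real.sign (x - y) : ℝ) * (η x - η y)) * etaKernel η x z -
    (2 * η y - 2 * (Real.sign (x - y) : ℝ) * (η x - η y)) * etaKernel η y z

/-- The differences add up to zero, so for distinct points exactly two of the signs agree. If just
two points coincide, the other two signs are opposite. Only the triple diagonal is exceptional. -/
theorem sign_cocycle (x y z : ℝ) : (x = y ∧ y = z) ∨
    Real.sign (x - y) * Real.sign (y - z) + Real.sign (y - z) * Real.sign (z - x) +
      Real.sign (z - x) * Real.sign (x - y) = -1 := by
  rcases lt_trichotomy (x - y) 0 with h1 | h1 | h1 <;>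
  rcases lt_trichotomy (y - z) 0 with h2 | h2 | h2 <;>
  rcases lt_trichotomy (z - x) 0 with h3 | h3 | h3 <;>
  first
  | (exfalso; linarith)
  | (left; constructor <;> linarith)
  | (right; simp only [Real.sign_of_neg, Real.sign_of_pos, h1, h2, h3, Real.sign_zero]; norm_num)

/-- The cyclic sum is 2(η(x) − η(y))(η(y) − η(z))(η(z) − η(x)) times one plus the sum of products in
`sign_cocycle`. On the triple diagonal each kernel is zero. -/
theorem jacobiKernel_cyclic (η : ℝ → ℂ) (x y z : ℝ) :
    jacobiKernel η x y z + jacobiKernel η y z x + jacobiKernel η z x y = 0 := by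
  rcases sign_cocycle x y z with ⟨rfl, rfl⟩ | h
  · simp [jacobiKernel, etaKernel]
  · have h' : ((Real.sign (x - y) : ℝ) : ℂ) * (Real.sign (y - z) : ℝ) +
        (Real.sign (y - z) : ℝ) * (Real.sign (z - x) : ℝ) +
        (Real.sign (z - x) : ℝ) * (Real.sign (x - y) : ℝ) = -1 := by exact_mod_cast h
    have e1 : ((Real.sign (x - z) : ℝ) : ℂ) = -(Real.sign (z - x) : ℝ) := by
      rw [← neg_sub z x, Real.sign_neg]; push_cast; rfl
    have e2 : ((Real.sign (y - x) : ℝ) : ℂ) = -(Real.sign (x - y) : ℝ) := by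
      rw [← neg_sub x y, Real.sign_neg]; push_cast; rfl
    have e3 : ((Real.sign (z - y) : ℝ) : ℂ) = -(Real.sign (y - z) : ℝ) := by
      rw [← neg_sub y z, Real.sign_neg]; push_cast; rfl
    simp only [jacobiKernel, etaKernel, e1, e2, e3]
    generalize ((Real.sign (x - y) : ℝ) : ℂ) = r at *
    generalize ((Real.sign (y - z) : ℝ) : ℂ) = s at *
    generalize ((Real.sign (z - x) : ℝ) : ℂ) = t at *
    linear_combination (2 * (η x - η y) * (η y - η z) * (η z - η x)) * h'

theorem integrable_mul_jacobiKernel {V : Set ℝ} {η a b c : ℝ → ℂ} (hη : Continuous η)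
    (ha : IsTest V a) (hb : IsTest V b) (hc : IsTest V c) :
    MeasureTheory.Integrable fun p : (ℝ × ℝ) × ℝ =>
      a p.1.1 * b p.1.2 * c p.2 * jacobiKernel η p.1.1 p.1.2 p.2 := by
  have hx : Continuous fun p : (ℝ × ℝ) × ℝ => η p.1.1 := by fun_prop
  have hy : Continuous fun p : (ℝ × ℝ) × ℝ => η p.1.2 := by fun_prop
  have hz : Continuous fun p : (ℝ × ℝ) × ℝ => η p.2 := by fun_prop
  have ca := ha.1.continuous
  have cb := hb.1.continuous
  have cc := hc.1.continuous
  have habc : Continuous fun p : (ℝ × ℝ) × ℝ => a p.1.1 * b p.1.2 * c p.2 := by fun_prop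
  have hs : HasCompactSupport fun p : (ℝ × ℝ) × ℝ => a p.1.1 * b p.1.2 * c p.2 := by
    refine HasCompactSupport.intro ((ha.2.1.isCompact.prod hb.2.1.isCompact).prod
      hc.2.1.isCompact) fun p hp => ?_
    by_contra h
    exact hp ⟨⟨subset_tsupport _ (left_ne_zero_of_mul (left_ne_zero_of_mul h)),
      subset_tsupport _ (right_ne_zero_of_mul (left_ne_zero_of_mul h))⟩,
      subset_tsupport _ (right_ne_zero_of_mul h)⟩
  have key : ∀ φ : (ℝ × ℝ) × ℝ → ℂ, Continuous φ →
      MeasureTheory.Integrable fun p : (ℝ × ℝ) × ℝ => a p.1.1 * b p.1.2 * c p.2 * φ p :=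
    fun φ hφ => (habc.mul hφ).integrable_of_hasCompactSupport hs.mul_right
  have sgn : ∀ (u : (ℝ × ℝ) × ℝ → ℝ × ℝ), Measurable u → ∀ F : (ℝ × ℝ) × ℝ → ℂ,
      MeasureTheory.Integrable F → MeasureTheory.Integrable fun p =>
        ((Real.sign ((u p).1 - (u p).2) : ℝ) : ℂ) * F p := fun u hu F hF =>
    hF.bdd_mul (measurable_sign_fst_sub_snd.comp hu).aestronglyMeasurable
      (Filter.Eventually.of_forall fun _ => norm_sign_le _)
  have sxy := sgn (fun p => (p.1.1, p.1.2)) (by fun_prop)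
  have sxz := sgn (fun p => (p.1.1, p.2)) (by fun_prop)
  have syz := sgn (fun p => (p.1.2, p.2)) (by fun_prop)
  have i1 := key (fun p => 2 * η p.1.1 * (η p.1.1 ^ 2 - η p.2 ^ 2) -
    2 * η p.1.2 * (η p.1.2 ^ 2 - η p.2 ^ 2)) (by fun_prop)
  have i2 := sxz _ (key (fun p => 2 * η p.1.1 * (η p.1.1 - η p.2) ^ 2) (by fun_prop))
  have i3 := syz _ (key (fun p => 2 * η p.1.2 * (η p.1.2 - η p.2) ^ 2) (by fun_prop))
  have i4 := sxy _ (key (fun p => 2 * (η p.1.1 - η p.1.2) * (η p.1.1 ^ 2 - η p.1.2 ^ 2))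
    (by fun_prop))
  have i5 := sxy _ (sxz _ (key (fun p => 2 * (η p.1.1 - η p.1.2) * (η p.1.1 - η p.2) ^ 2)
    (by fun_prop)))
  have i6 := sxy _ (syz _ (key (fun p => 2 * (η p.1.1 - η p.1.2) * (η p.1.2 - η p.2) ^ 2)
    (by fun_prop)))
  refine (((((i1.sub i2).add i3).sub i4).add i5).sub i6).congr
    (Filter.Eventually.of_forall fun p => ?_)
  simp only [jacobiKernel, etaKernel, Pi.sub_apply, Pi.add_apply]
  ring

/-- Invariance of the integral under `((x, y), z) ↦ ((y, z), x)`. -/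
theorem integral_cyclic {F : (ℝ × ℝ) × ℝ → ℂ} (hF : MeasureTheory.Integrable F) :
    MeasureTheory.Integrable (fun p : (ℝ × ℝ) × ℝ => F ((p.1.2, p.2), p.1.1)) ∧
      ∫ p : (ℝ × ℝ) × ℝ, F ((p.1.2, p.2), p.1.1) = ∫ p, F p := by
  have h1 := MeasureTheory.measurePreserving_prodAssoc
    (MeasureTheory.volume : MeasureTheory.Measure ℝ)
    (MeasureTheory.volume : MeasureTheory.Measure ℝ) (MeasureTheory.volume : MeasureTheory.Measure ℝ)
  have h2 := MeasureTheory.Measure.measurePreserving_swap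
    (μ := (MeasureTheory.volume : MeasureTheory.Measure ℝ))
    (ν := (MeasureTheory.volume : MeasureTheory.Measure (ℝ × ℝ)))
  have he := (MeasurableEquiv.prodComm (α := ℝ) (β := ℝ × ℝ)).measurableEmbedding.comp
    (MeasurableEquiv.prodAssoc (α := ℝ) (β := ℝ) (γ := ℝ)).measurableEmbedding
  exact ⟨((h2.comp h1).integrable_comp_emb he).2 hF, (h2.comp h1).integral_comp he F⟩

theorem kernelVar_kernelInt {V : Set ℝ} {η c : ℝ → ℂ} (hη : Continuous η) (hc : IsTest V c)
    (x y : ℝ) : kernelVar η (kernelInt η c) x y = ∫ z, c z * jacobiKernel η x y z := by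
  have i : ∀ x, MeasureTheory.Integrable fun z => etaKernel η x z * c z := fun x => by
    have cc := hc.1.continuous
    have i1 : MeasureTheory.Integrable fun z => (η x ^ 2 - η z ^ 2) * c z :=
      (by fun_prop : Continuous fun z => (η x ^ 2 - η z ^ 2) * c z).integrable_of_hasCompactSupport
        hc.2.1.mul_left
    have i2 : MeasureTheory.Integrable fun z => (η x - η z) ^ 2 * c z :=
      (by fun_prop : Continuous fun z => (η x - η z) ^ 2 * c z).integrable_of_hasCompactSupport
        hc.2.1.mul_left
    have i3 := i2.bdd_mul (measurable_sign_sub x).aestronglyMeasurable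
      (Filter.Eventually.of_forall fun _ => norm_sign_le _)
    refine (i1.sub i3).congr (Filter.Eventually.of_forall fun z => ?_)
    simp only [etaKernel, Pi.sub_apply]
    ring
  have e : ∀ z, c z * jacobiKernel η x y z =
      (2 * η x - 2 * (Real.sign (x - y) : ℝ) * (η x - η y)) * (etaKernel η x z * c z) -
        (2 * η y - 2 * (Real.sign (x - y) : ℝ) * (η x - η y)) * (etaKernel η y z * c z) :=
    fun z => by rw [jacobiKernel]; ring
  rw [integral_congr_fun e, MeasureTheory.integral_sub ((i x).const_mul _) ((i y).const_mul _),
    MeasureTheory.integral_const_mul, MeasureTheory.integral_const_mul, kernelVar, kernelInt,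
    kernelInt]
  ring

theorem integral_kernelVar_eq {V : Set ℝ} {η a b c : ℝ → ℂ} (hη : Continuous η)
    (ha : IsTest V a) (hb : IsTest V b) (hc : IsTest V c) :
    ∫ p : ℝ × ℝ, a p.1 * b p.2 * kernelVar η (kernelInt η c) p.1 p.2 =
      ∫ p : (ℝ × ℝ) × ℝ, a p.1.1 * b p.1.2 * c p.2 * jacobiKernel η p.1.1 p.1.2 p.2 := by
  rw [MeasureTheory.Measure.volume_eq_prod (ℝ × ℝ) ℝ,
    MeasureTheory.integral_prod _ (integrable_mul_jacobiKernel hη ha hb hc)]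
  refine integral_congr_fun fun p => ?_
  rw [kernelVar_kernelInt hη hc, ← MeasureTheory.integral_const_mul]
  exact integral_congr_fun fun z => by ring

theorem integral_kernelVar_cyclic {V : Set ℝ} {η a b c : ℝ → ℂ} (hη : Continuous η)
    (ha : IsTest V a) (hb : IsTest V b) (hc : IsTest V c) :
    (∫ p : ℝ × ℝ, a p.1 * b p.2 * kernelVar η (kernelInt η c) p.1 p.2) +
      (∫ p : ℝ × ℝ, b p.1 * c p.2 * kernelVar η (kernelInt η a) p.1 p.2) +
      (∫ p : ℝ × ℝ, c p.1 * a p.2 * kernelVar η (kernelInt η b) p.1 p.2) = 0 := by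
  have i1 := integrable_mul_jacobiKernel hη ha hb hc
  have i2 := integrable_mul_jacobiKernel hη hb hc ha
  have i3 := integrable_mul_jacobiKernel hη hc ha hb
  rw [integral_kernelVar_eq hη ha hb hc, integral_kernelVar_eq hη hb hc ha,
    integral_kernelVar_eq hη hc ha hb]
  -- One rotation of the variables brings the second integrand to the arguments of the first; the
  -- third needs two.
  obtain ⟨k2, e2⟩ := integral_cyclic i2
  obtain ⟨k3, e3⟩ := integral_cyclic i3
  obtain ⟨k4, e4⟩ := integral_cyclic k3
  have h : ∀ p : (ℝ × ℝ) × ℝ,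
      a p.1.1 * b p.1.2 * c p.2 * jacobiKernel η p.1.1 p.1.2 p.2 +
        b p.1.2 * c p.2 * a p.1.1 * jacobiKernel η p.1.2 p.2 p.1.1 +
        c p.2 * a p.1.1 * b p.1.2 * jacobiKernel η p.2 p.1.1 p.1.2 = 0 := fun p => by
    linear_combination (a p.1.1 * b p.1.2 * c p.2) * jacobiKernel_cyclic η p.1.1 p.1.2 p.2
  have j : MeasureTheory.Integrable fun p : (ℝ × ℝ) × ℝ =>
      a p.1.1 * b p.1.2 * c p.2 * jacobiKernel η p.1.1 p.1.2 p.2 +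
        b p.1.2 * c p.2 * a p.1.1 * jacobiKernel η p.1.2 p.2 p.1.1 := i1.add k2
  rw [← e2, ← e3, ← e4, ← MeasureTheory.integral_add i1 k2, ← MeasureTheory.integral_add j k4,
    integral_congr_fun h, MeasureTheory.integral_zero]

/-! ### The Jacobi identity for densities -/

theorem integral_mul_etaKernel {V W : Set ℝ} {η a b : ℝ → ℂ} (hη : Continuous η)
    (ha : IsTest V a) (hb : IsTest W b) :
    ∫ p : ℝ × ℝ, a p.1 * b p.2 * etaKernel η p.1 p.2 = ∫ x, a x * kernelInt η b x := by
  rw [MeasureTheory.Measure.volume_eq_prod ℝ ℝ,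
    MeasureTheory.integral_prod _ (integrable_mul_etaKernel hη ha hb)]
  refine integral_congr_fun fun x => ?_
  rw [kernelInt, ← MeasureTheory.integral_const_mul]
  exact integral_congr_fun fun y => by ring

theorem integrable_mul_kernelVar {V W : Set ℝ} {η ξ a b : ℝ → ℂ} (hη : Continuous η)
    (hξ : Continuous ξ) (ha : IsTest V a) (hb : IsTest W b) :
    MeasureTheory.Integrable fun p : ℝ × ℝ => a p.1 * b p.2 * kernelVar η ξ p.1 p.2 := by
  have hs := continuous_hasCompactSupport_prod ha hb
  have ca := ha.1.continuous
  have cb := hb.1.continuous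
  have i1 : MeasureTheory.Integrable fun p : ℝ × ℝ =>
      a p.1 * b p.2 * (2 * η p.1 * ξ p.1 - 2 * η p.2 * ξ p.2) :=
    Continuous.integrable_of_hasCompactSupport (by fun_prop) hs.mul_right
  have i2 : MeasureTheory.Integrable fun p : ℝ × ℝ =>
      a p.1 * b p.2 * (2 * (η p.1 - η p.2) * (ξ p.1 - ξ p.2)) :=
    Continuous.integrable_of_hasCompactSupport (by fun_prop) hs.mul_right
  have i3 := i2.bdd_mul measurable_sign_fst_sub_snd.aestronglyMeasurable
    (Filter.Eventually.of_forall fun _ => norm_sign_le _)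
  refine (i1.sub i3).congr (Filter.Eventually.of_forall fun p => ?_)
  simp only [kernelVar, Pi.sub_apply]
  ring

/-- The derivative of a bracket along a Hamiltonian vector field. -/
theorem hasDerivAt_bracket_hamVec {V K : Set ℝ} (hV : IsOpen V) (hK : IsCompact K) (hVK : V ⊆ K)
    {η : ℝ → ℂ} (hη : ContDiff ℝ ∞ η) {P Q : EtaField} (hP : RegularOn P η K)
    (hQ : RegularOn Q η K) {f g c : ℝ → ℂ} (hf : IsTest V f) (hg : IsTest V g) (hc : IsTest V c) :
    HasDerivAt (fun t : ℝ => bracket P Q (fun x => η x + t * kernelInt η c x) f g)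
      ((∫ x, gradVar P η (kernelInt η c) f x * hamVec Q η g x) -
        (∫ x, gradVar Q η (kernelInt η c) g x * hamVec P η f x) +
        ∫ p : ℝ × ℝ, grad P η f p.1 * grad Q η g p.2 *
          kernelVar η (kernelInt η c) p.1 p.2) 0 := by
  have hξ := contDiff_kernelInt hη hc
  obtain ⟨ε₁, hε₁, h1⟩ := exists_regularOn_add_mul hK hη hξ hP
  obtain ⟨ε₂, hε₂, h2⟩ := exists_regularOn_add_mul hK hη hξ hQ
  have hP' := hP.mono hVK
  have hQ' := hQ.mono hVK
  have hG := isTest_grad hV hη.contDiffOn hf hP'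
  have hH := isTest_grad hV hη.contDiffOn hg hQ'
  have hG' := isTest_gradVar hV hη.contDiffOn hξ hf hP'
  have hH' := isTest_gradVar hV hη.contDiffOn hξ hg hQ'
  refine (hasDerivAt_bracket hV hη hξ (lt_min hε₁ hε₂)
    (fun t ht => (h1 t (Set.Ioo_subset_Ioo (neg_le_neg (min_le_left _ _)) (min_le_left _ _) ht)).mono
      hVK)
    (fun t ht => (h2 t (Set.Ioo_subset_Ioo (neg_le_neg (min_le_right _ _))
      (min_le_right _ _) ht)).mono hVK) hf hg).congr_deriv ?_
  have i1 := integrable_mul_etaKernel hη.continuous hG' hH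
  have i2 := integrable_mul_etaKernel hη.continuous hG hH'
  have i3 := integrable_mul_kernelVar hη.continuous hξ.continuous hG hH
  have i12 : MeasureTheory.Integrable fun p : ℝ × ℝ =>
      gradVar P η (kernelInt η c) f p.1 * grad Q η g p.2 * etaKernel η p.1 p.2 +
        grad P η f p.1 * gradVar Q η (kernelInt η c) g p.2 * etaKernel η p.1 p.2 := i1.add i2
  simp only [add_mul]
  rw [MeasureTheory.integral_add i12 i3, MeasureTheory.integral_add i1 i2,
    integral_mul_etaKernel hη.continuous hG' hH, integral_mul_etaKernel hη.continuous hG hH',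
    kernelInt_skew hη.continuous hG hH']
  rfl

theorem contDiff_hamVec {V : Set ℝ} (hV : IsOpen V) {η : ℝ → ℂ} (hη : ContDiff ℝ ∞ η)
    {P : EtaField} (hP : RegularOn P η V) {f : ℝ → ℂ} (hf : IsTest V f) :
    ContDiff ℝ ∞ (hamVec P η f) :=
  contDiff_kernelInt hη (isTest_grad hV hη.contDiffOn hf hP)

/-- The second variation of each functional occurs twice, with its two arguments exchanged and
opposite signs, and cancels by symmetry. The three kernel terms cancel by
`integral_kernelVar_cyclic`. Regularity on a compact set keeps the densities regular along the
varied curves for small t. -/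
theorem bracket_jacobi_aux {V K : Set ℝ} (hV : IsOpen V) (hK : IsCompact K) (hVK : V ⊆ K)
    {η : ℝ → ℂ} (hη : ContDiff ℝ ∞ η) {P Q R : EtaField} (hP : RegularOn P η K)
    (hQ : RegularOn Q η K) (hR : RegularOn R η K) {f g h : ℝ → ℂ} (hf : IsTest V f)
    (hg : IsTest V g) (hh : IsTest V h) : ∃ j₁ j₂ j₃ : ℂ,
      HasDerivAt (fun t : ℝ => bracket P Q (fun x => η x + t * hamVec R η h x) f g) j₁ 0 ∧
      HasDerivAt (fun t : ℝ => bracket Q R (fun x => η x + t * hamVec P η f x) g h) j₂ 0 ∧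
      HasDerivAt (fun t : ℝ => bracket R P (fun x => η x + t * hamVec Q η g x) h f) j₃ 0 ∧
      j₁ + j₂ + j₃ = 0 := by
  have hP' := hP.mono hVK
  have hQ' := hQ.mono hVK
  have hR' := hR.mono hVK
  have tP := isTest_grad hV hη.contDiffOn hf hP'
  have tQ := isTest_grad hV hη.contDiffOn hg hQ'
  have tR := isTest_grad hV hη.contDiffOn hh hR'
  have xP := contDiff_hamVec hV hη hP' hf
  have xQ := contDiff_hamVec hV hη hQ' hg
  have xR := contDiff_hamVec hV hη hR' hh
  refine ⟨_, _, _, hasDerivAt_bracket_hamVec hV hK hVK hη hP hQ hf hg tR,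
    hasDerivAt_bracket_hamVec hV hK hVK hη hQ hR hg hh tP,
    hasDerivAt_bracket_hamVec hV hK hVK hη hR hP hh hf tQ, ?_⟩
  have hc := integral_kernelVar_cyclic hη.continuous tP tQ tR
  have sP := integral_gradVar_mul_comm hV hη.contDiffOn hP' hf xR xQ
  have sQ := integral_gradVar_mul_comm hV hη.contDiffOn hQ' hg xP xR
  have sR := integral_gradVar_mul_comm hV hη.contDiffOn hR' hh xQ xP
  simp only [← hamVec_eq_kernelInt] at hc ⊢
  linear_combination hc + sP + sQ + sR

theorem bracket_jacobi {U : Set ℝ} {η : ℝ → ℂ} (hU : IsOpen U) (hη : ContDiffOn ℝ ∞ η U)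
    {P Q R : EtaField} (hP : RegularOn P η U) (hQ : RegularOn Q η U) (hR : RegularOn R η U)
    {f g h : ℝ → ℂ} (hf : IsTest U f) (hg : IsTest U g) (hh : IsTest U h) : ∃ j₁ j₂ j₃ : ℂ,
      HasDerivAt (fun t : ℝ => bracket P Q (fun x => η x + t * hamVec R η h x) f g) j₁ 0 ∧
      HasDerivAt (fun t : ℝ => bracket Q R (fun x => η x + t * hamVec P η f x) g h) j₂ 0 ∧
      HasDerivAt (fun t : ℝ => bracket R P (fun x => η x + t * hamVec Q η g x) h f) j₃ 0 ∧
      j₁ + j₂ + j₃ = 0 := by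
  have hK := (hf.2.1.isCompact.union hg.2.1.isCompact).union hh.2.1.isCompact
  obtain ⟨W, ζ, hW, hKW, -, hWU, hζ, heqW⟩ := exists_global_curve hU hη hK
    (Set.union_subset (Set.union_subset hf.2.2 hg.2.2) hh.2.2)
  -- A second shrinking: regularity along the global curve ζ is known on W, and it is needed on a
  -- compact set containing V.
  obtain ⟨V, hV, hKV, hVW, hVc⟩ := exists_open_between_and_isCompact_closure hK hW hKW
  have heq := heqW.mono (subset_closure.trans hVW)
  have hf' := hf.of_subset ((Set.subset_union_left.trans Set.subset_union_left).trans hKV)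
  have hg' := hg.of_subset ((Set.subset_union_right.trans Set.subset_union_left).trans hKV)
  have hh' := hh.of_subset (Set.subset_union_right.trans hKV)
  have reg : ∀ {S : EtaField}, RegularOn S η U → RegularOn S ζ (closure V) := fun hS =>
    ((hS.mono (subset_closure.trans hWU)).congr hW heqW).mono hVW
  obtain ⟨j₁, j₂, j₃, h₁, h₂, h₃, hj⟩ := bracket_jacobi_aux hV hVc subset_closure hζ (reg hP)
    (reg hQ) (reg hR) hf' hg' hh'
  -- The Hamiltonian vector fields at η and ζ agree on V, so the varied curves agree there as well,
  -- for every t.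
  have key : ∀ (A B C : EtaField) (a b c : ℝ → ℂ), IsTest V a → IsTest V b → IsTest V c →
      (fun t : ℝ => bracket A B (fun x => η x + t * hamVec C η c x) a b) =
        fun t : ℝ => bracket A B (fun x => ζ x + t * hamVec C ζ c x) a b := by
    intro A B C a b c ha hb hc
    funext t
    refine bracket_congr hV (fun x hx => ?_) ha hb A B
    simp only [heq hx, hamVec_congr hV heq hc C hx]
  refine ⟨j₁, j₂, j₃, ?_, ?_, ?_, hj⟩
  · rwa [key P Q R f g h hf' hg' hh']
  · rwa [key Q R P g h f hg' hh' hf']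
  · rwa [key R P Q h f g hh' hf' hg']

theorem bracket_laws {U : Set ℝ} {η : ℝ → ℂ} (hU : IsOpen U) (hη : ContDiffOn ℝ ∞ η U)
    {P Q R : EtaField} (hP : RegularOn P η U) (hQ : RegularOn Q η U) (hR : RegularOn R η U)
    {f g h : ℝ → ℂ} (hf : IsTest U f) (hg : IsTest U g) (hh : IsTest U h) :
    bracket P Q η f g = -bracket Q P η g f ∧
      bracket (P * Q) R η f h =
        bracket P R η (fun x => f x * value Q η x) h +
          bracket Q R η (fun x => f x * value P η x) h := by
  obtain ⟨V, ζ, hV, hKV, -, hVU, hζ, heq⟩ := exists_global_curve hU hη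
    ((hf.2.1.isCompact.union hg.2.1.isCompact).union hh.2.1.isCompact)
    (Set.union_subset (Set.union_subset hf.2.2 hg.2.2) hh.2.2)
  have hVU' : V ⊆ U := subset_closure.trans hVU
  have hf' := hf.of_subset ((Set.subset_union_left.trans Set.subset_union_left).trans hKV)
  have hg' := hg.of_subset ((Set.subset_union_right.trans Set.subset_union_left).trans hKV)
  have hh' := hh.of_subset (Set.subset_union_right.trans hKV)
  have hP' := (hP.mono hVU').congr hV heq
  have hQ' := (hQ.mono hVU').congr hV heq
  have hR' := (hR.mono hVU').congr hV heq
  have eP : (fun x => f x * value P η x) = fun x => f x * value P ζ x :=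
    hf'.mul_congr fun x hx => value_congr hV heq hx P
  have eQ : (fun x => f x * value Q η x) = fun x => f x * value Q ζ x :=
    hf'.mul_congr fun x hx => value_congr hV heq hx Q
  constructor
  · rw [bracket_congr hV heq hf' hg', bracket_congr hV heq hg' hf',
      bracket_skew hV hζ hP' hQ' hf' hg']
  · rw [eP, eQ, bracket_congr hV heq hf' hh',
      bracket_congr hV heq (hf'.mul_value hV hζ.contDiffOn hQ') hh',
      bracket_congr hV heq (hf'.mul_value hV hζ.contDiffOn hP') hh',
      bracket_mul hV hζ hP' hQ' hR' hf' hh']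

end EtaTower

end

theorem mainTheorem3 :
    -- the action of G = SL(2, ℂ) on the differential field ℂ⟨η⟩
    (∀ g : SL2, ∃! σ : EtaField ≃ₐ[ℂ] EtaField, IsMoebius g σ) ∧
    -- the bracket on ℂ⟨η⟩ is skew, satisfies the Leibniz rule, is compatible with ∂, and satisfies
    -- the Jacobi identity
    (∀ (U : Set ℝ) (η : ℝ → ℂ), IsOpen U → ContDiffOn ℝ ∞ η U →
      ∀ P Q R : EtaField, RegularOn P η U → RegularOn Q η U → RegularOn R η U →
      ∀ f g h : ℝ → ℂ, IsTest U f → IsTest U g → IsTest U h →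
        bracket P Q η f g = -bracket Q P η g f ∧
        bracket (P * Q) R η f h =
          bracket P R η (fun x => f x * value Q η x) h +
            bracket Q R η (fun x => f x * value P η x) h ∧
        bracket (D P) Q η f g = -bracket P Q η (deriv f) g ∧
        ∃ j₁ j₂ j₃ : ℂ,
          HasDerivAt (fun t : ℝ => bracket P Q (fun x => η x + t * hamVec R η h x) f g) j₁ 0 ∧
          HasDerivAt (fun t : ℝ => bracket Q R (fun x => η x + t * hamVec P η f x) g h) j₂ 0 ∧
          HasDerivAt (fun t : ℝ => bracket R P (fun x => η x + t * hamVec Q η g x) h f) j₃ 0 ∧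
          j₁ + j₂ + j₃ = 0) ∧
    -- (i) the tower of differential fields, and its arrows
    (∀ S : Subgroup SL2, S = cartan ∨ S = unipotent ∨ S = borelLower ∨ S = ⊤ →
      (∀ P ∈ invariants S, D P ∈ invariants S) ∧ IsPoissonSubfield S) ∧
    invariants ⊤ ≤ invariants borelLower ∧
    invariants borelLower ≤ invariants cartan ∧
    invariants borelLower ≤ invariants unipotent ∧
    -- (ii) the basic bracket, from the wave functions and as a distribution
    (∀ a : ℝ → ℂ, (∀ x, a (-x) = -a x) → ∀ x y : ℝ,
      waveBracket a (etaAt x) (etaAt y) =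
        etaAt x ^ 2 - etaAt y ^ 2 -
          ((Real.sign (x - y) : ℝ) : ℂ) • (etaAt x - etaAt y) ^ 2) ∧
    (∀ (U : Set ℝ) (η : ℝ → ℂ), IsOpen U → ContDiffOn ℝ ∞ η U →
      ∀ f g : ℝ → ℂ, IsTest U f → IsTest U g →
        bracket eta eta η f g =
          ∫ x, ∫ y, f x * g y *
            (η x ^ 2 - η y ^ 2 - (Real.sign (x - y) : ℝ) * (η x - η y) ^ 2)) ∧
    -- (iii) the N-invariants
    invariants unipotent = diffAdjoin theta ∧
    AlgebraicIndependent ℂ (fun n : ℕ => D^[n] theta) ∧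
    (∀ (U : Set ℝ) (η : ℝ → ℂ), IsOpen U → ContDiffOn ℝ ∞ η U →
      ∀ f g : ℝ → ℂ, IsTest U f → IsTest U g →
        bracket theta theta η f g =
          ∫ x, ∫ y, f x * g y *
            (2 * (Real.sign (x - y) : ℝ) * value theta η x * value theta η y)) ∧
    -- (iv) the B-invariants
    vField = (1 / 2) * (D theta / theta) ∧
    invariants borelLower = diffAdjoin vField ∧
    (∀ (U : Set ℝ) (η : ℝ → ℂ), IsOpen U → ContDiffOn ℝ ∞ η U → (∀ x ∈ U, deriv η x ≠ 0) →
      ∀ f g : ℝ → ℂ, IsTest U f → IsTest U g →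
        bracket vField vField η f g =
          -(1 / 2) * deltaPairing 1 (fun x y => f x * g y)) ∧
    -- (v) the G-invariants
    uField = D vField - vField ^ 2 ∧
    invariants ⊤ = diffAdjoin uField ∧
    (∀ (U : Set ℝ) (η : ℝ → ℂ), IsOpen U → ContDiffOn ℝ ∞ η U → (∀ x ∈ U, deriv η x ≠ 0) →
      ∀ f g : ℝ → ℂ, IsTest U f → IsTest U g →
        bracket uField uField η f g =
          (1 / 2) * deltaPairing 3 (fun x y => f x * g y) +
            deltaPairing 1 (fun x y => f x * g y * (value uField η x + value uField η y))) := by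
  refine ⟨existsUnique_moebius, ?_, ?_, invariants_anti le_top,
    invariants_anti cartan_le_borelLower, invariants_anti unipotent_le_borelLower,
    fun a _ x y => waveBracket_etaAt a x y, fun _ η _ _ f g _ _ => bracket_eta η f g,
    invariants_unipotent, algebraicIndependent_theta,
    fun U η hU hη f g hf hg => bracket_theta hU hη hf hg, vField_eq, invariants_borelLower,
    fun U η hU hη h0 f g hf hg => bracket_vField hU hη h0 hf hg, uField_eq, invariants_top,
    fun U η hU hη h0 f g hf hg => bracket_uField hU hη h0 hf hg⟩
  · intro U η hU hη P Q R hP hQ hR f g h hf hg hh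
    obtain ⟨h1, h2⟩ := bracket_laws hU hη hP hQ hR hf hg hh
    exact ⟨h1, h2, bracket_D hU hη hP Q hf g, bracket_jacobi hU hη hP hQ hR hf hg hh⟩
  · exact fun S hS => ⟨fun _ => D_mem_invariants, isPoissonSubfield hS⟩
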